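/- Real simple eigenvalues. Let $G$ be a subgroup of $GL(d_0,\mathbb R)$. A periodic cocycle in $G$ with period $\ell\ge 1$ is a sequence $(A_i)_{i\in\mathbb Z}$ in $G$ with $A_{i+\ell}=A_i$ for all $i$. It is bounded by $C$ if $\max(\|A_i\|,\|A_i^{-1}\|)\le C$ for $1\le i\le \ell$ (operator norm for the Euclidean norm), and hyperbolic if $\mathcal A:=A_\ell\cdots A_1$ has no (complex) eigenvalue of modulus $1$. An $\varepsilon$-path of perturbations of $(A_i)$ in $G$ with the same period is a family $(A_i(t))_{t\in[0,1]}$ of periodic cocycles in $G$ with period $\ell$, each $A_i(t)$ continuous in $t$, such that $A_i(0)=A_i$ and $\max(\|A_i-A_i(t)\|,\|A_i^{-1}-A_i(t)^{-1}\|)<\varepsilon$ for all $i$ and all $t\in[0,1]$; put $\mathcal A(t):=A_\ell(t)\cdots A_1(t)$. For any $d_0\ge 1$, $C>1$ and $\varepsilon>0$ there exists $T\ge 1$ such that the following holds. Let $G$ be $GL(d_0,\mathbb R)$, or $SL(d_0,\mathbb R)$ with $d_0\ge 2$, or (when $d_0$ is even) $Sp(d_0,\mathbb R)$. Let $(A_i)$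 be a periodic cocycle in $G$, bounded by $C$, with period $\ell\ge T$; if $G=Sp(d_0,\mathbb R)$, assume moreover that it is hyperbolic. Then $(A_i)$ admits an $\varepsilon$-path of perturbations $(A_i(t))_{t\in[0,1]}$ in $G$ with the same period such that 1. $\mathcal A(t)$ is hyperbolic for every $t\in(0,1]$, except that in the case $G=SL(2,\mathbb R)$ this is asserted only when the eigenvalues of $\mathcal A(0)=A_\ell\cdots A_1$ are real; 2. $\mathcal A(1)$ has $d_0$ distinct real eigenvalues, all with modulus in $(0,1/2)\cup(2,+\infty)$. -/

import Mathlib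

open scoped Matrix Matrix.Norms.L2Operator

section Cocycles

variable {ι : Type*} [Fintype ι] [DecidableEq ι]

/-- `SL(ι, ℝ)` as a subgroup of `GL(ι, ℝ)`. -/
def slSubgroup (ι : Type*) [Fintype ι] [DecidableEq ι] : Subgroup (GL ι ℝ) :=
  (Matrix.GeneralLinearGroup.det : GL ι ℝ →* ℝˣ).ker

/-- `Sp(2d, ℝ)` as a subgroup of `GL(2d, ℝ)`: the invertible matrices preserving the standard
symplectic form of `ℝ^d × ℝ^d`. -/
def spSubgroup (d : ℕ) : Subgroup (GL (Fin d ⊕ Fin d) ℝ) :=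
  (Matrix.symplecticGroup (Fin d) ℝ).units

/-- `A` is a periodic cocycle in `G` with period `ℓ ≥ 1` (not necessarily the least one). -/
structure IsPeriodicCocycle (G : Subgroup (GL ι ℝ)) (ℓ : ℕ) (A : ℤ → GL ι ℝ) : Prop where
  one_le_period : 1 ≤ ℓ
  mem : ∀ i, A i ∈ G
  periodic : ∀ i, A (i + ℓ) = A i

/-- `cocycleProd A n = A_n ⋯ A_2 A_1`. -/
def cocycleProd (A : ℤ → GL ι ℝ) : ℕ → GL ι ℝ
  | 0 => 1
  | n + 1 => A ((n : ℤ) + 1) * cocycleProd A n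

/-- The cocycle with period `ℓ` is bounded by `C`; the norm is the operator norm
associated with the Euclidean norm. -/
def IsCocycleBoundedBy (C : ℝ) (ℓ : ℕ) (A : ℤ → GL ι ℝ) : Prop :=
  ∀ i : ℤ, 1 ≤ i → i ≤ ℓ →
    max ‖(A i : Matrix ι ι ℝ)‖ ‖((A i)⁻¹ : GL ι ℝ).val‖ ≤ C

/-- The set of all complex eigenvalues of a real matrix. -/
def complexEigenvalues (M : Matrix ι ι ℝ) : Set ℂ :=
  {z | Module.End.HasEigenvalue (Matrix.toLin' (M.map (algebraMap ℝ ℂ))) z}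

/-- The cocycle `A` with period `ℓ` is hyperbolic: the product over the period has no eigenvalue
on the unit circle. -/
def IsHyperbolicCocycle (ℓ : ℕ) (A : ℤ → GL ι ℝ) : Prop :=
  ∀ z ∈ complexEigenvalues (cocycleProd A ℓ : Matrix ι ι ℝ), ‖z‖ ≠ 1

/-- `P` is an `ε`-path of perturbations in `G`, with the same period `ℓ`, of the cocycle `A`. -/
structure IsPerturbationPath (G : Subgroup (GL ι ℝ)) (ε : ℝ) (ℓ : ℕ) (A : ℤ → GL ι ℝ)
    (P : unitInterval → ℤ → GL ι ℝ) : Prop where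
  cocycle : ∀ t, IsPeriodicCocycle G ℓ (P t)
  continuous : ∀ i, Continuous fun t => (P t i : Matrix ι ι ℝ)
  start : ∀ i, P 0 i = A i
  close : ∀ t i, max ‖(A i : Matrix ι ι ℝ) - (P t i : Matrix ι ι ℝ)‖
    ‖((A i)⁻¹ : GL ι ℝ).val - ((P t i)⁻¹ : GL ι ℝ).val‖ < ε

/-- The real matrix `M`, of size `d₀ = card ι`, has `d₀` distinct real eigenvalues, all with
modulus in `(0, 1/2) ∪ (2, ∞)`. -/
def HasFarSimpleRealSpectrum (M : Matrix ι ι ℝ) : Prop :=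
  ∃ v : ι → ℝ, Function.Injective v ∧
    ∀ j, Module.End.HasEigenvalue (Matrix.toLin' M) (v j) ∧
      |v j| ∈ Set.Ioo (0 : ℝ) (1 / 2) ∪ Set.Ioi 2

end Cocycles

/-! ### QR decompositions adapted to a block structure. -/

section OrthogonalTriangular

open Matrix Polynomial

/-! A perturbation of fixed small size repeated at each of `ℓ` steps has an effect of order `ℓ`
times that size on the product. For `ℓ` large this gives room to move the eigenvalues by any
prescribed bounded amount. Perturbations are written multiplicatively, as `X t n * a n` with `X t n`
close to `1`.

To control the spectrum, put the product in real Schur form: in an orthonormal basis it is block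
triangular, and each diagonal block has an irreducible characteristic polynomial, hence size one or
two and a single modulus of eigenvalues. Transporting the flag by QR (`exists_orthogonal_frames`)
makes every factor block triangular in orthonormal frames that close up after one period. The
diagonal blocks then multiply independently, and conjugating by the frames does not increase the
size of a perturbation. Two moves are available.

Rescaling (`exists_isDeformation_scale`): multiplying block `c` by `exp (t κ_c / ℓ)` at each step
multiplies its eigenvalues by `exp (t κ_c)`. If `κ_c` has the sign of the log modulus, no eigenvalue
meets the unit circle for `t > 0`. Generic `κ` separate the moduli of distinct blocks.

Rotating (`exists_rotatedProd_parabolic`): in a plane block with nonreal eigenvalues, all factors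
are turned by a small angle, in a sense following the orientation of the partial products. While the
block is elliptic, the arcsine of its normalized trace moves with speed at least `ℓ`, so ellipticity
is lost within angle `π / ℓ`. The eigenvalues become real with unchanged modulus.

For `GL`, rescale to become hyperbolic, rotate to make all eigenvalues real, and rescale again to
separate them. For `SL` the slopes must have sum zero, which requires at least two blocks; this
fails only in dimension two with nonreal eigenvalues. For `Sp`, the stable subspace of a hyperbolic
product is Lagrangian (`exists_lagrangian_stable`). The `GL` result is applied to the restriction to
it and extended by `diag (Y, (Y⁻¹)ᵀ)` in orthonormal symplectic frames, so the other eigenvalues are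
the inverses. -/

theorem exists_lowerTriangular_mul_mul_transpose_diag {n : Type*} [Fintype n] [LinearOrder n]
    {S : Matrix n n ℝ} (hS : S.PosDef) :
    ∃ L : Matrix n n ℝ, (∀ i j, i < j → L i j = 0) ∧
      (∀ i j, i ≠ j → (L * S * Lᵀ) i j = 0) ∧ ∀ i, 0 < (L * S * Lᵀ) i i := by
  classical
  let : LocallyFiniteOrderBot n := LocallyFiniteOrderBot.ofIic n (fun a => {x | x ≤ a}) (by simp)
  have hd := LDL.diag_eq_lowerInv_conj hS
  rw [conjTranspose_eq_transpose_of_trivial] at hd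
  refine ⟨LDL.lowerInv hS, fun i j hij => LDL.lowerInv_triangular hS hij, fun i j hij => ?_,
    fun i => ?_⟩
  · rw [← hd, LDL.diag, diagonal_apply_ne _ hij]
  · have h2 : (LDL.lowerInv hS * S * (LDL.lowerInv hS)ᴴ).PosDef := by
      refine hS.mul_mul_conjTranspose_same ?_
      exact Matrix.vecMul_injective_of_isUnit (isUnit_of_invertible _)
    simpa using h2.diag_pos (i := i)

variable {ι : Type*} [Fintype ι] [DecidableEq ι]

theorem blockTriangular_val_inv {g : GL ι ℝ} {b : ι → ℕ} (hg : (g : Matrix ι ι ℝ).BlockTriangular b) :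
    ((g⁻¹ : GL ι ℝ) : Matrix ι ι ℝ).BlockTriangular b := by
  let : Invertible (g : Matrix ι ι ℝ) := g.invertible
  rw [coe_units_inv]
  exact blockTriangular_inv_of_blockTriangular hg

/-- Gram–Schmidt orthonormalization of the columns of `V`, adapted to a block structure `b`. -/
theorem exists_blockTriangular_mul_orthonormal {m : Type*} [Fintype m] {V : Matrix m ι ℝ}
    (hV : Function.Injective V.mulVec) (b : ι → ℕ) :
    ∃ K : GL ι ℝ, K.val.BlockTriangular b ∧ (V * K.val)ᵀ * (V * K.val) = 1 := by
  have hS : (Vᵀ * V).PosDef := by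
    have := Matrix.PosDef.conjTranspose_mul_self V hV
    rwa [conjTranspose_eq_transpose_of_trivial] at this
  obtain ⟨L, hL0, hLo, hLd⟩ : ∃ L : Matrix ι ι ℝ, (∀ i j, b i < b j → L i j = 0) ∧
      (∀ i j, i ≠ j → (L * (Vᵀ * V) * Lᵀ) i j = 0) ∧ ∀ i, 0 < (L * (Vᵀ * V) * Lᵀ) i i := by
    let e := Fintype.equivFin ι
    -- The block label is compared first and `e` only breaks ties, so triangular for this order
    -- implies block triangular for `b`.
    let : LinearOrder ι := LinearOrder.lift' (fun x => toLex (b x, e x)) (fun x y h => by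
      have h2 := congrArg (fun z => (ofLex z).2) h
      exact e.injective h2)
    obtain ⟨L, h1, h2, h3⟩ := exists_lowerTriangular_mul_mul_transpose_diag hS
    refine ⟨L, fun i j hij => h1 i j ?_, h2, h3⟩
    change toLex (b i, e i) < toLex (b j, e j)
    exact Prod.Lex.toLex_lt_toLex.2 (Or.inl hij)
  set d : ι → ℝ := fun i => (Real.sqrt ((L * (Vᵀ * V) * Lᵀ) i i))⁻¹
  have hQ : (V * (Lᵀ * diagonal d))ᵀ * (V * (Lᵀ * diagonal d)) = 1 := by
    have : (V * (Lᵀ * diagonal d))ᵀ * (V * (Lᵀ * diagonal d))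
        = diagonal d * (L * (Vᵀ * V) * Lᵀ) * diagonal d := by
      simp only [transpose_mul, transpose_transpose, diagonal_transpose, Matrix.mul_assoc]
    rw [this]
    ext i j
    rw [mul_diagonal, diagonal_mul]
    by_cases hij : i = j
    · subst hij
      have := Real.mul_self_sqrt (hLd i).le
      have h0 := (Real.sqrt_pos.2 (hLd i)).ne'
      simp only [d, one_apply_eq]
      field_simp
      rw [pow_two, this]
    · rw [hLo i j hij, one_apply_ne hij]; simp
  have hK : (V * (Lᵀ * diagonal d))ᵀ * V * (Lᵀ * diagonal d) = 1 := by
    rw [Matrix.mul_assoc, hQ]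
  exact ⟨⟨_, _, mul_eq_one_comm.1 hK, hK⟩,
    BlockTriangular.mul (fun i j hij => hL0 j i hij) (blockTriangular_diagonal d), hQ⟩

/-- QR decomposition, adapted to a block structure `b`. -/
theorem exists_orthogonal_mul_blockTriangular (P : GL ι ℝ) (b : ι → ℕ) :
    ∃ Q R : GL ι ℝ, (Q : Matrix ι ι ℝ)ᵀ * (Q : Matrix ι ι ℝ) = 1 ∧
      (R : Matrix ι ι ℝ).BlockTriangular b ∧ P = Q * R := by
  obtain ⟨K, hK, hPK⟩ := exists_blockTriangular_mul_orthonormal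
    (Matrix.mulVec_injective_of_isUnit P.isUnit) b
  exact ⟨P * K, K⁻¹, hPK, blockTriangular_val_inv hK, by group⟩

/-- An intermediate index outside block `c` makes one of the two factors vanish by triangularity.
This is what allows each diagonal block to be treated as a sequence of its own. -/
theorem toSquareBlock_mul {M N : Matrix ι ι ℝ} {b : ι → ℕ} (hM : M.BlockTriangular b)
    (hN : N.BlockTriangular b) (c : ℕ) :
    (M * N).toSquareBlock b c = M.toSquareBlock b c * N.toSquareBlock b c := by
  ext ⟨x, hx⟩ ⟨y, hy⟩
  simp only [toSquareBlock_def, of_apply, mul_apply]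
  rw [← Finset.sum_subtype (Finset.univ.filter (fun a => b a = c)) (by simp)
    (fun z => M x z * N z y)]
  refine (Finset.sum_filter_of_ne fun z _ hz => ?_).symm
  by_contra hzc
  rcases lt_or_gt_of_ne hzc with h | h
  · exact hz (by rw [hM (by rwa [hx]), zero_mul])
  · exact hz (by rw [hN (by rwa [hy]), mul_zero])

end OrthogonalTriangular

/-! ### Moduli of the roots of a real irreducible polynomial. -/

section RealPolynomials

open Polynomial

/-- Up to a scalar `p` is the minimal polynomial of both roots, and it divides `(X - z)(X - z̄)`, so
`w` is `z` or its conjugate. -/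
theorem norm_eq_of_irreducible {p : ℝ[X]} (hp : Irreducible p) {z w : ℂ} (hz : aeval z p = 0)
    (hw : aeval w p = 0) : ‖w‖ = ‖z‖ := by
  have h1 := minpoly.eq_of_irreducible hp hz
  have h2 := minpoly.eq_of_irreducible hp hw
  have h3 : aeval w (minpoly ℝ z) = 0 := by rw [← h1, h2, minpoly.aeval]
  have h4 : minpoly ℝ z ∣ X ^ 2 - C (2 * z.re) * X + C (‖z‖ ^ 2) := by
    refine minpoly.dvd ℝ z ?_
    have : (z - z) * (z - (starRingEnd ℂ) z) = z ^ 2 - (z + (starRingEnd ℂ) z) * z +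
      z * (starRingEnd ℂ) z := by ring
    rw [Complex.add_conj, Complex.mul_conj', sub_self, zero_mul] at this
    simp only [map_add, map_sub, map_mul, map_pow, aeval_X, aeval_C]
    simpa using this.symm
  obtain ⟨q, hq⟩ := h4
  have h5 : aeval w (X ^ 2 - C (2 * z.re) * X + C (‖z‖ ^ 2) : ℝ[X]) = 0 := by
    rw [hq, map_mul, h3, zero_mul]
  have h6 : (w - z) * (w - (starRingEnd ℂ) z) = 0 := by
    have : (w - z) * (w - (starRingEnd ℂ) z) = w ^ 2 - (z + (starRingEnd ℂ) z) * w +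
      z * (starRingEnd ℂ) z := by ring
    rw [this, Complex.add_conj, Complex.mul_conj']
    simpa using h5
  rcases mul_eq_zero.1 h6 with h | h
  · rw [sub_eq_zero.1 h]
  · rw [sub_eq_zero.1 h, RCLike.norm_conj]

end RealPolynomials

/-! ### Invariant lines and planes of a real matrix. -/

section Schur

open Matrix Polynomial

/-- The vectors are the real and imaginary parts of a complex eigenvector for the eigenvalue `s + i
t`. -/
theorem exists_eigenvector_re_im {ι : Type*} [Fintype ι] [DecidableEq ι] [Nonempty ι]
    (M : Matrix ι ι ℝ) :
    ∃ (s t : ℝ) (x y : ι → ℝ), (x ≠ 0 ∨ y ≠ 0) ∧ M *ᵥ x = s • x - t • y ∧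
      M *ᵥ y = t • x + s • y := by
  obtain ⟨z, hz⟩ := Module.End.exists_eigenvalue (Matrix.toLin' (M.map (algebraMap ℝ ℂ)))
  obtain ⟨v, hv, hv0⟩ := hz.exists_hasEigenvector
  have hv1 : (M.map (algebraMap ℝ ℂ)) *ᵥ v = z • v := by
    simpa using Module.End.mem_eigenspace_iff.1 hv
  refine ⟨z.re, z.im, fun i => (v i).re, fun i => (v i).im, ?_, ?_, ?_⟩
  · by_contra! h
    refine hv0 (funext fun i => Complex.ext ?_ ?_)
    · exact congrFun h.1 i
    · exact congrFun h.2 i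
  · ext i
    have := congrArg Complex.re (congrFun hv1 i)
    simpa [mulVec, dotProduct] using this
  · ext i
    have := congrArg Complex.im (congrFun hv1 i)
    simp [mulVec, dotProduct] at this ⊢
    linarith

/-- A real matrix is similar to a block triangular one whose first diagonal block has an
irreducible characteristic polynomial. -/
theorem exists_similar_fromBlocks_irreducible {ι : Type*} [Fintype ι] [DecidableEq ι] [Nonempty ι]
    (M : Matrix ι ι ℝ) :
    ∃ (k : ℕ) (v : Fin k → ι → ℝ) (B : Matrix (Fin k) (Fin k) ℝ), LinearIndependent ℝ v ∧
      0 < k ∧ Irreducible B.charpoly ∧ ∀ j, M *ᵥ v j = ∑ i, B i j • v i := by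
  obtain ⟨s, t, x, y, hxy, hx, hy⟩ := exists_eigenvector_re_im M
  by_cases ht : t = 0
  · obtain ⟨u, hu, hMu⟩ : ∃ u, u ≠ 0 ∧ M *ᵥ u = s • u := by
      rcases hxy with h | h
      · exact ⟨x, h, by simp [hx, ht]⟩
      · exact ⟨y, h, by simp [hy, ht]⟩
    refine ⟨1, ![u], !![s], ?_, one_pos, ?_, ?_⟩
    · rw [linearIndependent_unique_iff]; simpa
    · have : (!![s] : Matrix (Fin 1) (Fin 1) ℝ).charpoly = X - C s := by
        simp [charpoly, charmatrix]
      rw [this]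
      exact irreducible_X_sub_C s
    · intro j
      fin_cases j
      simpa using hMu
  · refine ⟨2, ![x, y], !![s, t; -t, s], ?_, two_pos, ?_, ?_⟩
    · rw [LinearIndependent.pair_iff]
      intro a c hac
      have h1 : M *ᵥ (a • x + c • y) = 0 := by rw [hac, mulVec_zero]
      rw [mulVec_add, mulVec_smul, mulVec_smul, hx, hy] at h1
      -- Applying `M` to the relation `a x + c y = 0` and subtracting `s` times it leaves `t (c x -
      -- a y) = 0`. The two relations together give `(a² + c²) x = (a² + c²) y = 0`.
      have h2 : ∀ i, c * x i = a * y i := fun i => by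
        have e1 := congrFun h1 i
        have e2 := congrFun hac i
        simp at e1 e2
        have : t * (c * x i - a * y i) = 0 := by linear_combination e1 - s * e2
        rcases mul_eq_zero.1 this with h | h
        · exact absurd h ht
        · linarith
      have h3 : ∀ i, (a ^ 2 + c ^ 2) * x i = 0 ∧ (a ^ 2 + c ^ 2) * y i = 0 := fun i => by
        have e2 := congrFun hac i
        simp at e2
        exact ⟨by linear_combination a * e2 + c * h2 i, by linear_combination c * e2 - a * h2 i⟩
      have h4 : a ^ 2 + c ^ 2 = 0 := by
        by_contra h
        rcases hxy with h5 | h5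
        · exact h5 (funext fun i => (mul_eq_zero.1 (h3 i).1).resolve_left h)
        · exact h5 (funext fun i => (mul_eq_zero.1 (h3 i).2).resolve_left h)
      constructor <;> nlinarith [sq_nonneg a, sq_nonneg c]
    · have hdeg : (!![s, t; -t, s] : Matrix (Fin 2) (Fin 2) ℝ).charpoly.natDegree = 2 := by
        rw [charpoly_natDegree_eq_dim]; simp
      rw [Polynomial.irreducible_iff_roots_eq_zero_of_degree_le_three (by omega) (by omega)]
      refine Multiset.eq_zero_of_forall_notMem fun r hr => ?_
      have hr' := (Polynomial.mem_roots'.1 hr).2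
      rw [IsRoot.def, charpoly_fin_two] at hr'
      simp [trace_fin_two, det_fin_two] at hr'
      nlinarith [sq_nonneg (r - s), sq_pos_of_ne_zero ht]
    · intro j
      fin_cases j
      · simp [hx, sub_eq_add_neg]
      · simp [hy]

end Schur

/-! ### Real Schur form. -/

section Schur

open Matrix Polynomial

theorem charpoly_toSquareBlock_sumElim_zero {m κ : Type*} [Fintype m] [Fintype κ] [DecidableEq m]
    [DecidableEq κ] {ι : Type*} [Fintype ι] [DecidableEq ι] (e : ι ≃ m ⊕ κ)
    (B : Matrix m m ℝ) (E : Matrix m κ ℝ) (F : Matrix κ m ℝ) (D : Matrix κ κ ℝ) (b : κ → ℕ) :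
    (((fromBlocks B E F D).submatrix e e).toSquareBlock
      (fun x => Sum.elim (fun _ => 0) (fun y => b y + 1) (e x)) 0).charpoly = B.charpoly := by
  let g : m → {x // Sum.elim (fun _ => 0) (fun y => b y + 1) (e x) = 0} :=
    fun i => ⟨e.symm (Sum.inl i), by simp⟩
  have hg : Function.Bijective g := by
    refine ⟨fun i j h => ?_, fun ⟨x, hx⟩ => ?_⟩
    · simpa [g] using congrArg (fun z => e z.1) h
    · rcases h : e x with i | y
      · exact ⟨i, Subtype.ext (by simp [g, ← h])⟩
      · rw [h] at hx; simp at hx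
  let f := (Equiv.ofBijective g hg).symm
  rw [← charpoly_reindex f]
  congr 1
  ext i j
  change fromBlocks B E F D (e (e.symm (Sum.inl i))) (e (e.symm (Sum.inl j))) = _
  simp

theorem charpoly_toSquareBlock_sumElim_succ {m κ : Type*} [Fintype m] [Fintype κ] [DecidableEq m]
    [DecidableEq κ] {ι : Type*} [Fintype ι] [DecidableEq ι] (e : ι ≃ m ⊕ κ)
    (B : Matrix m m ℝ) (E : Matrix m κ ℝ) (F : Matrix κ m ℝ) (D : Matrix κ κ ℝ) (b : κ → ℕ)
    (c : ℕ) :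
    (((fromBlocks B E F D).submatrix e e).toSquareBlock
      (fun x => Sum.elim (fun _ => 0) (fun y => b y + 1) (e x)) (c + 1)).charpoly =
      (D.toSquareBlock b c).charpoly := by
  let g : {y // b y = c} → {x // Sum.elim (fun _ => 0) (fun y => b y + 1) (e x) = c + 1} :=
    fun y => ⟨e.symm (Sum.inr y.1), by simp [y.2]⟩
  have hg : Function.Bijective g := by
    refine ⟨fun i j h => ?_, fun ⟨x, hx⟩ => ?_⟩
    · simpa [g, Subtype.ext_iff] using congrArg (fun z => e z.1) h
    · rcases h : e x with i | y
      · rw [h] at hx; simp at hx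
      · rw [h] at hx
        exact ⟨⟨y, by simpa using hx⟩, Subtype.ext (by simp [g, ← h])⟩
  let f := (Equiv.ofBijective g hg).symm
  rw [← charpoly_reindex f]
  congr 1
  ext i j
  change fromBlocks B E F D (e (e.symm (Sum.inr i.1))) (e (e.symm (Sum.inr j.1))) = _
  simp [toSquareBlock_def]

/-- Induction on the dimension: a basis of an invariant subspace with irreducible characteristic
polynomial is completed, and the induction hypothesis is applied to the quotient block `D`, whose
labels are shifted by one to free the label `0`. Only labels in the image of `b` are constrained,
since an empty block has characteristic polynomial `1`. -/
theorem exists_similar_blockTriangular.{u} (n : ℕ) : ∀ (ι : Type u) [Fintype ι] [DecidableEq ι]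
    (M : Matrix ι ι ℝ), Fintype.card ι = n → ∃ (U V : Matrix ι ι ℝ) (b : ι → ℕ), U * V = 1 ∧
      (V * M * U).BlockTriangular b ∧
      ∀ c ∈ Finset.univ.image b, Irreducible ((V * M * U).toSquareBlock b c).charpoly := by
  induction n using Nat.strong_induction_on with
  | _ n ih =>
  intro ι _ _ M hn
  rcases isEmpty_or_nonempty ι with hι | hι
  · exact ⟨1, 1, fun _ => 0, by simp, fun i => (hι.false i).elim, by simp⟩
  obtain ⟨k, v, B, hv, hk, hB, hMv⟩ := exists_similar_fromBlocks_irreducible M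
  let w := Module.Basis.sumExtend hv
  have hwv : ∀ j, w (Sum.inl j) = v j := fun j => by
    simp [w, Module.Basis.sumExtend]
    rfl
  let κ : Type u := Module.Basis.sumExtendIndex hv
  change Module.Basis (Fin k ⊕ κ) ℝ (ι → ℝ) at w
  have hfin : Finite (Fin k ⊕ κ) := Module.Finite.finite_basis w
  have hfinκ : Finite κ := Finite.of_injective (Sum.inr : κ → Fin k ⊕ κ) Sum.inr_injective
  have := Fintype.ofFinite κ
  classical
  let e : ι ≃ Fin k ⊕ κ := (Pi.basisFun ℝ ι).indexEquiv w
  set U : Matrix ι (Fin k ⊕ κ) ℝ := (Pi.basisFun ℝ ι).toMatrix w with hU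
  set V : Matrix (Fin k ⊕ κ) ι ℝ := w.toMatrix (Pi.basisFun ℝ ι) with hV
  have hUV : U * V = 1 := Module.Basis.toMatrix_mul_toMatrix_flip _ _
  have hVU : V * U = 1 := Module.Basis.toMatrix_mul_toMatrix_flip _ _
  have hUe : ∀ i j, U i j = w j i := fun i j => by simp [hU, Module.Basis.toMatrix_apply]
  have hN : ∃ (E : Matrix (Fin k) κ ℝ) (D : Matrix κ κ ℝ), V * M * U = fromBlocks B E 0 D := by
    have h1 : M * U * (fromRows (1 : Matrix (Fin k) (Fin k) ℝ) (0 : Matrix κ (Fin k) ℝ)) =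
        U * fromRows B (0 : Matrix κ (Fin k) ℝ) := by
      ext i j
      have h2 := congrFun (hMv j) i
      simp only [mulVec, dotProduct, Finset.sum_apply, Pi.smul_apply, smul_eq_mul] at h2
      have h3 : ∀ i j, (U * (fromRows (1 : Matrix (Fin k) (Fin k) ℝ) (0 : Matrix κ (Fin k) ℝ))) i j = v j i := by
        intro i j
        simp [mul_apply, Fintype.sum_sum_type, one_apply, hUe, hwv]
      rw [Matrix.mul_assoc, mul_apply]
      simp only [h3]
      rw [h2]
      simp [mul_apply, hUe, hwv, mul_comm]
    have h2 : V * M * U * (fromRows (1 : Matrix (Fin k) (Fin k) ℝ) (0 : Matrix κ (Fin k) ℝ)) =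
        fromRows B (0 : Matrix κ (Fin k) ℝ) := by
      rw [Matrix.mul_assoc V, Matrix.mul_assoc V, h1, ← Matrix.mul_assoc, hVU, Matrix.one_mul]
    have h3 : ∀ i j, (V * M * U) i (Sum.inl j) = fromRows B (0 : Matrix κ (Fin k) ℝ) i j := by
      intro i j
      rw [← h2]
      simp [mul_apply (M := V * M * U), one_apply]
    refine ⟨(V * M * U).toBlocks₁₂, (V * M * U).toBlocks₂₂, ?_⟩
    ext (i | i) (j | j) <;> simp [h3] <;> rfl
  obtain ⟨E, D, hN⟩ := hN
  have hcard : Fintype.card κ < n := by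
    have := Fintype.card_congr e
    rw [Fintype.card_sum, Fintype.card_fin] at this
    omega
  obtain ⟨U', V', b, hUV', hT, hirr⟩ := ih _ hcard κ D rfl
  let F : Matrix (Fin k ⊕ κ) (Fin k ⊕ κ) ℝ := fromBlocks 1 0 0 U'
  let F' : Matrix (Fin k ⊕ κ) (Fin k ⊕ κ) ℝ := fromBlocks 1 0 0 V'
  have hVMU : ((F' * V).submatrix e id) * M *
      ((U * F).submatrix id e) =
      (fromBlocks B (E * U') 0 (V' * D * U')).submatrix e e := by
    have h4 : F' * V * M * (U * F) =
        fromBlocks B (E * U') 0 (V' * D * U') := by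
      calc _ = F' * (V * M * U) * F := by
            simp only [Matrix.mul_assoc]
        _ = _ := by rw [hN]; simp [F, F', fromBlocks_multiply]
    rw [← h4]
    rfl
  refine ⟨(U * F).submatrix id e, (F' * V).submatrix e id,
    fun x => Sum.elim (fun _ => 0) (fun y => b y + 1) (e x), ?_, ?_, ?_⟩
  · rw [submatrix_mul_equiv]
    have : U * F * (F' * V) = 1 := by
      calc _ = U * (F * F') * V := by
            simp only [Matrix.mul_assoc]
        _ = 1 := by simp [F, F', fromBlocks_multiply, hUV', hUV]
    rw [this, submatrix_id_id]
  · rw [hVMU]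
    intro x y hxy
    rw [submatrix_apply]
    rcases hi : e x with i | i <;> rcases hj : e y with j | j <;> simp [hi, hj] at hxy ⊢
    exact hT hxy
  · rw [hVMU]
    intro c hc
    rcases c with _ | c
    · rw [charpoly_toSquareBlock_sumElim_zero]; exact hB
    · rw [charpoly_toSquareBlock_sumElim_succ]
      refine hirr c ?_
      simp only [Finset.mem_image, Finset.mem_univ, true_and] at hc ⊢
      obtain ⟨x, hx⟩ := hc
      rcases h : e x with i | i
      · rw [h] at hx; simp at hx
      · rw [h] at hx; exact ⟨i, by simpa using hx⟩

variable {ι : Type*} [Fintype ι] [DecidableEq ι]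

theorem charpoly_mul_mul_of_mul_eq_one {M U V : Matrix ι ι ℝ} (h : U * V = 1) :
    (V * M * U).charpoly = M.charpoly := by
  rw [charpoly_mul_comm, ← Matrix.mul_assoc, h, Matrix.one_mul]

/-- Each diagonal block is merely conjugated by the corresponding block of `R`. Hence the similarity
to triangular form can be replaced by its orthogonal QR factor. -/
theorem charpoly_toSquareBlock_conj {N : Matrix ι ι ℝ} {b : ι → ℕ} (hN : N.BlockTriangular b)
    {R : GL ι ℝ} (hR : (R : Matrix ι ι ℝ).BlockTriangular b) (c : ℕ) :
    (((R : Matrix ι ι ℝ) * N * ((R⁻¹ : GL ι ℝ) : Matrix ι ι ℝ)).toSquareBlock b c).charpoly =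
      (N.toSquareBlock b c).charpoly := by
  have hR' := blockTriangular_val_inv hR
  rw [toSquareBlock_mul (hR.mul hN) hR', toSquareBlock_mul hR hN]
  apply charpoly_mul_mul_of_mul_eq_one
  rw [← toSquareBlock_mul hR' hR, Units.inv_mul]
  ext i j
  simp [toSquareBlock_def, one_apply, Subtype.ext_iff]

/-- Real Schur form. -/
theorem exists_orthogonal_blockTriangular (M : Matrix ι ι ℝ) :
    ∃ (Q : GL ι ℝ) (b : ι → ℕ), (Q : Matrix ι ι ℝ)ᵀ * (Q : Matrix ι ι ℝ) = 1 ∧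
      (((Q⁻¹ : GL ι ℝ) : Matrix ι ι ℝ) * M * (Q : Matrix ι ι ℝ)).BlockTriangular b ∧
      ∀ c ∈ Finset.univ.image b, Irreducible
        ((((Q⁻¹ : GL ι ℝ) : Matrix ι ι ℝ) * M * (Q : Matrix ι ι ℝ)).toSquareBlock b c).charpoly := by
  obtain ⟨U, V, b, hUV, hT, hirr⟩ := exists_similar_blockTriangular _ ι M rfl
  let P : GL ι ℝ := ⟨U, V, hUV, mul_eq_one_comm.1 hUV⟩
  obtain ⟨Q, R, hQ, hR, hP⟩ := exists_orthogonal_mul_blockTriangular P b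
  have key : ((Q⁻¹ : GL ι ℝ) : Matrix ι ι ℝ) * M * (Q : Matrix ι ι ℝ) =
      (R : Matrix ι ι ℝ) * (V * M * U) * ((R⁻¹ : GL ι ℝ) : Matrix ι ι ℝ) := by
    have h1 : Q⁻¹ = R * P⁻¹ := by rw [hP]; group
    have h2 : Q = P * R⁻¹ := by rw [hP]; group
    have h3 : (Q : Matrix ι ι ℝ) = U * ((R⁻¹ : GL ι ℝ) : Matrix ι ι ℝ) := by
      conv_lhs => rw [h2]
      rfl
    have h4 : ((Q⁻¹ : GL ι ℝ) : Matrix ι ι ℝ) = (R : Matrix ι ι ℝ) * V := by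
      rw [h1]; rfl
    rw [h3, h4]
    simp only [Matrix.mul_assoc]
  refine ⟨Q, b, hQ, ?_, fun c hc => ?_⟩
  · rw [key]; exact (hR.mul hT).mul (blockTriangular_val_inv hR)
  · rw [key, charpoly_toSquareBlock_conj hT hR]; exact hirr c hc

end Schur

/-! ### Small multiplicative deformations and rescaling of blocks. -/

section Deformations

open Matrix Polynomial

variable {ι : Type*} [Fintype ι] [DecidableEq ι]

/-- `seqProd a n = a (n - 1) ⋯ a 1 a 0`. -/
def seqProd {M : Type*} [Monoid M] (a : ℕ → M) : ℕ → M
  | 0 => 1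
  | n + 1 => a n * seqProd a n

/-- `X` and its inverse are within `exp δ - 1` of the identity. -/
def NearOne (δ : ℝ) (X : GL ι ℝ) : Prop :=
  ‖(X : Matrix ι ι ℝ) - 1‖ ≤ Real.exp δ - 1 ∧
    ‖((X⁻¹ : GL ι ℝ) : Matrix ι ι ℝ) - 1‖ ≤ Real.exp δ - 1

/-- A path `t ↦ X t * a` of multiplicative perturbations in `G` of a sequence `a`, of size `δ`, such
that the characteristic polynomial of the product over `ℓ` steps satisfies `H` for `0 < t ≤ 1`. -/
structure IsDeformation (G : Subgroup (GL ι ℝ)) (δ : ℝ) (ℓ : ℕ) (a : ℕ → GL ι ℝ)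
    (H : ℝ[X] → Prop) (X : ℝ → ℕ → GL ι ℝ) : Prop where
  continuous : ∀ n, Continuous fun t => X t n
  zero : X 0 = 1
  mem : ∀ t n, X t n ∈ G
  near : ∀ t ∈ Set.Icc (0 : ℝ) 1, ∀ n, NearOne δ (X t n)
  prop : ∀ t ∈ Set.Ioc (0 : ℝ) 1, H (seqProd (X t * a) ℓ).val.charpoly

/-- Measuring size by `exp δ - 1` makes the `δ` add exactly under products, because `uv + u + v =
exp (δ₁ + δ₂) - 1` for `u = exp δ₁ - 1` and `v = exp δ₂ - 1`. -/
theorem norm_mul_sub_one_le {A B : Matrix ι ι ℝ} {δ₁ δ₂ : ℝ} (hA : ‖A - 1‖ ≤ Real.exp δ₁ - 1)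
    (hB : ‖B - 1‖ ≤ Real.exp δ₂ - 1) : ‖A * B - 1‖ ≤ Real.exp (δ₁ + δ₂) - 1 := by
  have h : A * B - 1 = (A - 1) * (B - 1) + (A - 1) + (B - 1) := by noncomm_ring
  have h1 := norm_mul_le (A - 1) (B - 1)
  have h2 : ‖A - 1‖ * ‖B - 1‖ ≤ (Real.exp δ₁ - 1) * (Real.exp δ₂ - 1) :=
    mul_le_mul hA hB (norm_nonneg _) ((norm_nonneg _).trans hA)
  rw [h, Real.exp_add]
  linarith [norm_add_le ((A - 1) * (B - 1) + (A - 1)) (B - 1),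
    norm_add_le ((A - 1) * (B - 1)) (A - 1)]

theorem NearOne.mul {δ₁ δ₂ : ℝ} {X Y : GL ι ℝ} (hX : NearOne δ₁ X) (hY : NearOne δ₂ Y) :
    NearOne (δ₁ + δ₂) (X * Y) := by
  refine ⟨norm_mul_sub_one_le hX.1 hY.1, ?_⟩
  rw [_root_.mul_inv_rev, add_comm]
  exact norm_mul_sub_one_le hY.2 hX.2

theorem NearOne.mono {δ₁ δ₂ : ℝ} (h : δ₁ ≤ δ₂) {X : GL ι ℝ} (hX : NearOne δ₁ X) :
    NearOne δ₂ X := by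
  have := Real.exp_le_exp.2 h
  exact ⟨by linarith [hX.1], by linarith [hX.2]⟩

theorem IsDeformation.mono {G : Subgroup (GL ι ℝ)} {δ₁ δ₂ : ℝ} {ℓ : ℕ} {a : ℕ → GL ι ℝ}
    {H₁ H₂ : ℝ[X] → Prop} {X : ℝ → ℕ → GL ι ℝ} (hX : IsDeformation G δ₁ ℓ a H₁ X)
    (hδ : δ₁ ≤ δ₂) (hH : ∀ p, H₁ p → H₂ p) : IsDeformation G δ₂ ℓ a H₂ X :=
  ⟨hX.continuous, hX.zero, hX.mem, fun t ht n => (hX.near t ht n).mono hδ,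
    fun t ht => hH _ (hX.prop t ht)⟩

theorem IsDeformation.mono_group {G G' : Subgroup (GL ι ℝ)} {δ : ℝ} {ℓ : ℕ} {a : ℕ → GL ι ℝ}
    {H : ℝ[X] → Prop} {X : ℝ → ℕ → GL ι ℝ} (hX : IsDeformation G δ ℓ a H X)
    (hG : G ≤ G') : IsDeformation G' δ ℓ a H X :=
  ⟨hX.continuous, hX.zero, fun t n => hG (hX.mem t n), hX.near, hX.prop⟩

/-- The path `X` is run on `[0, 1/2]` and `Y` on `[1/2, 1]`, the clamped parameters freezing the
inactive one. At the junction `H` comes from `X` at its end, so it holds on all of `(0, 1]`. -/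
theorem IsDeformation.trans {G : Subgroup (GL ι ℝ)} {δ₁ δ₂ : ℝ} {ℓ : ℕ} {a : ℕ → GL ι ℝ}
    {H : ℝ[X] → Prop} {X Y : ℝ → ℕ → GL ι ℝ} (hX : IsDeformation G δ₁ ℓ a H X)
    (hY : IsDeformation G δ₂ ℓ (X 1 * a) H Y) :
    ∃ Z, IsDeformation G (δ₁ + δ₂) ℓ a H Z ∧ Z 1 * a = Y 1 * (X 1 * a) := by
  refine ⟨fun t => Y (max 0 (2 * t - 1)) * X (min 1 (2 * t)), ⟨fun n => ?_, ?_, fun t n => ?_,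
    fun t ht n => ?_, fun t ht => ?_⟩, ?_⟩
  · exact ((hY.continuous n).comp (by fun_prop)).mul ((hX.continuous n).comp (by fun_prop))
  · simp [hX.zero, hY.zero]
  · exact mul_mem (hY.mem _ _) (hX.mem _ _)
  · rw [add_comm]
    refine (hY.near _ ?_ n).mul (hX.near _ ?_ n)
    · exact ⟨le_max_left _ _, max_le zero_le_one (by linarith [ht.2])⟩
    · exact ⟨le_min zero_le_one (by linarith [ht.1]), min_le_left _ _⟩
  · rcases le_or_gt t (1 / 2) with h | h
    · have h1 : max 0 (2 * t - 1) = 0 := max_eq_left (by linarith)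
      have h2 : min 1 (2 * t) = 2 * t := min_eq_right (by linarith)
      simp only [h1, h2, hY.zero, one_mul]
      exact hX.prop _ ⟨by linarith [ht.1], by linarith⟩
    · have h1 : max 0 (2 * t - 1) = 2 * t - 1 := max_eq_right (by linarith)
      have h2 : min 1 (2 * t) = 1 := min_eq_left (by linarith)
      simp only [h1, h2, mul_assoc]
      exact hY.prop _ ⟨by linarith, by linarith [ht.2]⟩
  · have h1 : max (0 : ℝ) (2 * 1 - 1) = 1 := by norm_num
    have h2 : min (1 : ℝ) (2 * 1) = 1 := by norm_num
    simp only [h1, h2, mul_assoc]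

theorem norm_le_one_of_transpose_mul_self {m n : Type*} [Fintype m] [Fintype n] [DecidableEq n]
    [DecidableEq m] {Q : Matrix m n ℝ} (hQ : Qᵀ * Q = 1) : ‖Q‖ ≤ 1 := by
  have h := l2_opNorm_conjTranspose_mul_self Q
  rw [conjTranspose_eq_transpose_of_trivial, hQ] at h
  have h1 : ‖(1 : Matrix n n ℝ)‖ ≤ 1 := by
    rw [← diagonal_one, l2_opNorm_diagonal]
    exact (pi_norm_le_iff_of_nonneg zero_le_one).2 (by simp)
  nlinarith [norm_nonneg Q]

theorem opNorm_transpose {m n : Type*} [Fintype m] [Fintype n] [DecidableEq n]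
    [DecidableEq m] (Q : Matrix m n ℝ) : ‖Qᵀ‖ = ‖Q‖ := by
  rw [← l2_opNorm_conjTranspose Q, conjTranspose_eq_transpose_of_trivial]

theorem coe_inv_eq_transpose {Q : GL ι ℝ} (hQ : (Q : Matrix ι ι ℝ)ᵀ * (Q : Matrix ι ι ℝ) = 1) :
    ((Q⁻¹ : GL ι ℝ) : Matrix ι ι ℝ) = (Q : Matrix ι ι ℝ)ᵀ := by
  rw [coe_units_inv]
  exact inv_eq_left_inv hQ

/-- This is why the moving frames have to be orthonormal, and not only adapted to the flag: reading
a perturbation in them costs nothing, however long the period. -/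
theorem NearOne.conj {δ : ℝ} {X Q : GL ι ℝ} (hX : NearOne δ X)
    (hQ : (Q : Matrix ι ι ℝ)ᵀ * (Q : Matrix ι ι ℝ) = 1) : NearOne δ (Q * X * Q⁻¹) := by
  have key : ∀ Y : GL ι ℝ, ‖((Q * Y * Q⁻¹ : GL ι ℝ) : Matrix ι ι ℝ) - 1‖ ≤ ‖(Y : Matrix ι ι ℝ) - 1‖ := by
    intro Y
    have h1 : ((Q * Y * Q⁻¹ : GL ι ℝ) : Matrix ι ι ℝ) - 1 =
        (Q : Matrix ι ι ℝ) * ((Y : Matrix ι ι ℝ) - 1) * ((Q⁻¹ : GL ι ℝ) : Matrix ι ι ℝ) := by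
      rw [mul_sub, sub_mul, mul_one, Units.mul_inv]; rfl
    have hn := norm_le_one_of_transpose_mul_self hQ
    rw [h1, coe_inv_eq_transpose hQ]
    calc _ ≤ ‖(Q : Matrix ι ι ℝ) * ((Y : Matrix ι ι ℝ) - 1)‖ * ‖(Q : Matrix ι ι ℝ)ᵀ‖ := norm_mul_le _ _
      _ ≤ (‖(Q : Matrix ι ι ℝ)‖ * ‖(Y : Matrix ι ι ℝ) - 1‖) * ‖(Q : Matrix ι ι ℝ)ᵀ‖ := by
          gcongr; exact norm_mul_le _ _
      _ ≤ (1 * ‖(Y : Matrix ι ι ℝ) - 1‖) * 1 := by rw [opNorm_transpose]; gcongr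
      _ = _ := by ring
  refine ⟨(key X).trans hX.1, ?_⟩
  have : (Q * X * Q⁻¹)⁻¹ = Q * X⁻¹ * Q⁻¹ := by group
  rw [this]
  exact (key _).trans hX.2

/-- Orthonormal frames along a sequence, adapted to an invariant flag of the product. -/
theorem exists_orthogonal_frames (a : ℕ → GL ι ℝ) (ℓ : ℕ) {Q₀ : GL ι ℝ}
    (hQ₀ : (Q₀ : Matrix ι ι ℝ)ᵀ * (Q₀ : Matrix ι ι ℝ) = 1) {b : ι → ℕ}
    (hT : ((Q₀⁻¹ * seqProd a ℓ * Q₀ : GL ι ℝ) : Matrix ι ι ℝ).BlockTriangular b) :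
    ∃ Q : ℕ → GL ι ℝ, (∀ n, (Q n : Matrix ι ι ℝ)ᵀ * (Q n : Matrix ι ι ℝ) = 1) ∧ Q 0 = Q₀ ∧
      Q ℓ = Q₀ ∧
      ∀ n < ℓ, (((Q (n + 1))⁻¹ * a n * Q n : GL ι ℝ) : Matrix ι ι ℝ).BlockTriangular b := by
  -- The frame at time `n` is the orthogonal QR factor of the image of the initial frame. At times
  -- `0` and `ℓ` it is prescribed to be `Q₀`, which is allowed because the flag is invariant, so the
  -- frames close up.
  have h : ∀ n, ∃ Q : GL ι ℝ, (Q : Matrix ι ι ℝ)ᵀ * (Q : Matrix ι ι ℝ) = 1 ∧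
      (n = 0 ∨ n = ℓ → Q = Q₀) ∧
      ((Q⁻¹ * seqProd a n * Q₀ : GL ι ℝ) : Matrix ι ι ℝ).BlockTriangular b := by
    intro n
    by_cases hn : n = 0 ∨ n = ℓ
    · refine ⟨Q₀, hQ₀, fun _ => rfl, ?_⟩
      rcases hn with rfl | rfl
      · simp [seqProd, blockTriangular_one]
      · exact hT
    · obtain ⟨Q, R, hQ, hR, hQR⟩ := exists_orthogonal_mul_blockTriangular (seqProd a n * Q₀) b
      refine ⟨Q, hQ, fun h => absurd h hn, ?_⟩
      rw [mul_assoc, hQR, inv_mul_cancel_left]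
      exact hR
  choose Q h1 h2 h3 using h
  refine ⟨Q, h1, h2 0 (Or.inl rfl), h2 ℓ (Or.inr rfl), fun n _ => ?_⟩
  have : (Q (n + 1))⁻¹ * a n * Q n =
      ((Q (n + 1))⁻¹ * seqProd a (n + 1) * Q₀) * ((Q n)⁻¹ * seqProd a n * Q₀)⁻¹ := by
    rw [seqProd]; group
  rw [this, Units.val_mul]
  exact (h3 _).mul (blockTriangular_val_inv (h3 n))

/-- The frames telescope. The perturbation of `a n` is read in the frame `Q (n + 1)`, since it acts
after `a n`. -/
theorem seqProd_conj {M : Type*} [Group M] (a D Q : ℕ → M) (n : ℕ) :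
    seqProd ((fun n => Q (n + 1) * D n * (Q (n + 1))⁻¹) * a) n =
      Q n * seqProd (fun n => D n * ((Q (n + 1))⁻¹ * a n * Q n)) n * (Q 0)⁻¹ := by
  induction n with
  | zero => simp [seqProd]
  | succ n ih => rw [seqProd, ih, seqProd, Pi.mul_apply]; group

theorem blockTriangular_seqProd {a : ℕ → GL ι ℝ} {b : ι → ℕ} {n : ℕ}
    (ha : ∀ k < n, (a k : Matrix ι ι ℝ).BlockTriangular b) :
    (seqProd a n).val.BlockTriangular b := by
  induction n with
  | zero => exact blockTriangular_one
  | succ n ih => exact (ha n (by omega)).mul (ih fun k hk => ha k (by omega))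

theorem toSquareBlock_one (b : ι → ℕ) (c : ℕ) :
    (1 : Matrix ι ι ℝ).toSquareBlock b c = 1 := by
  ext i j
  simp [toSquareBlock_def, one_apply, Subtype.ext_iff]

theorem toSquareBlock_seqProd {a : ℕ → GL ι ℝ} {b : ι → ℕ} {n : ℕ}
    (ha : ∀ k < n, (a k : Matrix ι ι ℝ).BlockTriangular b) (c : ℕ) :
    (seqProd a n).val.toSquareBlock b c =
      seqProd (fun k => (a k : Matrix ι ι ℝ).toSquareBlock b c) n := by
  induction n with
  | zero => exact toSquareBlock_one b c
  | succ n ih =>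
    rw [seqProd, seqProd, ← ih fun k hk => ha k (by omega), ← toSquareBlock_mul (ha n (by omega))
      (blockTriangular_seqProd fun k hk => ha k (by omega))]
    rfl

theorem seqProd_congr {M : Type*} [Monoid M] {a a' : ℕ → M} {n : ℕ} (h : ∀ k < n, a k = a' k) :
    seqProd a n = seqProd a' n := by
  induction n with
  | zero => rfl
  | succ n ih => rw [seqProd, seqProd, h n (by omega), ih fun k hk => h k (by omega)]

/-- The diagonal matrix with entries `exp (v x)`. -/
noncomputable def expDiag (v : ι → ℝ) : GL ι ℝ where
  val := diagonal fun x => Real.exp (v x)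
  inv := diagonal fun x => Real.exp (-v x)
  val_inv := by simp [diagonal_mul_diagonal, ← Real.exp_add]
  inv_val := by simp [diagonal_mul_diagonal, ← Real.exp_add]

theorem det_expDiag (v : ι → ℝ) : (expDiag v : Matrix ι ι ℝ).det = Real.exp (∑ x, v x) := by
  simp [expDiag, Real.exp_sum]

theorem abs_exp_sub_one_le_exp_abs {x δ : ℝ} (h : |x| ≤ δ) :
    |Real.exp x - 1| ≤ Real.exp δ - 1 := by
  have h1 : Real.exp x ≤ Real.exp δ := Real.exp_le_exp.2 ((le_abs_self x).trans h)
  have h2 : Real.exp (-δ) ≤ Real.exp x := Real.exp_le_exp.2 (abs_le.1 h).1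
  have h3 : Real.exp (-δ) * Real.exp δ = 1 := by rw [← Real.exp_add]; simp
  rw [abs_le]
  constructor
  -- This is `exp δ + exp (-δ) ≥ 2`.
  · nlinarith [sq_nonneg (Real.exp δ - 1), Real.exp_pos δ, Real.exp_pos (-δ)]
  · linarith

theorem nearOne_expDiag {v : ι → ℝ} {δ : ℝ} (hδ : 0 ≤ δ) (hv : ∀ x, |v x| ≤ δ) :
    NearOne δ (expDiag v) := by
  have key : ∀ w : ι → ℝ, (∀ x, |w x| ≤ δ) →
      ‖(diagonal (fun x => Real.exp (w x)) : Matrix ι ι ℝ) - 1‖ ≤ Real.exp δ - 1 := by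
    intro w hw
    rw [← diagonal_one, diagonal_sub, l2_opNorm_diagonal]
    refine (pi_norm_le_iff_of_nonneg (by linarith [Real.add_one_le_exp δ])).2 fun x => ?_
    exact abs_exp_sub_one_le_exp_abs (hw x)
  exact ⟨key v hv, key (fun x => -v x) (by simpa using hv)⟩

theorem continuous_expDiag : Continuous (expDiag : (ι → ℝ) → GL ι ℝ) := by
  rw [Units.continuous_iff]
  constructor
  · exact Continuous.matrix_diagonal (by fun_prop)
  · exact Continuous.matrix_diagonal (by fun_prop)

theorem seqProd_smul {M : Type*} [Monoid M] [MulAction ℝ M] [IsScalarTower ℝ M M]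
    [SMulCommClass ℝ M M] (s : ℝ) (a : ℕ → M) (n : ℕ) :
    seqProd (fun k => s • a k) n = s ^ n • seqProd a n := by
  induction n with
  | zero => simp [seqProd]
  | succ n ih => rw [seqProd, ih, seqProd, smul_mul_smul_comm, pow_succ']

/-- Block `c` is multiplied by `exp (t κ_c / ℓ)` at each step of the moving frame. The factors
accumulate to `exp (t κ_c)` over the period, while a single step only pays `|κ_c| / ℓ ≤ δ`.
Normality of `G` is needed because the frames need not belong to `G`. -/
theorem exists_isDeformation_scale {G : Subgroup (GL ι ℝ)} [G.Normal] {ℓ : ℕ} (hℓ : 0 < ℓ) {δ : ℝ}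
    (hδ : 0 ≤ δ) (a : ℕ → GL ι ℝ) {Q₀ : GL ι ℝ}
    (hQ₀ : (Q₀ : Matrix ι ι ℝ)ᵀ * (Q₀ : Matrix ι ι ℝ) = 1) {b : ι → ℕ}
    (hT : ((Q₀⁻¹ * seqProd a ℓ * Q₀ : GL ι ℝ) : Matrix ι ι ℝ).BlockTriangular b) (κ : ℕ → ℝ)
    (hκ : ∀ x, |κ (b x)| ≤ ℓ * δ) (hG : ∀ s : ℝ, expDiag (fun x => s * κ (b x)) ∈ G) :
    ∃ X, IsDeformation G δ ℓ a (fun p => ∃ t ∈ Set.Ioc (0 : ℝ) 1,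
        p = ∏ c ∈ Finset.univ.image b, (Real.exp (t * κ c) •
          ((Q₀⁻¹ * seqProd a ℓ * Q₀ : GL ι ℝ) : Matrix ι ι ℝ).toSquareBlock b c).charpoly) X ∧
      (seqProd (X 1 * a) ℓ).val.charpoly =
        ∏ c ∈ Finset.univ.image b, (Real.exp (κ c) •
          ((Q₀⁻¹ * seqProd a ℓ * Q₀ : GL ι ℝ) : Matrix ι ι ℝ).toSquareBlock b c).charpoly := by
  obtain ⟨Q, hQ, hQ0, hQℓ, hQT⟩ := exists_orthogonal_frames a ℓ hQ₀ hT
  set D : ℝ → GL ι ℝ := fun t => expDiag (fun x => (t / ℓ) * κ (b x)) with hD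
  set r : ℕ → GL ι ℝ := fun n => (Q (n + 1))⁻¹ * a n * Q n with hr
  have hℓ' : (0 : ℝ) < ℓ := by exact_mod_cast hℓ
  have hDT : ∀ t, (D t : Matrix ι ι ℝ).BlockTriangular b := fun t => blockTriangular_diagonal _
  have hprod : ∀ t, seqProd ((fun n => Q (n + 1) * D t * (Q (n + 1))⁻¹) * a) ℓ =
      Q₀ * seqProd (fun n => D t * r n) ℓ * Q₀⁻¹ := by
    intro t
    rw [seqProd_conj a (fun _ => D t) Q ℓ, hQ0, hQℓ]
  have hr1 : (Q₀⁻¹ * seqProd a ℓ * Q₀ : GL ι ℝ) = seqProd r ℓ := by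
    have h1 := hprod 0
    have h2 : D 0 = 1 := by
      ext i j
      simp [hD, expDiag]
    have h3 : ((fun n => Q (n + 1) * D 0 * (Q (n + 1))⁻¹) * a) = a := by
      ext n : 1
      simp [h2]
    rw [h3] at h1
    rw [h1]
    simp only [h2, one_mul]
    group
  have hDb : ∀ t c, (D t : Matrix ι ι ℝ).toSquareBlock b c =
      Real.exp ((t / ℓ) * κ c) • (1 : Matrix {x // b x = c} {x // b x = c} ℝ) := by
    intro t c
    ext ⟨i, hi⟩ ⟨j, hj⟩
    simp [hD, expDiag, toSquareBlock_def, diagonal_apply, one_apply, hi]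
  have hchar : ∀ t, (seqProd ((fun n => Q (n + 1) * D t * (Q (n + 1))⁻¹) * a) ℓ).val.charpoly = ∏ c ∈ Finset.univ.image b, (Real.exp (t * κ c) •
          ((Q₀⁻¹ * seqProd a ℓ * Q₀ : GL ι ℝ) : Matrix ι ι ℝ).toSquareBlock b c).charpoly := by
    intro t
    have hT2 : ∀ k < ℓ, ((D t * r k : GL ι ℝ) : Matrix ι ι ℝ).BlockTriangular b :=
      fun k hk => (hDT t).mul (hQT k hk)
    have e1 : (seqProd ((fun n => Q (n + 1) * D t * (Q (n + 1))⁻¹) * a) ℓ).val.charpoly = (seqProd (fun n => D t * r n) ℓ).val.charpoly := by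
      rw [hprod, Units.val_mul, Units.val_mul]
      apply charpoly_mul_mul_of_mul_eq_one
      exact Units.inv_mul _
    rw [e1, (blockTriangular_seqProd hT2).charpoly]
    refine Finset.prod_congr rfl fun c _ => ?_
    rw [toSquareBlock_seqProd hT2, hr1, toSquareBlock_seqProd hQT]
    have e2 : ∀ k < ℓ, ((D t * r k : GL ι ℝ) : Matrix ι ι ℝ).toSquareBlock b c =
        Real.exp ((t / ℓ) * κ c) • (r k : Matrix ι ι ℝ).toSquareBlock b c := by
      intro k hk
      rw [Units.val_mul, toSquareBlock_mul (hDT t) (hQT k hk), hDb, smul_mul_assoc, one_mul]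
    have e3 : (ℓ : ℝ) * (t / ℓ * κ c) = t * κ c := by field_simp
    rw [seqProd_congr e2, seqProd_smul, ← Real.exp_nat_mul, e3]
  refine ⟨fun t n => Q (n + 1) * D t * (Q (n + 1))⁻¹, ⟨fun n => ?_, ?_, fun t n => ?_,
    fun t ht n => ?_, fun t ht => ⟨t, ht, hchar t⟩⟩, by simpa using hchar 1⟩
  · have : Continuous D := continuous_expDiag.comp (by fun_prop)
    fun_prop
  · ext n : 1
    have h2 : D 0 = 1 := by
      ext i j
      simp [hD, expDiag]
    simp [h2]
  · exact Subgroup.Normal.conj_mem inferInstance _ (hG _) _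
  · refine NearOne.conj (nearOne_expDiag hδ fun x => ?_) (hQ _)
    rw [abs_mul, abs_div, abs_of_pos hℓ', abs_of_nonneg ht.1]
    calc t / ℓ * |κ (b x)| ≤ 1 / ℓ * (ℓ * δ) := by
          gcongr
          · exact ht.2
          · exact hκ x
      _ = δ := by field_simp

end Deformations

/-! ### Rotating the factors of an elliptic product in the plane. -/

section PlaneRotations

open Matrix Polynomial

/-- The rotation by `π / 2`. -/
def quarterTurn : Matrix (Fin 2) (Fin 2) ℝ := !![0, -1; 1, 0]

theorem quarterTurn_mul_self : quarterTurn * quarterTurn = -1 := by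
  ext i j
  fin_cases i <;> fin_cases j <;> simp [quarterTurn]

/-- The rotation by `θ`. -/
noncomputable def planeRotation (θ : ℝ) : Matrix (Fin 2) (Fin 2) ℝ :=
  Real.cos θ • 1 + Real.sin θ • quarterTurn

theorem planeRotation_eq (θ : ℝ) :
    planeRotation θ = !![Real.cos θ, -Real.sin θ; Real.sin θ, Real.cos θ] := by
  ext i j
  fin_cases i <;> fin_cases j <;> simp [planeRotation, quarterTurn]

theorem planeRotation_zero : planeRotation 0 = 1 := by simp [planeRotation]

theorem planeRotation_mul_neg (θ : ℝ) : planeRotation θ * planeRotation (-θ) = 1 := by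
  have := Real.sin_sq_add_cos_sq θ
  ext i j
  fin_cases i <;> fin_cases j <;> simp [planeRotation_eq] <;> nlinarith

theorem continuous_planeRotation : Continuous planeRotation := by
  unfold planeRotation
  fun_prop

theorem det_planeRotation (θ : ℝ) : (planeRotation θ).det = 1 := by
  rw [planeRotation_eq, det_fin_two_of]
  nlinarith [Real.sin_sq_add_cos_sq θ]

theorem hasDerivAt_planeRotation (θ : ℝ) :
    HasDerivAt planeRotation (quarterTurn * planeRotation θ) θ := by
  have h := ((Real.hasDerivAt_cos θ).smul_const (1 : Matrix (Fin 2) (Fin 2) ℝ)).add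
    ((Real.hasDerivAt_sin θ).smul_const quarterTurn)
  convert! h using 1
  rw [planeRotation, mul_add, mul_smul_comm, mul_smul_comm, quarterTurn_mul_self, mul_one]
  simp [add_comm]

/-- The rotation by `θ`, as an invertible matrix. -/
noncomputable def planeRotationGL (θ : ℝ) : GL (Fin 2) ℝ where
  val := planeRotation θ
  inv := planeRotation (-θ)
  val_inv := planeRotation_mul_neg θ
  inv_val := by simpa using planeRotation_mul_neg (-θ)

theorem trace_quarterTurn_mul (N : Matrix (Fin 2) (Fin 2) ℝ) :
    (quarterTurn * N).trace = N 0 1 - N 1 0 := by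
  rw [trace_fin_two, mul_apply, mul_apply, Fin.sum_univ_two, Fin.sum_univ_two]
  simp [quarterTurn]
  ring

/-- The difference of the two sides is `(N 0 0 - N 1 1)² + (N 0 1 + N 1 0)²`. The left side is
invariant under conjugation, so the bound is uniform over all conjugates of `N`. -/
theorem sq_trace_quarterTurn_mul_ge (N : Matrix (Fin 2) (Fin 2) ℝ) :
    4 * N.det - N.trace ^ 2 ≤ (quarterTurn * N).trace ^ 2 := by
  rw [trace_quarterTurn_mul, det_fin_two, trace_fin_two]
  nlinarith [sq_nonneg (N 0 0 - N 1 1), sq_nonneg (N 0 1 + N 1 0)]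

/-- The sense of rotation of an elliptic matrix is preserved by conjugations of positive
determinant, and reversed by those of negative determinant. -/
theorem trace_quarterTurn_mul_conj {N : Matrix (Fin 2) (Fin 2) ℝ} (hN : N.trace ^ 2 < 4 * N.det)
    (P : GL (Fin 2) ℝ) :
    0 < (quarterTurn * N).trace * ((P : Matrix (Fin 2) (Fin 2) ℝ).det *
      (quarterTurn * ((P : Matrix (Fin 2) (Fin 2) ℝ) * N *
        ((P⁻¹ : GL (Fin 2) ℝ) : Matrix (Fin 2) (Fin 2) ℝ))).trace) := by
  have hdet : (P : Matrix (Fin 2) (Fin 2) ℝ).det ≠ 0 := P.det_ne_zero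
  have hadj : (P : Matrix (Fin 2) (Fin 2) ℝ).det •
      ((P⁻¹ : GL (Fin 2) ℝ) : Matrix (Fin 2) (Fin 2) ℝ) = (P : Matrix (Fin 2) (Fin 2) ℝ).adjugate := by
    rw [coe_units_inv, inv_def, smul_smul, Ring.inverse_eq_inv', mul_inv_cancel₀ hdet, one_smul]
  have h1 : (P : Matrix (Fin 2) (Fin 2) ℝ).det * (quarterTurn * ((P : Matrix (Fin 2) (Fin 2) ℝ) * N *
        ((P⁻¹ : GL (Fin 2) ℝ) : Matrix (Fin 2) (Fin 2) ℝ))).trace =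
      (quarterTurn * ((P : Matrix (Fin 2) (Fin 2) ℝ) * N *
        (P : Matrix (Fin 2) (Fin 2) ℝ).adjugate)).trace := by
    rw [← hadj, mul_smul_comm, mul_smul_comm, trace_smul, smul_eq_mul]
  rw [h1, trace_quarterTurn_mul, trace_quarterTurn_mul, adjugate_fin_two]
  rw [det_fin_two] at hdet
  rw [det_fin_two, trace_fin_two] at hN
  simp only [mul_apply, Fin.sum_univ_two, of_apply, cons_val', cons_val_zero, cons_val_one,
    cons_val_fin_one]
  generalize (P : Matrix (Fin 2) (Fin 2) ℝ) 0 0 = p at *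
  generalize (P : Matrix (Fin 2) (Fin 2) ℝ) 0 1 = q at *
  generalize (P : Matrix (Fin 2) (Fin 2) ℝ) 1 0 = r at *
  generalize (P : Matrix (Fin 2) (Fin 2) ℝ) 1 1 = s at *
  generalize N 0 0 = a at *
  generalize N 0 1 = b at *
  generalize N 1 0 = c at *
  generalize N 1 1 = d at *
  have hbc : b * c < 0 := by nlinarith [sq_nonneg (a - d)]
  -- The trace for the conjugated matrix, multiplied by `det P`, is the sum of this quadratic form
  -- over the two rows of `P`. Ellipticity makes the form definite, with the sign of `b - c`.
  have key : ∀ x y : ℝ, (x ≠ 0 ∨ y ≠ 0) → 0 < (b - c) * (b * x ^ 2 + (d - a) * x * y - c * y ^ 2) := by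
    intro x y hxy
    have e : 4 * ((b - c) * (b * x ^ 2 + (d - a) * x * y - c * y ^ 2)) =
        ((2 * b * x + (d - a) * y) ^ 2 + (4 * (a * d - b * c) - (a + d) ^ 2) * y ^ 2) +
        ((2 * c * y - (d - a) * x) ^ 2 + (4 * (a * d - b * c) - (a + d) ^ 2) * x ^ 2) := by ring
    have hpos : 0 < 4 * (a * d - b * c) - (a + d) ^ 2 := by linarith
    have : 0 < x ^ 2 + y ^ 2 := by
      rcases hxy with h | h
      · have := sq_pos_of_ne_zero h; positivity
      · have := sq_pos_of_ne_zero h; positivity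
    nlinarith [sq_nonneg (2 * b * x + (d - a) * y), sq_nonneg (2 * c * y - (d - a) * x),
      mul_pos hpos this]
  have hpq : p ≠ 0 ∨ q ≠ 0 := by
    by_contra! h
    exact hdet (by rw [h.1, h.2]; ring)
  have hrs : r ≠ 0 ∨ s ≠ 0 := by
    by_contra! h
    exact hdet (by rw [h.1, h.2]; ring)
  have := add_pos (key p q hpq) (key r s hrs)
  nlinarith [this]

/-- The product of the sequence `a` rotated at each step by the angle `σ k * θ`. -/
noncomputable def rotatedProd (a : ℕ → GL (Fin 2) ℝ) (σ : ℕ → ℝ) (n : ℕ) (θ : ℝ) : GL (Fin 2) ℝ :=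
  seqProd (fun k => planeRotationGL (σ k * θ) * a k) n

theorem det_rotatedProd (a : ℕ → GL (Fin 2) ℝ) (σ : ℕ → ℝ) (n : ℕ) (θ : ℝ) :
    (rotatedProd a σ n θ).val.det = (seqProd a n).val.det := by
  unfold rotatedProd
  induction n with
  | zero => rfl
  | succ n ih =>
    simp only [seqProd, Units.val_mul, det_mul] at ih ⊢
    rw [ih]
    simp [planeRotationGL, det_planeRotation]

/-- By the product rule, differentiating the `k`-th rotation inserts a quarter turn after step `k`.
It is carried back to time zero by conjugation with the partial product. -/
theorem hasDerivAt_rotatedProd (a : ℕ → GL (Fin 2) ℝ) (σ : ℕ → ℝ) (n : ℕ) (θ : ℝ) :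
    HasDerivAt (fun θ => (rotatedProd a σ n θ).val) ((rotatedProd a σ n θ).val *
      ∑ k ∈ Finset.range n, σ k • ((rotatedProd a σ (k + 1) θ)⁻¹.val * quarterTurn *
        (rotatedProd a σ (k + 1) θ).val)) θ := by
  induction n with
  | zero => simpa [rotatedProd, seqProd] using hasDerivAt_const θ (1 : Matrix (Fin 2) (Fin 2) ℝ)
  | succ n ih =>
    have h1 : HasDerivAt (fun θ => planeRotation (σ n * θ))
        (σ n • (quarterTurn * planeRotation (σ n * θ))) θ := by
      have := (hasDerivAt_planeRotation (σ n * θ)).scomp θ ((hasDerivAt_id θ).const_mul (σ n))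
      simpa [Function.comp_def] using this
    have h2 := (h1.mul_const (a n).val).mul ih
    have h3 : ∀ θ, (rotatedProd a σ (n + 1) θ).val =
        planeRotation (σ n * θ) * (a n).val * (rotatedProd a σ n θ).val := fun θ => rfl
    have h4 : (fun θ => (rotatedProd a σ (n + 1) θ).val) =
      (fun θ => planeRotation (σ n * θ) * (a n).val) * fun θ => (rotatedProd a σ n θ).val :=
        funext h3
    rw [h4]
    convert! h2 using 1
    rw [Finset.sum_range_succ, mul_add, add_comm]
    congr 1
    · rw [mul_smul_comm, ← mul_assoc, ← mul_assoc, Units.mul_inv, one_mul, h3, smul_mul_assoc,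
        smul_mul_assoc]
      simp only [mul_assoc]
    · rw [h3, mul_assoc]

theorem hasDerivAt_trace_rotatedProd (a : ℕ → GL (Fin 2) ℝ) (σ : ℕ → ℝ) (n : ℕ) (θ : ℝ) :
    HasDerivAt (fun θ => (rotatedProd a σ n θ).val.trace)
      (∑ k ∈ Finset.range n, σ k * (quarterTurn * ((rotatedProd a σ (k + 1) θ).val *
        (rotatedProd a σ n θ).val * (rotatedProd a σ (k + 1) θ)⁻¹.val)).trace) θ := by
  have h := (traceLinearMap (Fin 2) ℝ ℝ).toContinuousLinearMap.hasFDerivAt.comp_hasDerivAt θ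
    (hasDerivAt_rotatedProd a σ n θ)
  convert! h using 1
  change _ = ((rotatedProd a σ n θ).val * ∑ k ∈ Finset.range n, σ k •
    ((rotatedProd a σ (k + 1) θ)⁻¹.val * quarterTurn * (rotatedProd a σ (k + 1) θ).val)).trace
  rw [Finset.mul_sum, trace_sum]
  refine Finset.sum_congr rfl fun k _ => ?_
  rw [mul_smul_comm, trace_smul, smul_eq_mul, trace_mul_comm quarterTurn, mul_assoc,
    mul_assoc, trace_mul_comm (rotatedProd a σ (k + 1) θ).val]
  simp only [mul_assoc]

/-- As long as the rotated product is elliptic, its trace moves fast. -/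
theorem abs_deriv_trace_rotatedProd_ge {a : ℕ → GL (Fin 2) ℝ} {σ : ℕ → ℝ} {n : ℕ} {θ : ℝ}
    (hσ : ∀ k, σ k = SignType.sign (seqProd a (k + 1)).val.det)
    (hell : (rotatedProd a σ n θ).val.trace ^ 2 < 4 * (seqProd a n).val.det) :
    n * Real.sqrt (4 * (seqProd a n).val.det - (rotatedProd a σ n θ).val.trace ^ 2) ≤
      |∑ k ∈ Finset.range n, σ k * (quarterTurn * ((rotatedProd a σ (k + 1) θ).val *
        (rotatedProd a σ n θ).val * (rotatedProd a σ (k + 1) θ)⁻¹.val)).trace| := by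
  set N := (rotatedProd a σ n θ).val with hN
  have hdet : N.det = (seqProd a n).val.det := det_rotatedProd a σ n θ
  rw [← hdet] at hell ⊢
  set s : ℝ := ((SignType.sign (quarterTurn * N).trace : SignType) : ℝ) with hs
  have hs1 : |s| ≤ 1 := by
    rw [hs]; cases SignType.sign (quarterTurn * N).trace <;> simp
  -- The sign `σ k` compensates for partial products that reverse orientation, so every term has the
  -- common sign `s`: nothing cancels in the sum.
  have hterm : ∀ k, Real.sqrt (4 * N.det - N.trace ^ 2) ≤ s * (σ k * (quarterTurn *
      ((rotatedProd a σ (k + 1) θ).val * N * (rotatedProd a σ (k + 1) θ)⁻¹.val)).trace) := by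
    intro k
    have h1 := trace_quarterTurn_mul_conj hell (rotatedProd a σ (k + 1) θ)
    have h2 := sq_trace_quarterTurn_mul_ge ((rotatedProd a σ (k + 1) θ).val * N *
      (rotatedProd a σ (k + 1) θ)⁻¹.val)
    have hPinv : ((rotatedProd a σ (k + 1) θ)⁻¹).val * (rotatedProd a σ (k + 1) θ).val = 1 :=
      Units.inv_mul _
    have h3 : ((rotatedProd a σ (k + 1) θ).val * N * (rotatedProd a σ (k + 1) θ)⁻¹.val).trace =
        N.trace := by
      rw [trace_mul_comm, ← mul_assoc, hPinv, one_mul]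
    have h4 : ((rotatedProd a σ (k + 1) θ).val * N * (rotatedProd a σ (k + 1) θ)⁻¹.val).det =
        N.det := by
      rw [det_mul_comm, ← mul_assoc, hPinv, one_mul]
    rw [h3, h4] at h2
    rw [det_rotatedProd] at h1
    generalize (quarterTurn * ((rotatedProd a σ (k + 1) θ).val * N *
      (rotatedProd a σ (k + 1) θ)⁻¹.val)).trace = u at *
    have h5 : 0 < s * (σ k * u) := by
      have h6 : SignType.sign ((quarterTurn * N).trace * ((seqProd a (k + 1)).val.det * u)) = 1 :=
        sign_pos h1
      have h7 : u ≠ 0 := by rintro rfl; simp at h1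
      rw [sign_mul, sign_mul] at h6
      have h8 : s * (σ k * SignType.sign u) = 1 := by
        rw [hs, hσ]; exact_mod_cast congrArg (fun z : SignType => (z : ℝ)) h6
      have h9 : u = SignType.sign u * |u| := (sign_mul_abs u).symm
      rw [h9]
      calc (0 : ℝ) < |u| := abs_pos.2 h7
        _ = s * (σ k * SignType.sign u) * |u| := by rw [h8, one_mul]
        _ = _ := by ring
    have hσ1 : |σ k| ≤ 1 := by
      rw [hσ]; cases SignType.sign (seqProd a (k + 1)).val.det <;> simp
    have h6 : |s * (σ k * u)| = |u| := by
      have hs0 : s ≠ 0 := by intro h; rw [h] at h5; simp at h5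
      have hσ0 : σ k ≠ 0 := by intro h; rw [h] at h5; simp at h5
      have e1 : |s| = 1 := by
        rw [hs] at hs0 ⊢; cases h : SignType.sign (quarterTurn * N).trace <;> simp [h] at hs0 ⊢
      have e2 : |σ k| = 1 := by
        rw [hσ] at hσ0 ⊢
        cases h : SignType.sign (seqProd a (k + 1)).val.det <;> simp [h] at hσ0 ⊢
      rw [abs_mul, abs_mul, e1, e2, one_mul, one_mul]
    rw [← abs_of_pos h5, h6, ← Real.sqrt_sq_eq_abs]
    exact Real.sqrt_le_sqrt h2
  have hsum : n * Real.sqrt (4 * N.det - N.trace ^ 2) ≤ s * ∑ k ∈ Finset.range n, σ k *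
      (quarterTurn * ((rotatedProd a σ (k + 1) θ).val * N *
        (rotatedProd a σ (k + 1) θ)⁻¹.val)).trace := by
    rw [Finset.mul_sum]
    calc _ = ∑ k ∈ Finset.range n, Real.sqrt (4 * N.det - N.trace ^ 2) := by simp
      _ ≤ _ := Finset.sum_le_sum fun k _ => hterm k
  refine hsum.trans ((le_abs_self _).trans ?_)
  rw [abs_mul]
  exact mul_le_of_le_one_left (abs_nonneg _) hs1

/-- Rotating each factor of a long enough elliptic product makes it parabolic. -/
theorem exists_rotatedProd_parabolic {a : ℕ → GL (Fin 2) ℝ} {n : ℕ} {δ : ℝ} (hδ : 0 < δ)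
    (hn : Real.pi < n * δ)
    (hell : (seqProd a n).val.trace ^ 2 < 4 * (seqProd a n).val.det) :
    ∃ σ : ℕ → ℝ, (∀ k, |σ k| ≤ 1) ∧ ∃ θ₀ ∈ Set.Ioc 0 δ,
      (∀ θ ∈ Set.Ico 0 θ₀, (rotatedProd a σ n θ).val.trace ^ 2 < 4 * (seqProd a n).val.det) ∧
      (rotatedProd a σ n θ₀).val.trace ^ 2 = 4 * (seqProd a n).val.det := by
  set D := (seqProd a n).val.det with hD
  set σ : ℕ → ℝ := fun k => SignType.sign (seqProd a (k + 1)).val.det with hσ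
  set f : ℝ → ℝ := fun θ => (rotatedProd a σ n θ).val.trace with hf
  have hfd := hasDerivAt_trace_rotatedProd a σ n
  have hfc : Continuous f := continuous_iff_continuousAt.2 fun θ => (hfd θ).continuousAt
  have hDpos : 0 < D := by nlinarith [sq_nonneg (seqProd a n).val.trace]
  have hf0 : f 0 ^ 2 < 4 * D := by
    have h1 : planeRotationGL 0 = 1 := Units.ext planeRotation_zero
    have : rotatedProd a σ n 0 = seqProd a n := by
      unfold rotatedProd
      simp [h1]
    simpa [hf, this] using hell
  -- Otherwise `arcsin (f / R)`, with `R = 2 √D`, is differentiable on `[0, δ]` with derivative at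
  -- least `n` in modulus. By the mean value theorem it varies by at least `n * δ > π`, more than
  -- the range of the arcsine.
  have hex : ∃ θ ∈ Set.Icc 0 δ, 4 * D ≤ f θ ^ 2 := by
    by_contra! hcon
    set R := Real.sqrt (4 * D) with hR
    have hRpos : 0 < R := Real.sqrt_pos.2 (by linarith)
    have hR2 : R ^ 2 = 4 * D := Real.sq_sqrt (by linarith)
    have hlt : ∀ θ ∈ Set.Icc 0 δ, |f θ / R| < 1 := by
      intro θ hθ
      rw [abs_div, abs_of_pos hRpos, div_lt_one hRpos]
      exact abs_lt_of_sq_lt_sq (by rw [hR2]; exact hcon θ hθ) hRpos.le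
    set f' : ℝ → ℝ := fun θ => ∑ k ∈ Finset.range n, σ k * (quarterTurn *
      ((rotatedProd a σ (k + 1) θ).val * (rotatedProd a σ n θ).val *
        (rotatedProd a σ (k + 1) θ)⁻¹.val)).trace with hf'
    have hg : ∀ θ ∈ Set.Icc 0 δ, HasDerivAt (fun θ => Real.arcsin (f θ / R))
        (1 / Real.sqrt (1 - (f θ / R) ^ 2) * (f' θ / R)) θ := by
      intro θ hθ
      have h1 := abs_lt.1 (hlt θ hθ)
      exact (Real.hasDerivAt_arcsin h1.1.ne' h1.2.ne).comp θ ((hfd θ).div_const R)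
    obtain ⟨c, hc, hslope⟩ := exists_hasDerivAt_eq_slope _ _ hδ
      (fun θ hθ => (hg θ hθ).continuousAt.continuousWithinAt)
      (fun θ hθ => hg θ (Set.Ioo_subset_Icc_self hθ))
    have hc' := Set.Ioo_subset_Icc_self hc
    have h2 : n * Real.sqrt (4 * D - f c ^ 2) ≤ |f' c| :=
      abs_deriv_trace_rotatedProd_ge (fun k => rfl) (hcon c hc')
    have h3 : R * Real.sqrt (1 - (f c / R) ^ 2) = Real.sqrt (4 * D - f c ^ 2) := by
      rw [hR, ← Real.sqrt_mul (by linarith), ← hR, div_pow, hR2]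
      congr 1
      field_simp
    have h4 : 0 < Real.sqrt (4 * D - f c ^ 2) := Real.sqrt_pos.2 (by linarith [hcon c hc'])
    have h5 : (n : ℝ) ≤ |1 / Real.sqrt (1 - (f c / R) ^ 2) * (f' c / R)| := by
      have : 1 / Real.sqrt (1 - (f c / R) ^ 2) * (f' c / R) = f' c / Real.sqrt (4 * D - f c ^ 2) := by
        rw [← h3, div_mul_div_comm, one_mul, mul_comm R]
      rw [this, abs_div, abs_of_pos h4, le_div_iff₀ h4]
      exact h2
    rw [hslope, sub_zero, abs_div, abs_of_pos hδ, le_div_iff₀ hδ] at h5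
    have h6 := Real.arcsin_mem_Icc (f δ / R)
    have h7 := Real.arcsin_mem_Icc (f 0 / R)
    have h8 : |Real.arcsin (f δ / R) - Real.arcsin (f 0 / R)| ≤ Real.pi := by
      rw [abs_le]; constructor <;> linarith [h6.1, h6.2, h7.1, h7.2]
    linarith
  have hcomp : IsCompact {θ | θ ∈ Set.Icc 0 δ ∧ 4 * D ≤ f θ ^ 2} := by
    have : IsClosed {θ | 4 * D ≤ f θ ^ 2} := isClosed_le continuous_const (hfc.pow 2)
    exact isCompact_Icc.inter_right this
  obtain ⟨θ₀, hθ₀, hleast⟩ := hcomp.exists_isLeast hex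
  have hpos : 0 < θ₀ := by
    rcases hθ₀.1.1.lt_or_eq with h | h
    · exact h
    · exact absurd hθ₀.2 (by rw [← h]; linarith)
  refine ⟨σ, fun k => ?_, θ₀, ⟨hpos, hθ₀.1.2⟩, fun θ hθ => ?_, ?_⟩
  · simp only [hσ]
    cases SignType.sign (seqProd a (k + 1)).val.det <;> simp
  · by_contra! h
    exact absurd (hleast ⟨⟨hθ.1, hθ.2.le.trans hθ₀.1.2⟩, h⟩) (not_le.2 hθ.2)
  -- Equality is attained somewhere in `[0, θ₀]`, and by minimality of `θ₀` it can only be at `θ₀`.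
  · obtain ⟨θ, hθ, hfθ⟩ := intermediate_value_Icc hpos.le (hfc.pow 2).continuousOn
      ⟨hf0.le, hθ₀.2⟩
    have h1 := hleast ⟨⟨hθ.1, hθ.2.trans hθ₀.1.2⟩, hfθ.ge⟩
    rw [← le_antisymm hθ.2 h1]
    exact hfθ

end PlaneRotations

/-! ### Rotations inserted in one plane block of a Schur form. -/

section BlockRotation

open Matrix Polynomial

variable {ι : Type*} [Fintype ι] [DecidableEq ι]

/-- The inclusion of a plane spanned by two coordinate vectors. -/
def planeInclusion {p : ι → Prop} (e : Fin 2 ≃ {x // p x}) : Matrix ι (Fin 2) ℝ :=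
  of fun x i => if x = (e i).1 then 1 else 0

theorem planeInclusion_transpose_mul {p : ι → Prop} (e : Fin 2 ≃ {x // p x}) :
    (planeInclusion e)ᵀ * planeInclusion e = 1 := by
  ext i j
  simp [mul_apply, planeInclusion, one_apply, ← Subtype.ext_iff, eq_comm]

theorem planeInclusion_mul_mul_apply {p : ι → Prop} (e : Fin 2 ≃ {x // p x})
    (A : Matrix (Fin 2) (Fin 2) ℝ) (i j : Fin 2) :
    (planeInclusion e * A * (planeInclusion e)ᵀ) (e i).1 (e j).1 = A i j := by
  simp [mul_apply, planeInclusion, ← Subtype.ext_iff]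

theorem planeInclusion_mul_mul_apply_of_not {p : ι → Prop} (e : Fin 2 ≃ {x // p x})
    (A : Matrix (Fin 2) (Fin 2) ℝ) {x y : ι} (h : ¬ p x ∨ ¬ p y) :
    (planeInclusion e * A * (planeInclusion e)ᵀ) x y = 0 := by
  have key : ∀ z, ¬ p z → ∀ i, planeInclusion e z i = 0 := by
    intro z hz i
    have : z ≠ (e i).1 := fun h => hz (h ▸ (e i).2)
    simp [planeInclusion, this]
  rcases h with h | h
  · simp [mul_apply, key x h]
  · simp [mul_apply, key y h]

/-- The matrix acting as `R` on a coordinate plane and as the identity on the other coordinates. -/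
def planeInsert {p : ι → Prop} (e : Fin 2 ≃ {x // p x}) (R : Matrix (Fin 2) (Fin 2) ℝ) :
    Matrix ι ι ℝ :=
  1 + planeInclusion e * (R - 1) * (planeInclusion e)ᵀ

theorem planeInsert_mul {p : ι → Prop} (e : Fin 2 ≃ {x // p x})
    (R S : Matrix (Fin 2) (Fin 2) ℝ) :
    planeInsert e R * planeInsert e S = planeInsert e (R * S) := by
  unfold planeInsert
  have h := planeInclusion_transpose_mul e
  generalize planeInclusion e = E at *
  have h2 : E * (R - 1) * Eᵀ * (E * (S - 1) * Eᵀ) = E * ((R - 1) * (S - 1)) * Eᵀ := by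
    calc _ = E * (R - 1) * (Eᵀ * E) * (S - 1) * Eᵀ := by simp only [Matrix.mul_assoc]
      _ = _ := by rw [h, Matrix.mul_one]; simp only [Matrix.mul_assoc]
  have h3 : R * S - 1 = (R - 1) * (S - 1) + (R - 1) + (S - 1) := by noncomm_ring
  rw [h3, add_mul, mul_add, mul_add, h2, Matrix.mul_add, Matrix.mul_add, Matrix.add_mul,
    Matrix.add_mul, one_mul, one_mul, mul_one]
  abel

theorem planeInsert_one {p : ι → Prop} (e : Fin 2 ≃ {x // p x}) : planeInsert e 1 = 1 := by
  simp [planeInsert]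

theorem norm_planeInsert_sub_one_le {p : ι → Prop} (e : Fin 2 ≃ {x // p x})
    (R : Matrix (Fin 2) (Fin 2) ℝ) : ‖planeInsert e R - 1‖ ≤ ‖R - 1‖ := by
  have hE := norm_le_one_of_transpose_mul_self (planeInclusion_transpose_mul e)
  rw [planeInsert, add_sub_cancel_left]
  calc _ ≤ ‖planeInclusion e * (R - 1)‖ * ‖(planeInclusion e)ᵀ‖ := l2_opNorm_mul _ _
    _ ≤ ‖planeInclusion e‖ * ‖R - 1‖ * ‖(planeInclusion e)ᵀ‖ := by
        gcongr; exact l2_opNorm_mul _ _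
    _ ≤ 1 * ‖R - 1‖ * 1 := by rw [opNorm_transpose]; gcongr
    _ = _ := by ring

theorem det_planeInsert {p : ι → Prop} (e : Fin 2 ≃ {x // p x})
    (R : Matrix (Fin 2) (Fin 2) ℝ) : (planeInsert e R).det = R.det := by
  rw [planeInsert, Matrix.mul_assoc, det_one_add_mul_comm, Matrix.mul_assoc,
    planeInclusion_transpose_mul, Matrix.mul_one, add_sub_cancel]

/-- `planeInsert` for invertible matrices. -/
def planeInsertGL {p : ι → Prop} (e : Fin 2 ≃ {x // p x}) (R : GL (Fin 2) ℝ) : GL ι ℝ where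
  val := planeInsert e R.val
  inv := planeInsert e R⁻¹.val
  val_inv := by rw [planeInsert_mul, Units.mul_inv, planeInsert_one]
  inv_val := by rw [planeInsert_mul, Units.inv_mul, planeInsert_one]

theorem blockTriangular_planeInsert {b : ι → ℕ} {c : ℕ} (e : Fin 2 ≃ {x // b x = c})
    (R : Matrix (Fin 2) (Fin 2) ℝ) : (planeInsert e R).BlockTriangular b := by
  refine blockTriangular_one.add fun x y hxy => planeInclusion_mul_mul_apply_of_not e _ ?_
  by_contra! h
  rw [h.1, h.2] at hxy
  exact hxy.false

theorem toSquareBlock_planeInsert_of_ne {b : ι → ℕ} {c d : ℕ} (e : Fin 2 ≃ {x // b x = c})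
    (R : Matrix (Fin 2) (Fin 2) ℝ) (h : d ≠ c) : (planeInsert e R).toSquareBlock b d = 1 := by
  rw [← toSquareBlock_one]
  ext ⟨x, hx⟩ ⟨y, hy⟩
  have := planeInclusion_mul_mul_apply_of_not e (R - 1) (x := x) (y := y)
    (Or.inl (by rw [hx]; exact h))
  simp [toSquareBlock_def, planeInsert, this]

theorem toSquareBlock_planeInsert {b : ι → ℕ} {c : ℕ} (e : Fin 2 ≃ {x // b x = c})
    (R : Matrix (Fin 2) (Fin 2) ℝ) :
    ((planeInsert e R).toSquareBlock b c).submatrix e e = R := by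
  ext i j
  have := planeInclusion_mul_mul_apply e (R - 1) i j
  simp [toSquareBlock_def, planeInsert, this, one_apply, ← Subtype.ext_iff]

instance : (slSubgroup ι).Normal := by
  unfold slSubgroup
  infer_instance

theorem mem_slSubgroup_iff {g : GL ι ℝ} : g ∈ slSubgroup ι ↔ g.val.det = 1 := by
  rw [slSubgroup, MonoidHom.mem_ker, Units.ext_iff]
  rfl

theorem aeval_charpoly_prod_eq_zero {s : Finset ℕ} {f : ℕ → ℝ[X]} {z : ℂ}
    (h : aeval z (∏ c ∈ s, f c) = 0) : ∃ c ∈ s, aeval z (f c) = 0 := by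
  rw [map_prod, Finset.prod_eq_zero_iff] at h
  exact h

theorem seqProd_submatrix {κ μ : Type*} [Fintype κ] [DecidableEq κ] [Fintype μ] [DecidableEq μ]
    (e : κ ≃ μ) (a : ℕ → Matrix μ μ ℝ) (n : ℕ) :
    (seqProd a n).submatrix e e = seqProd (fun k => (a k).submatrix e e) n := by
  induction n with
  | zero => simp [seqProd]
  | succ n ih => rw [seqProd, seqProd, ← ih, submatrix_mul_equiv]

theorem charpoly_submatrix_equiv {κ μ : Type*} [Fintype κ] [DecidableEq κ] [Fintype μ]
    [DecidableEq μ] (e : κ ≃ μ) (A : Matrix μ μ ℝ) : (A.submatrix e e).charpoly = A.charpoly := by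
  rw [← charpoly_reindex e.symm A]
  rfl

theorem trace_sq_lt_of_nonreal_root {A : Matrix (Fin 2) (Fin 2) ℝ} {z : ℂ}
    (hz : aeval z A.charpoly = 0) (him : z.im ≠ 0) : A.trace ^ 2 < 4 * A.det := by
  rw [charpoly_fin_two] at hz
  have hre := congrArg Complex.re hz
  have him' := congrArg Complex.im hz
  simp [pow_two] at hre him'
  have h1 : z.im * (2 * z.re - A.trace) = 0 := by linarith
  have h2 : 2 * z.re = A.trace := by
    rcases mul_eq_zero.1 h1 with h | h
    · exact absurd h him
    · linarith
  nlinarith [sq_pos_of_ne_zero him]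

theorem im_eq_zero_of_irreducible_natDegree_le_one {p : ℝ[X]} (hp : p.natDegree ≤ 1)
    (hp0 : p ≠ 0) {z : ℂ} (hz : aeval z p = 0) : z.im = 0 := by
  obtain ⟨a, c, rfl⟩ := exists_eq_X_add_C_of_natDegree_le_one hp
  have hre := congrArg Complex.re hz
  have him := congrArg Complex.im hz
  simp at hre him
  rcases him with h | h
  · rw [h] at hre hp0
    simp at hre
    rw [hre] at hp0
    simp at hp0
  · exact h

/-- A nonreal pair of eigenvalues of the product can be made real, keeping its modulus and all the
other eigenvalues. -/
theorem exists_isDeformation_rotate {ℓ : ℕ} {δ θ₁ : ℝ} (hθ₁ : 0 < θ₁)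
    (hnear : ∀ θ, |θ| ≤ θ₁ → ‖planeRotation θ - 1‖ ≤ Real.exp δ - 1) (hℓ : Real.pi < ℓ * θ₁)
    (a : ℕ → GL ι ℝ) {z : ℂ} (hz : aeval z (seqProd a ℓ).val.charpoly = 0) (him : z.im ≠ 0) :
    ∃ (Y : ℝ → ℕ → GL ι ℝ) (g : ℝ[X]) (D τ₀ τ₁ : ℝ),
      IsDeformation (slSubgroup ι) δ ℓ a
        (fun p => ∃ τ : ℝ, τ ^ 2 ≤ 4 * D ∧ p = g * (X ^ 2 - C τ * X + C D)) Y ∧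
      τ₀ ^ 2 < 4 * D ∧ (seqProd a ℓ).val.charpoly = g * (X ^ 2 - C τ₀ * X + C D) ∧
      τ₁ ^ 2 = 4 * D ∧ (seqProd (Y 1 * a) ℓ).val.charpoly = g * (X ^ 2 - C τ₁ * X + C D) := by
  obtain ⟨Q₀, b, hQ₀, hT, hirr⟩ := exists_orthogonal_blockTriangular (seqProd a ℓ).val
  obtain ⟨Q, hQ, hQ0, hQℓ, hQT⟩ := exists_orthogonal_frames a ℓ hQ₀ hT
  set r : ℕ → GL ι ℝ := fun n => (Q (n + 1))⁻¹ * a n * Q n with hr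
  have hr1 : (Q₀⁻¹ * seqProd a ℓ * Q₀ : GL ι ℝ) = seqProd r ℓ := by
    have h1 := seqProd_conj a (fun _ => 1) Q ℓ
    have h3 : ((fun n => Q (n + 1) * 1 * (Q (n + 1))⁻¹) * a) = a := by
      ext n : 1
      simp
    rw [h3] at h1
    rw [h1, hQ0, hQℓ]
    simp only [one_mul]
    change Q₀⁻¹ * (Q₀ * seqProd r ℓ * Q₀⁻¹) * Q₀ = seqProd r ℓ
    generalize seqProd r ℓ = s
    group
  have hMr : (seqProd a ℓ).val.charpoly = (seqProd r ℓ).val.charpoly := by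
    rw [← hr1]
    exact (charpoly_mul_mul_of_mul_eq_one (Units.mul_inv Q₀)).symm
  have hN : (Q₀⁻¹).val * (seqProd a ℓ).val * Q₀.val = (seqProd r ℓ).val := by
    rw [← hr1]; rfl
  rw [hN] at hirr
  have hrT := blockTriangular_seqProd hQT
  rw [hMr, hrT.charpoly] at hz
  obtain ⟨c, hc, hzc⟩ := aeval_charpoly_prod_eq_zero hz
  -- A real irreducible polynomial has degree at most two, and its nonreal root excludes degree one.
  have hcard : Fintype.card {x // b x = c} = 2 := by
    have h1 := (hirr c hc).natDegree_le_two
    have h2 : ¬ ((seqProd r ℓ).val.toSquareBlock b c).charpoly.natDegree ≤ 1 := fun h =>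
      him (im_eq_zero_of_irreducible_natDegree_le_one h (charpoly_monic _).ne_zero hzc)
    rw [charpoly_natDegree_eq_dim] at h1 h2
    omega
  let e : Fin 2 ≃ {x // b x = c} := (Fintype.equivFinOfCardEq hcard).symm
  -- Triangularity of `r n`, and with it invertibility of the diagonal block, is known only for `n <
  -- ℓ`. Later values are set to `1`.
  have hα : ∃ α : ℕ → GL (Fin 2) ℝ, ∀ n < ℓ,
      (α n).val = ((r n).val.toSquareBlock b c).submatrix e e := by
    have : ∀ n, ∃ β : GL (Fin 2) ℝ, n < ℓ →
        β.val = ((r n).val.toSquareBlock b c).submatrix e e := by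
      intro n
      by_cases hn : n < ℓ
      · have h1 := hQT n hn
        have h2 : ((r n).val.toSquareBlock b c) * ((r n)⁻¹.val.toSquareBlock b c) = 1 := by
          rw [← toSquareBlock_mul h1 (blockTriangular_val_inv h1), Units.mul_inv,
            toSquareBlock_one]
        have h3 : ((r n).val.toSquareBlock b c).submatrix e e *
            ((r n)⁻¹.val.toSquareBlock b c).submatrix e e = 1 := by
          rw [submatrix_mul_equiv, h2, submatrix_one_equiv]
        exact ⟨⟨_, _, h3, mul_eq_one_comm.1 h3⟩, fun _ => rfl⟩
      · exact ⟨1, fun h => absurd h hn⟩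
    choose α hα using this
    exact ⟨α, hα⟩
  obtain ⟨α, hα⟩ := hα
  have hαprod : ((seqProd r ℓ).val.toSquareBlock b c).submatrix e e = (seqProd α ℓ).val := by
    rw [toSquareBlock_seqProd hQT, seqProd_submatrix, seqProd_congr (fun k hk => (hα k hk).symm)]
    generalize ℓ = n
    induction n with
    | zero => rfl
    | succ n ih => rw [seqProd, seqProd, ih]; rfl
  have hell : (seqProd α ℓ).val.trace ^ 2 < 4 * (seqProd α ℓ).val.det := by
    refine trace_sq_lt_of_nonreal_root (z := z) ?_ him
    rw [← hαprod, charpoly_submatrix_equiv]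
    exact hzc
  obtain ⟨σ, hσ, θ₀, hθ₀, hlt, heq⟩ := exists_rotatedProd_parabolic hθ₁ hℓ hell
  set D : ℝ → ℕ → GL ι ℝ := fun t n => planeInsertGL e (planeRotationGL (σ n * (t * θ₀))) with hD
  set Y : ℝ → ℕ → GL ι ℝ := fun t n => Q (n + 1) * D t n * (Q (n + 1))⁻¹ with hY
  -- The contribution of the other blocks, on which the inserted rotations act as the identity.
  set g : ℝ[X] := ∏ d ∈ (Finset.univ.image b).erase c,
    ((seqProd r ℓ).val.toSquareBlock b d).charpoly with hg
  have hDT : ∀ t n, (D t n).val.BlockTriangular b := fun t n => blockTriangular_planeInsert e _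
  have hchar : ∀ t, (seqProd (Y t * a) ℓ).val.charpoly = g * (X ^ 2 -
      C (rotatedProd α σ ℓ (t * θ₀)).val.trace * X + C (seqProd α ℓ).val.det) := by
    intro t
    have hT2 : ∀ k < ℓ, ((D t k * r k : GL ι ℝ) : Matrix ι ι ℝ).BlockTriangular b :=
      fun k hk => (hDT t k).mul (hQT k hk)
    have e1 : (seqProd (Y t * a) ℓ).val.charpoly =
        (seqProd (fun n => D t n * r n) ℓ).val.charpoly := by
      have := seqProd_conj a (D t) Q ℓ
      rw [hQ0, hQℓ] at this
      rw [hY, this, Units.val_mul, Units.val_mul]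
      exact charpoly_mul_mul_of_mul_eq_one (Units.inv_mul _)
    rw [e1, (blockTriangular_seqProd hT2).charpoly, ← Finset.mul_prod_erase _ _ hc, mul_comm]
    congr 1
    · refine Finset.prod_congr rfl fun d hd => ?_
      rw [toSquareBlock_seqProd hT2, toSquareBlock_seqProd hQT]
      congr 1
      refine seqProd_congr fun k hk => ?_
      rw [Units.val_mul, toSquareBlock_mul (hDT t k) (hQT k hk)]
      have : (D t k).val.toSquareBlock b d = 1 :=
        toSquareBlock_planeInsert_of_ne e _ (Finset.ne_of_mem_erase hd)
      rw [this, Matrix.one_mul]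
    · rw [← charpoly_submatrix_equiv e, toSquareBlock_seqProd hT2, seqProd_submatrix]
      have e2 : seqProd (fun k => ((D t k * r k : GL ι ℝ).val.toSquareBlock b c).submatrix e e) ℓ =
          (rotatedProd α σ ℓ (t * θ₀)).val := by
        have e3 : ∀ k < ℓ, ((D t k * r k : GL ι ℝ).val.toSquareBlock b c).submatrix e e =
            (planeRotationGL (σ k * (t * θ₀)) * α k).val := by
          intro k hk
          rw [Units.val_mul, toSquareBlock_mul (hDT t k) (hQT k hk), ← submatrix_mul_equiv _ _ e e e,
            ← hα k hk, Units.val_mul]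
          congr 1
          exact toSquareBlock_planeInsert e _
        rw [seqProd_congr e3, rotatedProd]
        generalize ℓ = n
        induction n with
        | zero => rfl
        | succ n ih => rw [seqProd, seqProd, ih]; rfl
      rw [e2, charpoly_fin_two, det_rotatedProd]
  have hzero : Y 0 = 1 := by
    have h1 : planeRotationGL 0 = 1 := Units.ext planeRotation_zero
    have h2 : planeInsertGL e 1 = 1 := Units.ext (planeInsert_one e)
    ext n : 1
    simp [hY, hD, h1, h2]
  refine ⟨Y, g, (seqProd α ℓ).val.det, (seqProd α ℓ).val.trace,
    (rotatedProd α σ ℓ θ₀).val.trace, ⟨fun n => ?_, hzero, fun t n => ?_, fun t ht n => ?_,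
      fun t ht => ⟨_, ?_, hchar t⟩⟩, hell, ?_, heq, by simpa using hchar 1⟩
  · have h1 : Continuous fun t => D t n := by
      rw [Units.continuous_iff]
      have h2 : ∀ s : ℝ, Continuous fun t => planeInsert e (planeRotation (s * (t * θ₀))) := by
        intro s
        unfold planeInsert
        have := continuous_planeRotation.comp (show Continuous fun t => s * (t * θ₀) by fun_prop)
        have h3 : Continuous fun t => planeRotation (s * (t * θ₀)) - 1 := this.sub continuous_const
        exact continuous_const.add ((continuous_const.matrix_mul h3).matrix_mul continuous_const)
      refine ⟨h2 (σ n), ?_⟩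
      have := h2 (-σ n)
      simp only [neg_mul] at this
      exact this
    exact (continuous_const.mul h1).mul continuous_const
  · refine Subgroup.Normal.conj_mem inferInstance _ ?_ _
    rw [mem_slSubgroup_iff]
    exact (det_planeInsert e _).trans (det_planeRotation _)
  · have hbd : |σ n * (t * θ₀)| ≤ θ₁ := by
      rw [abs_mul, abs_mul, abs_of_nonneg ht.1, abs_of_pos hθ₀.1]
      calc _ ≤ 1 * (1 * θ₀) := by
            gcongr
            · exact mul_nonneg ht.1 hθ₀.1.le
            · exact hσ n
            · exact hθ₀.1.le
            · exact ht.2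
        _ ≤ θ₁ := by linarith [hθ₀.2]
    refine NearOne.conj ⟨?_, ?_⟩ (hQ _)
    · exact (norm_planeInsert_sub_one_le e _).trans (hnear _ hbd)
    · exact (norm_planeInsert_sub_one_le e _).trans (hnear _ (by rwa [abs_neg]))
  · rcases ht.2.lt_or_eq with h | h
    · refine (hlt _ ⟨mul_nonneg ht.1.le hθ₀.1.le, ?_⟩).le
      nlinarith [hθ₀.1]
    · rw [h, one_mul]; exact heq.le
  · have := hchar 0
    have h2 : rotatedProd α σ ℓ (0 * θ₀) = seqProd α ℓ := by
      have h1 : planeRotationGL 0 = 1 := Units.ext planeRotation_zero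
      unfold rotatedProd
      simp [h1]
    rw [h2, hzero, one_mul] at this
    exact this

end BlockRotation

/-! ### Making all eigenvalues real while keeping their moduli. -/

section RealEigenvalues

open Matrix Polynomial

/-- No complex root has modulus one. -/
def NoUnitRoot (p : ℝ[X]) : Prop := ∀ z : ℂ, aeval z p = 0 → ‖z‖ ≠ 1

/-- All complex roots have modulus less than one. -/
def ContractingRoots (p : ℝ[X]) : Prop := ∀ z : ℂ, aeval z p = 0 → ‖z‖ < 1

/-- All complex roots are real. -/
def RealRoots (p : ℝ[X]) : Prop := ∀ z : ℂ, aeval z p = 0 → z.im = 0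

/-- Each root of `q` has the modulus of some root of `p`. -/
def RootModuliSubset (p q : ℝ[X]) : Prop :=
  ∀ z : ℂ, aeval z q = 0 → ∃ w : ℂ, aeval w p = 0 ∧ ‖z‖ = ‖w‖

/-- The number of nonreal roots, with multiplicity. -/
noncomputable def nonrealRootCount (p : ℝ[X]) : ℕ :=
  ((p.map (algebraMap ℝ ℂ)).roots.filter fun z => z.im ≠ 0).card

theorem mem_roots_map_iff {p : ℝ[X]} (hp : p ≠ 0) {z : ℂ} :
    z ∈ (p.map (algebraMap ℝ ℂ)).roots ↔ aeval z p = 0 := by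
  rw [mem_roots (Polynomial.map_ne_zero hp), IsRoot.def, eval_map_algebraMap]

theorem nonrealRootCount_mul {p q : ℝ[X]} (hp : p ≠ 0) (hq : q ≠ 0) :
    nonrealRootCount (p * q) = nonrealRootCount p + nonrealRootCount q := by
  unfold nonrealRootCount
  rw [Polynomial.map_mul, roots_mul (mul_ne_zero (Polynomial.map_ne_zero hp)
    (Polynomial.map_ne_zero hq)), Multiset.filter_add, Multiset.card_add]

theorem nonrealRootCount_eq_zero_iff {p : ℝ[X]} (hp : p ≠ 0) :
    nonrealRootCount p = 0 ↔ RealRoots p := by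
  unfold nonrealRootCount RealRoots
  rw [Multiset.card_eq_zero, Multiset.filter_eq_nil]
  simp only [mem_roots_map_iff hp, not_not]

theorem nonrealRootCount_le (p : ℝ[X]) : nonrealRootCount p ≤ p.natDegree := by
  unfold nonrealRootCount
  calc _ ≤ (p.map (algebraMap ℝ ℂ)).roots.card := Multiset.card_le_card (Multiset.filter_le _ _)
    _ ≤ _ := (card_roots' _).trans (natDegree_map_le)

theorem aeval_quadratic {τ D : ℝ} {z : ℂ} (hz : aeval z (X ^ 2 - C τ * X + C D : ℝ[X]) = 0) :
    z.im * (2 * z.re - τ) = 0 ∧ z.re ^ 2 - z.im ^ 2 - τ * z.re + D = 0 := by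
  have hre := congrArg Complex.re hz
  have him := congrArg Complex.im hz
  simp [pow_two] at hre him
  constructor <;> linarith

/-- The two roots are conjugate or equal and their product is `D`. Rotations preserve the
determinant `D`, so they keep the modulus up to the parabolic time. -/
theorem norm_sq_of_quadratic_root {τ D : ℝ} (h : τ ^ 2 ≤ 4 * D) {z : ℂ}
    (hz : aeval z (X ^ 2 - C τ * X + C D : ℝ[X]) = 0) : ‖z‖ ^ 2 = D := by
  obtain ⟨h1, h2⟩ := aeval_quadratic hz
  rw [← Complex.normSq_eq_norm_sq, Complex.normSq_apply]
  rcases mul_eq_zero.1 h1 with h3 | h3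
  · rw [h3] at h2 ⊢
    have h4 : (2 * z.re - τ) ^ 2 = 0 := le_antisymm (by nlinarith) (sq_nonneg _)
    have h5 : 2 * z.re - τ = 0 := by simpa using h4
    nlinarith
  · have h4 : τ = 2 * z.re := by linarith
    rw [h4] at h2
    nlinarith

theorem realRoots_quadratic {τ D : ℝ} (h : τ ^ 2 = 4 * D) :
    RealRoots (X ^ 2 - C τ * X + C D : ℝ[X]) := by
  intro z hz
  obtain ⟨h1, h2⟩ := aeval_quadratic hz
  rcases mul_eq_zero.1 h1 with h3 | h3
  · exact h3
  · have : z.im ^ 2 = 0 := by nlinarith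
    simpa using this

theorem quadratic_ne_zero (τ D : ℝ) : (X ^ 2 - C τ * X + C D : ℝ[X]) ≠ 0 := by
  intro h
  have := congrArg (fun p => coeff p 2) h
  simp at this

theorem not_realRoots_quadratic {τ D : ℝ} (h : τ ^ 2 < 4 * D) :
    ¬ RealRoots (X ^ 2 - C τ * X + C D : ℝ[X]) := by
  intro hreal
  have hdeg : (X ^ 2 - C τ * X + C D : ℝ[X]).degree = 2 := by compute_degree!
  obtain ⟨z, hz⟩ := IsAlgClosed.exists_aeval_eq_zero ℂ (X ^ 2 - C τ * X + C D : ℝ[X])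
    (by rw [hdeg]; norm_num)
  obtain ⟨h1, h2⟩ := aeval_quadratic hz
  rw [hreal z hz] at h2
  nlinarith [sq_nonneg (2 * z.re - τ)]

theorem rootModuliSubset_refl (p : ℝ[X]) : RootModuliSubset p p := fun z hz => ⟨z, hz, rfl⟩

theorem RootModuliSubset.trans {p q r : ℝ[X]} (h₁ : RootModuliSubset p q)
    (h₂ : RootModuliSubset q r) : RootModuliSubset p r := by
  intro z hz
  obtain ⟨w, hw, h⟩ := h₂ z hz
  obtain ⟨v, hv, h'⟩ := h₁ w hw
  exact ⟨v, hv, h.trans h'⟩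

theorem RootModuliSubset.noUnitRoot {p q : ℝ[X]} (h : RootModuliSubset p q) (hp : NoUnitRoot p) :
    NoUnitRoot q := by
  intro z hz
  obtain ⟨w, hw, h⟩ := h z hz
  rw [h]; exact hp w hw

theorem RootModuliSubset.contractingRoots {p q : ℝ[X]} (h : RootModuliSubset p q)
    (hp : ContractingRoots p) : ContractingRoots q := by
  intro z hz
  obtain ⟨w, hw, h⟩ := h z hz
  rw [h]; exact hp w hw

theorem rootModuliSubset_mul_quadratic {g : ℝ[X]} {τ τ' D : ℝ} (h : τ ^ 2 ≤ 4 * D)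
    (h' : τ' ^ 2 ≤ 4 * D) :
    RootModuliSubset (g * (X ^ 2 - C τ * X + C D)) (g * (X ^ 2 - C τ' * X + C D)) := by
  intro z hz
  rw [map_mul, mul_eq_zero] at hz
  rcases hz with hz | hz
  · exact ⟨z, by rw [map_mul, hz, zero_mul], rfl⟩
  · have hdeg : (X ^ 2 - C τ * X + C D : ℝ[X]).degree = 2 := by compute_degree!
    obtain ⟨w, hw⟩ := IsAlgClosed.exists_aeval_eq_zero ℂ (X ^ 2 - C τ * X + C D : ℝ[X])
      (by rw [hdeg]; norm_num)
    refine ⟨w, by rw [map_mul, hw, mul_zero], ?_⟩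
    have h1 := norm_sq_of_quadratic_root h hw
    have h2 := norm_sq_of_quadratic_root h' hz
    exact (sq_eq_sq₀ (norm_nonneg _) (norm_nonneg _)).1 (h2.trans h1.symm)

variable {ι : Type*} [Fintype ι] [DecidableEq ι]

theorem nearOne_one {δ : ℝ} (hδ : 0 ≤ δ) : NearOne δ (1 : GL ι ℝ) := by
  have : (0 : ℝ) ≤ Real.exp δ - 1 := by linarith [Real.add_one_le_exp δ]
  constructor <;> simpa

theorem exists_planeRotation_near {δ : ℝ} (hδ : 0 < δ) :
    ∃ θ₁ > 0, ∀ θ, |θ| ≤ θ₁ → ‖planeRotation θ - 1‖ ≤ Real.exp δ - 1 := by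
  have h1 : 0 < Real.exp δ - 1 := by linarith [Real.add_one_lt_exp hδ.ne']
  have h2 : Continuous fun θ => ‖planeRotation θ - 1‖ :=
    (continuous_planeRotation.sub continuous_const).norm
  have h3 : ∀ᶠ θ in nhds (0 : ℝ), ‖planeRotation θ - 1‖ < Real.exp δ - 1 := by
    refine h2.continuousAt.eventually_lt continuousAt_const ?_
    simpa [planeRotation_zero] using h1
  obtain ⟨r, hr, h4⟩ := Metric.eventually_nhds_iff.1 h3
  refine ⟨r / 2, by linarith, fun θ hθ => (h4 ?_).le⟩
  rw [Real.dist_eq, sub_zero]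
  linarith

/-- All eigenvalues of a long product can be made real by a perturbation keeping the moduli. -/
theorem exists_isDeformation_realRoots_aux (m : ℕ) : ∀ {δ : ℝ}, 0 < δ → ∃ T : ℕ, ∀ ℓ, T ≤ ℓ →
    ∀ a : ℕ → GL ι ℝ, nonrealRootCount (seqProd a ℓ).val.charpoly ≤ m →
    ∃ Y, IsDeformation (slSubgroup ι) δ ℓ a (RootModuliSubset (seqProd a ℓ).val.charpoly) Y ∧
      RealRoots (seqProd (Y 1 * a) ℓ).val.charpoly := by
  induction m with
  | zero =>
    intro δ hδ
    refine ⟨0, fun ℓ _ a ha => ⟨fun _ => 1, ⟨fun n => continuous_const, rfl, fun t n => one_mem _,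
      fun t _ n => nearOne_one hδ.le, fun t _ => ?_⟩, ?_⟩⟩
    · rw [one_mul]; exact rootModuliSubset_refl _
    · rw [one_mul]
      exact (nonrealRootCount_eq_zero_iff (charpoly_monic _).ne_zero).1 (Nat.le_zero.1 ha)
  | succ m ih =>
    intro δ hδ
    obtain ⟨T₁, hT₁⟩ := ih (half_pos hδ)
    obtain ⟨θ₁, hθ₁, hnear⟩ := exists_planeRotation_near (half_pos hδ)
    obtain ⟨T₂, hT₂⟩ := exists_nat_gt (Real.pi / θ₁)
    refine ⟨max T₁ T₂, fun ℓ hℓ a ha => ?_⟩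
    have hmax := max_le_iff.1 hℓ
    by_cases hreal : RealRoots (seqProd a ℓ).val.charpoly
    · obtain ⟨Y, hY, hY'⟩ := hT₁ ℓ hmax.1 a
        (((nonrealRootCount_eq_zero_iff (charpoly_monic _).ne_zero).2 hreal).trans_le (zero_le))
      exact ⟨Y, hY.mono (by linarith) fun _ h => h, hY'⟩
    unfold RealRoots at hreal
    push Not at hreal
    obtain ⟨z, hz, him⟩ := hreal
    have hπ : Real.pi < ℓ * θ₁ := by
      rw [div_lt_iff₀ hθ₁] at hT₂
      have : (T₂ : ℝ) ≤ ℓ := by exact_mod_cast hmax.2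
      nlinarith
    obtain ⟨Y, g, D, τ₀, τ₁, hY, hτ₀, hp₀, hτ₁, hp₁⟩ :=
      exists_isDeformation_rotate hθ₁ hnear hπ a hz him
    have hg : g ≠ 0 := by
      rintro rfl
      rw [zero_mul] at hp₀
      exact (charpoly_monic _).ne_zero hp₀
    -- One quadratic factor with nonreal roots has been replaced by one with a double real root, the
    -- cofactor `g` being the same.
    have hlt : nonrealRootCount (seqProd (Y 1 * a) ℓ).val.charpoly ≤ m := by
      rw [hp₀, nonrealRootCount_mul hg (quadratic_ne_zero _ _)] at ha
      rw [hp₁, nonrealRootCount_mul hg (quadratic_ne_zero _ _),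
        (nonrealRootCount_eq_zero_iff (quadratic_ne_zero _ _)).2 (realRoots_quadratic hτ₁)]
      have : nonrealRootCount (X ^ 2 - C τ₀ * X + C D : ℝ[X]) ≠ 0 := fun h =>
        not_realRoots_quadratic hτ₀ ((nonrealRootCount_eq_zero_iff (quadratic_ne_zero _ _)).1 h)
      omega
    obtain ⟨Y', hY', hreal'⟩ := hT₁ ℓ hmax.1 _ hlt
    have h1 : ∀ p, (∃ τ : ℝ, τ ^ 2 ≤ 4 * D ∧ p = g * (X ^ 2 - C τ * X + C D)) →
        RootModuliSubset (seqProd a ℓ).val.charpoly p := by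
      rintro p ⟨τ, hτ, rfl⟩
      rw [hp₀]
      exact rootModuliSubset_mul_quadratic hτ₀.le hτ
    obtain ⟨Z, hZ, hZ1⟩ := (hY.mono le_rfl h1).trans
      (hY'.mono le_rfl fun p hp => (h1 _ ⟨τ₁, hτ₁.le, hp₁⟩).trans hp)
    exact ⟨Z, hZ.mono (by linarith) fun _ h => h, by rw [hZ1]; exact hreal'⟩

/-- The number of rotations needed is bounded by the dimension, which makes `T` independent of the
sequence. -/
theorem exists_isDeformation_realRoots (ι : Type*) [Fintype ι] [DecidableEq ι] {δ : ℝ}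
    (hδ : 0 < δ) : ∃ T : ℕ, ∀ ℓ, T ≤ ℓ → ∀ a : ℕ → GL ι ℝ,
    ∃ Y, IsDeformation (slSubgroup ι) δ ℓ a (RootModuliSubset (seqProd a ℓ).val.charpoly) Y ∧
      RealRoots (seqProd (Y 1 * a) ℓ).val.charpoly := by
  obtain ⟨T, hT⟩ := exists_isDeformation_realRoots_aux (ι := ι) (Fintype.card ι) hδ
  refine ⟨T, fun ℓ hℓ a => hT ℓ hℓ a ((nonrealRootCount_le _).trans ?_)⟩
  rw [charpoly_natDegree_eq_dim]

end RealEigenvalues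

/-! ### Choice of the rescaling exponents. -/

section Slopes

/-- Perturbing the slopes `κ₀` generically, keeping their sum, makes the values `κ c + L c`
pairwise distinct. -/
theorem exists_generic_slopes {ι : Type*} [Fintype ι] (b : ι → ℕ) (L κ₀ : ℕ → ℝ) {K : ℝ}
    (hK : ∀ x, |κ₀ (b x)| ≤ K) :
    ∃ κ : ℕ → ℝ, (∀ x, |κ (b x)| ≤ K + 1) ∧ (∀ x, |κ (b x) - κ₀ (b x)| ≤ 1) ∧
      ∑ x, κ (b x) = ∑ x, κ₀ (b x) ∧
      ∀ x y, κ (b x) + L (b x) = κ (b y) + L (b y) → b x = b y := by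
  rcases isEmpty_or_nonempty ι with hι | hι
  · exact ⟨κ₀, fun x => hι.elim x, fun x => hι.elim x, rfl, fun x => hι.elim x⟩
  -- The correction is `τ (b x - m)`. Subtracting the mean label makes its sum over all indices
  -- zero.
  set m : ℝ := (∑ x, (b x : ℝ)) / Fintype.card ι with hm
  obtain ⟨V, hV⟩ := (Set.finite_range fun x => |(b x : ℝ) - m|).bddAbove
  have hV0 : 0 ≤ V := (abs_nonneg _).trans (hV ⟨hι.some, rfl⟩)
  -- These are the finitely many `τ` for which two distinct labels could collide; any small positive
  -- `τ` outside this set works.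
  have hbad : (Set.range fun xy : ι × ι => (L (b xy.2) + κ₀ (b xy.2) - L (b xy.1) - κ₀ (b xy.1)) /
      ((b xy.1 : ℝ) - b xy.2)).Finite := Set.finite_range _
  have hpos : (0 : ℝ) < 1 / (V + 1) := by positivity
  obtain ⟨τ, hτ, hτbad⟩ := ((Set.Ioo_infinite hpos).sdiff hbad).nonempty
  have hsmall : ∀ x, |τ * ((b x : ℝ) - m)| ≤ 1 := by
    intro x
    have h1 : |(b x : ℝ) - m| ≤ V := hV ⟨x, rfl⟩
    rw [abs_mul, abs_of_pos hτ.1]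
    have h2 := hτ.2
    rw [lt_div_iff₀ (by linarith)] at h2
    nlinarith [hτ.1]
  refine ⟨fun c => κ₀ c + τ * (c - m), fun x => ?_, fun x => ?_, ?_, fun x y hxy => ?_⟩
  · exact (abs_add_le _ _).trans (add_le_add (hK x) (hsmall x))
  · simpa using hsmall x
  · have hcard : (Fintype.card ι : ℝ) ≠ 0 := by exact_mod_cast Fintype.card_ne_zero
    rw [Finset.sum_add_distrib, ← Finset.mul_sum, Finset.sum_sub_distrib, Finset.sum_const,
      Finset.card_univ, nsmul_eq_mul, hm, mul_div_cancel₀ _ hcard]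
    simp
  · by_contra hne
    have hne' : (b x : ℝ) - b y ≠ 0 := sub_ne_zero.2 (by exact_mod_cast hne)
    refine hτbad ⟨(x, y), ?_⟩
    simp only at hxy ⊢
    rw [div_eq_iff hne']
    linarith

/-- Slopes moving every exponent `L c` away from zero. -/
theorem exists_slopes {ι : Type*} [Fintype ι] (b : ι → ℕ) (L : ℕ → ℝ) :
    ∃ κ : ℕ → ℝ, (∀ x, |κ (b x)| ≤ 3) ∧
      (∀ x, (1 ≤ κ (b x) ∧ 0 ≤ L (b x)) ∨ (κ (b x) ≤ -1 ∧ L (b x) ≤ 0 ∧ L (b x) ≠ 0)) ∧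
      ∀ x y, κ (b x) + L (b x) = κ (b y) + L (b y) → b x = b y := by
  obtain ⟨κ, h1, h2, -, h4⟩ := exists_generic_slopes b L (fun c => if 0 ≤ L c then 2 else -2)
    (K := 2) (fun x => by split_ifs <;> norm_num)
  refine ⟨κ, fun x => (h1 x).trans (by norm_num), fun x => ?_, h4⟩
  have h := abs_le.1 (h2 x)
  by_cases hL : 0 ≤ L (b x)
  · rw [if_pos hL] at h
    exact Or.inl ⟨by linarith, hL⟩
  · rw [if_neg hL] at h
    exact Or.inr ⟨by linarith, by linarith, by linarith⟩

/-- Slopes of sum zero moving every exponent `L c` away from zero. -/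
theorem exists_slopes_sum_zero {ι : Type*} [Fintype ι] (b : ι → ℕ) (L : ℕ → ℝ)
    (hL : ∑ x, L (b x) = 0) {x₁ x₂ : ι} (hx : b x₁ ≠ b x₂) :
    ∃ κ : ℕ → ℝ, (∀ x, |κ (b x)| ≤ 2 * Fintype.card ι + 1) ∧ ∑ x, κ (b x) = 0 ∧
      (∀ x, (1 ≤ κ (b x) ∧ 0 ≤ L (b x)) ∨ (κ (b x) ≤ -1 ∧ L (b x) ≤ 0)) ∧
      ∀ x y, κ (b x) + L (b x) = κ (b y) + L (b y) → b x = b y := by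
  classical
  -- `P` selects the blocks to be pushed up. Sum zero forces both classes to be nonempty: if all
  -- exponents vanish, one block is singled out arbitrarily; otherwise exponents of sum zero take
  -- both signs.
  obtain ⟨P, hP1, hP2, hP3, hP4⟩ : ∃ P : ℕ → Prop, (∃ x, P (b x)) ∧ (∃ x, ¬ P (b x)) ∧
      (∀ x, P (b x) → 0 ≤ L (b x)) ∧ ∀ x, ¬ P (b x) → L (b x) ≤ 0 := by
    by_cases h : ∀ x, L (b x) = 0
    · exact ⟨fun c => c = b x₁, ⟨x₁, rfl⟩, ⟨x₂, hx.symm⟩, fun x _ => (h x).ge, fun x _ => (h x).le⟩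
    · push Not at h
      obtain ⟨x, hx⟩ := h
      refine ⟨fun c => 0 ≤ L c, ?_, ?_, fun x h => h, fun x h => (not_le.1 h).le⟩
      · by_contra! hcon
        have := Finset.sum_lt_sum_of_nonempty (s := Finset.univ) ⟨x, Finset.mem_univ x⟩
          (fun y _ => hcon y)
        simp [hL] at this
      · by_contra! hcon
        exact hx ((Finset.sum_eq_zero_iff_of_nonneg fun y _ => hcon y).1 hL x (Finset.mem_univ x))
  set A := Finset.univ.filter fun x => P (b x) with hA
  set B := Finset.univ.filter fun x => ¬ P (b x) with hB
  have hApos : (0 : ℝ) < A.card := by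
    obtain ⟨x, hx⟩ := hP1
    exact_mod_cast Finset.card_pos.2 ⟨x, by simpa [hA] using hx⟩
  have hBpos : (0 : ℝ) < B.card := by
    obtain ⟨x, hx⟩ := hP2
    exact_mod_cast Finset.card_pos.2 ⟨x, by simpa [hB] using hx⟩
  have hA1 : (1 : ℝ) ≤ A.card := by exact_mod_cast hApos
  have hB1 : (1 : ℝ) ≤ B.card := by exact_mod_cast hBpos
  have hAn : (A.card : ℝ) ≤ Fintype.card ι := by exact_mod_cast Finset.card_le_univ A
  have hBn : (B.card : ℝ) ≤ Fintype.card ι := by exact_mod_cast Finset.card_le_univ B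
  set n : ℝ := ((Fintype.card ι : ℕ) : ℝ) with hn
  have hA2 : 2 ≤ 2 * n / A.card := by rw [le_div_iff₀ hApos]; linarith
  have hB2 : 2 ≤ 2 * n / B.card := by rw [le_div_iff₀ hBpos]; linarith
  have hA3 : 2 * n / A.card ≤ 2 * n := div_le_self (by linarith) hA1
  have hB3 : 2 * n / B.card ≤ 2 * n := div_le_self (by linarith) hB1
  -- The weights `2n / |A|` and `-2n / |B|` balance, and their moduli lie between `2` and `2n`, so a
  -- correction of at most `1` leaves modulus at least `1`.
  obtain ⟨κ, h1, h2, h3, h4⟩ := exists_generic_slopes b L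
    (fun c => if P c then 2 * n / A.card else -(2 * n / B.card)) (K := 2 * n) (fun x => by
      split_ifs
      · rw [abs_of_pos (by linarith)]; exact hA3
      · rw [abs_neg, abs_of_pos (by linarith)]; exact hB3)
  refine ⟨κ, h1, ?_, fun x => ?_, h4⟩
  · rw [h3, Finset.sum_ite, Finset.sum_const, Finset.sum_const, ← hA, ← hB, nsmul_eq_mul,
      nsmul_eq_mul]
    field_simp
    ring
  · have h := abs_le.1 (h2 x)
    by_cases hp : P (b x)
    · rw [if_pos hp] at h
      exact Or.inl ⟨by linarith, hP3 x hp⟩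
    · rw [if_neg hp] at h
      exact Or.inr ⟨by linarith, hP4 x hp⟩

end Slopes

/-! ### Hyperbolic and simple real spectrum in the general and special linear groups. -/

section SimpleSpectrum

open Matrix Polynomial

variable {ι : Type*} [Fintype ι] [DecidableEq ι]

theorem aeval_charpoly_eq_det (A : Matrix ι ι ℝ) (z : ℂ) :
    aeval z A.charpoly = (scalar ι z - A.map (algebraMap ℝ ℂ)).det := by
  rw [← eval_charpoly, charpoly_map, eval_map_algebraMap]

theorem aeval_charpoly_smul_eq_zero_iff {s : ℝ} (hs : s ≠ 0) (A : Matrix ι ι ℝ) (z : ℂ) :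
    aeval z (s • A).charpoly = 0 ↔ aeval ((s : ℂ)⁻¹ * z) A.charpoly = 0 := by
  have hs' : (s : ℂ) ≠ 0 := by exact_mod_cast hs
  rw [aeval_charpoly_eq_det, aeval_charpoly_eq_det]
  have : scalar ι z - (s • A).map (algebraMap ℝ ℂ) =
      (s : ℂ) • (scalar ι ((s : ℂ)⁻¹ * z) - A.map (algebraMap ℝ ℂ)) := by
    ext i j
    simp [scalar_apply, diagonal_apply, mul_sub]
    split_ifs
    · field_simp
    · simp
  rw [this, det_smul, mul_eq_zero]
  constructor
  · rintro (h | h)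
    · exact absurd h (pow_ne_zero _ hs')
    · exact h
  · exact Or.inr

theorem abs_det_eq_pow_of_norm_roots {A : Matrix ι ι ℝ} {ρ : ℝ}
    (h : ∀ z : ℂ, aeval z A.charpoly = 0 → ‖z‖ = ρ) : |A.det| = ρ ^ Fintype.card ι := by
  have h1 := det_eq_prod_roots_charpoly (A.map (algebraMap ℝ ℂ))
  have h2 : (A.map (algebraMap ℝ ℂ)).det = ((A.det : ℝ) : ℂ) :=
    ((algebraMap ℝ ℂ).map_det A).symm
  have h3 : |A.det| = ‖(A.map (algebraMap ℝ ℂ)).charpoly.roots.prod‖ := by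
    rw [← h1, h2, Complex.norm_real, Real.norm_eq_abs]
  have h4 : ∀ z ∈ (A.map (algebraMap ℝ ℂ)).charpoly.roots, ‖z‖ = ρ := by
    intro z hz
    refine h z ?_
    rwa [charpoly_map, mem_roots_map_iff (charpoly_monic _).ne_zero] at hz
  have h5 : (A.map (algebraMap ℝ ℂ)).charpoly.roots.card = Fintype.card ι := by
    rw [IsAlgClosed.card_roots_eq_natDegree, charpoly_natDegree_eq_dim]
  rw [h3, ← h5]
  have h6 := map_multiset_prod (normHom : ℂ →*₀ ℝ) (A.map (algebraMap ℝ ℂ)).charpoly.roots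
  refine h6.trans ?_
  rw [Multiset.map_congr (f := (normHom : ℂ →*₀ ℝ)) rfl (g := fun _ => ρ) h4, Multiset.map_const', Multiset.prod_replicate]

theorem aeval_charpoly_eq_zero_of_toSquareBlock {Q₀ g : GL ι ℝ} {b : ι → ℕ}
    (hT : (Q₀⁻¹ * g * Q₀).val.BlockTriangular b) {c : ℕ} (hc : c ∈ Finset.univ.image b) {z : ℂ}
    (hz : aeval z ((Q₀⁻¹ * g * Q₀).val.toSquareBlock b c).charpoly = 0) :
    aeval z g.val.charpoly = 0 := by
  have : g.val.charpoly = (Q₀⁻¹ * g * Q₀).val.charpoly :=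
    (charpoly_mul_mul_of_mul_eq_one (Units.mul_inv Q₀)).symm
  rw [this, hT.charpoly, map_prod]
  exact Finset.prod_eq_zero hc hz

/-- The exponents of the diagonal blocks of a Schur form. -/
theorem exists_block_exponents {N : Matrix ι ι ℝ} {b : ι → ℕ} (hdet : N.det ≠ 0)
    (hT : N.BlockTriangular b)
    (hirr : ∀ c ∈ Finset.univ.image b, Irreducible (N.toSquareBlock b c).charpoly) :
    ∃ L : ℕ → ℝ, (∀ c ∈ Finset.univ.image b, ∀ z : ℂ,
      aeval z (N.toSquareBlock b c).charpoly = 0 → ‖z‖ = Real.exp (L c)) ∧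
      ∑ x, L (b x) = Real.log |N.det| := by
  have hρ : ∀ c, ∃ ρ : ℝ, c ∈ Finset.univ.image b → ∀ z : ℂ,
      aeval z (N.toSquareBlock b c).charpoly = 0 → ‖z‖ = ρ := by
    intro c
    by_cases hc : c ∈ Finset.univ.image b
    · obtain ⟨z, hz⟩ := IsAlgClosed.exists_aeval_eq_zero ℂ _
        (degree_pos_of_irreducible (hirr c hc)).ne'
      exact ⟨‖z‖, fun _ w hw => norm_eq_of_irreducible (hirr c hc) hz hw⟩
    · exact ⟨0, fun h => absurd h hc⟩
  choose ρ hρ using hρ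
  have habs : |N.det| = ∏ x, ρ (b x) := by
    rw [hT.det, Finset.abs_prod, Finset.prod_comp ρ b]
    refine Finset.prod_congr rfl fun c hc => ?_
    rw [abs_det_eq_pow_of_norm_roots (hρ c hc), Fintype.card_subtype]
  have hne : ∀ x, ρ (b x) ≠ 0 := by
    have h0 : ∏ x, ρ (b x) ≠ 0 := by rw [← habs]; exact abs_ne_zero.2 hdet
    intro x
    exact Finset.prod_ne_zero_iff.1 h0 x (Finset.mem_univ x)
  refine ⟨fun c => Real.log (ρ c), fun c hc z hz => ?_, ?_⟩
  · have h1 := hρ c hc z hz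
    obtain ⟨x, -, rfl⟩ := Finset.mem_image.1 hc
    have h2 : 0 < ρ (b x) := lt_of_le_of_ne (h1 ▸ norm_nonneg z) (hne x).symm
    rw [h1, Real.exp_log h2]
  · rw [habs, Real.log_prod fun x _ => hne x]

theorem card_fiber_eq_one_of_real_root {N : Matrix ι ι ℝ} {b : ι → ℕ} {c : ℕ}
    (hirr : Irreducible (N.toSquareBlock b c).charpoly) {z : ℂ}
    (hz : aeval z (N.toSquareBlock b c).charpoly = 0) (him : z.im = 0) :
    Fintype.card {x // b x = c} = 1 := by
  have h1 : z = algebraMap ℝ ℂ z.re := Complex.ext (by simp) (by simp [him])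
  rw [h1, aeval_algebraMap_apply, map_eq_zero, coe_aeval_eq_eval] at hz
  have h2 := natDegree_eq_of_degree_eq_some (degree_eq_one_of_irreducible_of_root hirr hz)
  rwa [charpoly_natDegree_eq_dim] at h2

theorem exp_one_gt_two : (2 : ℝ) < Real.exp 1 := by
  have := Real.exp_one_gt_d9
  linarith

/-- Rescaling the blocks of a Schur form with suitable slopes. -/
theorem exists_isDeformation_of_slopes {G : Subgroup (GL ι ℝ)} [G.Normal] {ℓ : ℕ} (hℓ : 0 < ℓ)
    {δ : ℝ} (hδ : 0 ≤ δ) (a : ℕ → GL ι ℝ) {Q₀ : GL ι ℝ}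
    (hQ₀ : (Q₀ : Matrix ι ι ℝ)ᵀ * (Q₀ : Matrix ι ι ℝ) = 1) {b : ι → ℕ}
    (hT : ((Q₀⁻¹ * seqProd a ℓ * Q₀ : GL ι ℝ) : Matrix ι ι ℝ).BlockTriangular b)
    (hirr : ∀ c ∈ Finset.univ.image b,
      Irreducible ((Q₀⁻¹ * seqProd a ℓ * Q₀).val.toSquareBlock b c).charpoly)
    {L : ℕ → ℝ} (hL : ∀ c ∈ Finset.univ.image b, ∀ z : ℂ,
      aeval z ((Q₀⁻¹ * seqProd a ℓ * Q₀).val.toSquareBlock b c).charpoly = 0 →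
        ‖z‖ = Real.exp (L c))
    {κ : ℕ → ℝ} (hκ : ∀ x, |κ (b x)| ≤ ℓ * δ) (hG : ∀ s : ℝ, expDiag (fun x => s * κ (b x)) ∈ G)
    (hsign : ∀ x, (1 ≤ κ (b x) ∧ 0 ≤ L (b x)) ∨ (κ (b x) ≤ -1 ∧ L (b x) ≤ 0))
    (hinj : ∀ x y, κ (b x) + L (b x) = κ (b y) + L (b y) → b x = b y) :
    ∃ Y, IsDeformation G δ ℓ a (fun p => NoUnitRoot p ∧
        ((∀ x, 0 ≤ L (b x) → κ (b x) < 0) → ContractingRoots p)) Y ∧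
      (RealRoots (seqProd a ℓ).val.charpoly →
        HasFarSimpleRealSpectrum (seqProd (Y 1 * a) ℓ).val) := by
  obtain ⟨Y, hY, hY1⟩ := exists_isDeformation_scale hℓ hδ a hQ₀ hT κ hκ hG
  set N := (Q₀⁻¹ * seqProd a ℓ * Q₀).val with hN
  have hroot : ∀ (t : ℝ) (c : ℕ) (z : ℂ), c ∈ Finset.univ.image b →
      aeval z (Real.exp (t * κ c) • N.toSquareBlock b c).charpoly = 0 →
      ‖z‖ = Real.exp (t * κ c + L c) := by
    intro t c z hc hz
    rw [aeval_charpoly_smul_eq_zero_iff (Real.exp_ne_zero _)] at hz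
    have h := hL c hc _ hz
    rw [norm_mul, norm_inv, Complex.norm_real, Real.norm_eq_abs, Real.abs_exp] at h
    rw [Real.exp_add, ← h, mul_inv_cancel_left₀ (Real.exp_ne_zero _)]
  refine ⟨Y, hY.mono le_rfl ?_, fun hreal => ?_⟩
  · rintro p ⟨t, ht, rfl⟩
    have key : ∀ z : ℂ, aeval z (∏ c ∈ Finset.univ.image b,
        (Real.exp (t * κ c) • N.toSquareBlock b c).charpoly) = 0 →
        ∃ x, ‖z‖ = Real.exp (t * κ (b x) + L (b x)) := by
      intro z hz
      obtain ⟨c, hc, hz⟩ := aeval_charpoly_prod_eq_zero hz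
      obtain ⟨x, -, rfl⟩ := Finset.mem_image.1 hc
      exact ⟨x, hroot t _ z hc hz⟩
    constructor
    · intro z hz
      obtain ⟨x, hx⟩ := key z hz
      rw [hx, ← Real.exp_zero, Real.exp_injective.ne_iff]
      -- As `κ` and `L` never have opposite signs and `κ` is nonzero, the exponent `t κ + L` does
      -- not vanish for `t > 0`.
      rcases hsign x with h | h
      · have := mul_pos ht.1 (zero_lt_one.trans_le h.1); linarith
      · have := mul_pos_of_neg_of_neg (neg_lt_zero.2 ht.1) (h.1.trans_lt (by norm_num)); linarith
    · intro hneg z hz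
      obtain ⟨x, hx⟩ := key z hz
      rw [hx, Real.exp_lt_one_iff]
      rcases hsign x with h | h
      · linarith [hneg x h.2]
      · have := mul_pos_of_neg_of_neg (neg_lt_zero.2 ht.1) (h.1.trans_lt (by norm_num)); linarith
  -- When all eigenvalues are real every block has size one, so separating the moduli of blocks
  -- separates all eigenvalues. The final exponents are at least `1` in modulus, and `exp 1 > 2`.
  · have hex : ∀ x, ∃ lam : ℝ, aeval (lam : ℂ) (N.toSquareBlock b (b x)).charpoly = 0 ∧
        Fintype.card {y // b y = b x} = 1 := by
      intro x
      have hc : b x ∈ Finset.univ.image b := Finset.mem_image_of_mem b (Finset.mem_univ x)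
      obtain ⟨z, hz⟩ := IsAlgClosed.exists_aeval_eq_zero ℂ _
        (degree_pos_of_irreducible (hirr _ hc)).ne'
      have him := hreal z (aeval_charpoly_eq_zero_of_toSquareBlock hT hc hz)
      refine ⟨z.re, ?_, card_fiber_eq_one_of_real_root (hirr _ hc) hz him⟩
      have h1 : z = (z.re : ℂ) := Complex.ext (by simp) (by simp [him])
      rwa [← h1]
    choose lam hlam hcard using hex
    have hv : ∀ x, aeval ((Real.exp (κ (b x)) * lam x : ℝ) : ℂ)
        (Real.exp (κ (b x)) • N.toSquareBlock b (b x)).charpoly = 0 := by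
      intro x
      rw [aeval_charpoly_smul_eq_zero_iff (Real.exp_ne_zero _)]
      have : ((Real.exp (κ (b x)) : ℝ) : ℂ) ≠ 0 := by exact_mod_cast Real.exp_ne_zero _
      rw [Complex.ofReal_mul, inv_mul_cancel_left₀ this]
      exact hlam x
    have hnorm : ∀ x, |Real.exp (κ (b x)) * lam x| = Real.exp (κ (b x) + L (b x)) := by
      intro x
      have h1 := hroot 1 (b x) _ (Finset.mem_image_of_mem b (Finset.mem_univ x))
        (by rw [one_mul]; exact hv x)
      rwa [one_mul, Complex.norm_real, Real.norm_eq_abs] at h1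
    refine ⟨fun x => Real.exp (κ (b x)) * lam x, fun x y hxy => ?_, fun x => ⟨?_, ?_⟩⟩
    · have h1 := congrArg abs hxy
      simp only [hnorm] at h1
      have h2 := hinj x y (Real.exp_injective h1)
      have := (Fintype.card_eq_one_iff.1 (hcard y))
      obtain ⟨w, hw⟩ := this
      have e1 := hw ⟨x, h2⟩
      have e2 := hw ⟨y, rfl⟩
      exact congrArg Subtype.val (e1.trans e2.symm)
    · rw [Module.End.hasEigenvalue_iff_isRoot_charpoly, charpoly_toLin', hY1, IsRoot.def]
      have h1 := hv x
      rw [← Complex.coe_algebraMap, aeval_algebraMap_apply, map_eq_zero,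
        coe_aeval_eq_eval] at h1
      rw [eval_prod]
      exact Finset.prod_eq_zero (Finset.mem_image_of_mem b (Finset.mem_univ x)) h1
    · rw [hnorm]
      rcases hsign x with h | h
      · right
        have : Real.exp 1 ≤ Real.exp (κ (b x) + L (b x)) := Real.exp_le_exp.2 (by linarith)
        exact exp_one_gt_two.trans_le this
      · left
        refine ⟨Real.exp_pos _, ?_⟩
        have h1 : Real.exp (κ (b x) + L (b x)) ≤ Real.exp (-1) := Real.exp_le_exp.2 (by linarith)
        have h2 : Real.exp (-1) < 1 / 2 := by
          rw [Real.exp_neg, one_div]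
          exact inv_strictAnti₀ two_pos exp_one_gt_two
        exact h1.trans_lt h2

/-- The clause on `ContractingRoots` is kept for the symplectic case: if all exponents are negative,
every slope is negative too, so contraction is never lost. -/
theorem exists_isDeformation_hyperbolic_gl {ℓ : ℕ} (hℓ : 0 < ℓ) {δ : ℝ} (hδ : 3 ≤ ℓ * δ)
    (a : ℕ → GL ι ℝ) :
    ∃ Y, IsDeformation ⊤ δ ℓ a (fun p => NoUnitRoot p ∧
        (ContractingRoots (seqProd a ℓ).val.charpoly → ContractingRoots p)) Y ∧
      (RealRoots (seqProd a ℓ).val.charpoly →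
        HasFarSimpleRealSpectrum (seqProd (Y 1 * a) ℓ).val) := by
  obtain ⟨Q₀, b, hQ₀, hT, hirr⟩ := exists_orthogonal_blockTriangular (seqProd a ℓ).val
  have hdet : (Q₀⁻¹ * seqProd a ℓ * Q₀).val.det ≠ 0 := (Q₀⁻¹ * seqProd a ℓ * Q₀).det_ne_zero
  obtain ⟨L, hL, -⟩ := exists_block_exponents hdet hT hirr
  obtain ⟨κ, hκ, hsign, hinj⟩ := exists_slopes b L
  have hδ0 : 0 ≤ δ := by
    have : (0 : ℝ) < ℓ := by exact_mod_cast hℓ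
    nlinarith
  obtain ⟨Y, hY, hY1⟩ := exists_isDeformation_of_slopes (G := ⊤) hℓ hδ0 a hQ₀ hT hirr hL
    (fun x => (hκ x).trans hδ) (fun _ => Subgroup.mem_top _)
    (fun x => (hsign x).imp id fun h => ⟨h.1, h.2.1⟩) hinj
  refine ⟨Y, hY.mono le_rfl fun p hp => ⟨hp.1, fun hcon => hp.2 fun x hx => ?_⟩, hY1⟩
  exfalso
  have hc : b x ∈ Finset.univ.image b := Finset.mem_image_of_mem b (Finset.mem_univ x)
  obtain ⟨z, hz⟩ := IsAlgClosed.exists_aeval_eq_zero ℂ _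
    (degree_pos_of_irreducible (hirr _ hc)).ne'
  have h1 := hL _ hc z hz
  have h2 : ‖z‖ < 1 := by
    exact hcon z (aeval_charpoly_eq_zero_of_toSquareBlock hT hc hz)
  rw [h1, Real.exp_lt_one_iff] at h2
  linarith

theorem exists_isDeformation_hyperbolic_sl {ℓ : ℕ} (hℓ : 0 < ℓ) {δ : ℝ}
    (hδ : 2 * Fintype.card ι + 1 ≤ ℓ * δ) (a : ℕ → GL ι ℝ) (hdet : (seqProd a ℓ).val.det = 1)
    (hcard : 2 ≤ Fintype.card ι)
    (hreal : Fintype.card ι = 2 → RealRoots (seqProd a ℓ).val.charpoly) :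
    ∃ Y, IsDeformation (slSubgroup ι) δ ℓ a NoUnitRoot Y ∧
      (RealRoots (seqProd a ℓ).val.charpoly →
        HasFarSimpleRealSpectrum (seqProd (Y 1 * a) ℓ).val) := by
  obtain ⟨Q₀, b, hQ₀, hT, hirr⟩ := exists_orthogonal_blockTriangular (seqProd a ℓ).val
  have hdet1 : (Q₀⁻¹ * seqProd a ℓ * Q₀).val.det = 1 := by
    rw [Units.val_mul, det_mul_comm, Units.val_mul, ← Matrix.mul_assoc, Units.mul_inv,
      Matrix.one_mul, hdet]
  obtain ⟨L, hL, hLsum⟩ := exists_block_exponents (by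
    change (Q₀⁻¹ * seqProd a ℓ * Q₀).val.det ≠ 0
    rw [hdet1]; exact one_ne_zero) hT hirr
  have hLsum' : ∑ x, L (b x) = 0 := by
    rw [hLsum]
    change Real.log |(Q₀⁻¹ * seqProd a ℓ * Q₀).val.det| = 0
    rw [hdet1]; simp
  -- A single block would have size at most two, hence exactly two. Its irreducible polynomial would
  -- then have no real root, against `hreal`.
  obtain ⟨x₁, x₂, hx⟩ : ∃ x₁ x₂, b x₁ ≠ b x₂ := by
    by_contra! hcon
    have hne : Nonempty ι := Fintype.card_pos_iff.1 (by omega)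
    let x := hne.some
    have hc : b x ∈ Finset.univ.image b := Finset.mem_image_of_mem b (Finset.mem_univ x)
    have h1 : Fintype.card {y // b y = b x} = Fintype.card ι :=
      Fintype.card_congr (Equiv.subtypeUnivEquiv fun y => hcon y x)
    have h2 := (hirr _ hc).natDegree_le_two
    rw [charpoly_natDegree_eq_dim, h1] at h2
    obtain ⟨z, hz⟩ := IsAlgClosed.exists_aeval_eq_zero ℂ _
      (degree_pos_of_irreducible (hirr _ hc)).ne'
    have h3 := card_fiber_eq_one_of_real_root (hirr _ hc) hz (hreal (by omega) z
      (aeval_charpoly_eq_zero_of_toSquareBlock hT hc hz))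
    omega
  obtain ⟨κ, hκ, hκsum, hsign, hinj⟩ := exists_slopes_sum_zero b L hLsum' hx
  have hδ0 : 0 ≤ δ := by
    have : (0 : ℝ) < ℓ := by exact_mod_cast hℓ
    have : (0 : ℝ) ≤ Fintype.card ι := by positivity
    nlinarith
  obtain ⟨Y, hY, hY1⟩ := exists_isDeformation_of_slopes (G := slSubgroup ι) hℓ hδ0 a hQ₀ hT hirr hL
    (fun x => (hκ x).trans hδ) (fun s => by
      rw [mem_slSubgroup_iff, det_expDiag, ← Finset.mul_sum, hκsum]; simp) hsign hinj
  exact ⟨Y, hY.mono le_rfl fun p hp => hp.1, hY1⟩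

/-- Each of three stages spends `δ / 3`. The first rescaling makes the path hyperbolic at once;
rotations keep the moduli, so hyperbolicity persists while the eigenvalues become real; the last
rescaling splits the double eigenvalues they create and moves the spectrum far from the circle. -/
theorem exists_isDeformation_farSimple_gl (ι : Type*) [Fintype ι] [DecidableEq ι] {δ : ℝ}
    (hδ : 0 < δ) : ∃ T : ℕ, 1 ≤ T ∧ ∀ ℓ, T ≤ ℓ → ∀ a : ℕ → GL ι ℝ,
    ∃ Y, IsDeformation ⊤ δ ℓ a (fun p => NoUnitRoot p ∧
        (ContractingRoots (seqProd a ℓ).val.charpoly → ContractingRoots p)) Y ∧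
      HasFarSimpleRealSpectrum (seqProd (Y 1 * a) ℓ).val := by
  have hδ3 : 0 < δ / 3 := by positivity
  obtain ⟨T₁, hT₁⟩ := exists_isDeformation_realRoots ι hδ3
  obtain ⟨T₂, hT₂⟩ := exists_nat_ge (3 / (δ / 3))
  refine ⟨max 1 (max T₁ T₂), le_max_left _ _, fun ℓ hℓ a => ?_⟩
  obtain ⟨hℓ0, hℓ1, hℓ2⟩ : 1 ≤ ℓ ∧ T₁ ≤ ℓ ∧ T₂ ≤ ℓ := by simpa using hℓ
  have hℓδ : 3 ≤ ℓ * (δ / 3) := by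
    rw [div_le_iff₀ hδ3] at hT₂
    have : (T₂ : ℝ) ≤ ℓ := by exact_mod_cast hℓ2
    nlinarith
  obtain ⟨Y₁, hY₁, -⟩ := exists_isDeformation_hyperbolic_gl hℓ0 hℓδ a
  have h1 := hY₁.prop 1 ⟨one_pos, le_rfl⟩
  obtain ⟨Y₂, hY₂, hreal⟩ := hT₁ ℓ hℓ1 (Y₁ 1 * a)
  have h2 := hY₂.prop 1 ⟨one_pos, le_rfl⟩
  obtain ⟨Y₃, hY₃, hfar⟩ := exists_isDeformation_hyperbolic_gl hℓ0 hℓδ (Y₂ 1 * (Y₁ 1 * a))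
  obtain ⟨Z, hZ, hZ1⟩ := hY₁.trans ((hY₂.mono_group le_top).mono le_rfl fun p hp =>
    ⟨hp.noUnitRoot h1.1, fun hcon => hp.contractingRoots (h1.2 hcon)⟩)
  rw [← hZ1] at hY₃ hfar hreal h2
  obtain ⟨W, hW, hW1⟩ := hZ.trans (hY₃.mono le_rfl fun p hp =>
    ⟨hp.1, fun hcon => hp.2 (h2.contractingRoots (h1.2 hcon))⟩)
  exact ⟨W, hW.mono (by linarith) fun _ h => h, by rw [hW1]; exact hfar hreal⟩

theorem det_seqProd_eq_one {a : ℕ → GL ι ℝ} (ha : ∀ n, a n ∈ slSubgroup ι) (n : ℕ) :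
    (seqProd a n).val.det = 1 := by
  rw [← mem_slSubgroup_iff]
  induction n with
  | zero => exact one_mem _
  | succ n ih => exact mul_mem (ha n) ih

theorem exists_isDeformation_farSimple_sl (ι : Type*) [Fintype ι] [DecidableEq ι]
    (hcard : 2 ≤ Fintype.card ι) {δ : ℝ} (hδ : 0 < δ) :
    ∃ T : ℕ, 1 ≤ T ∧ ∀ ℓ, T ≤ ℓ → ∀ a : ℕ → GL ι ℝ, (∀ n, a n ∈ slSubgroup ι) →
    ∃ Y, IsDeformation (slSubgroup ι) δ ℓ a (fun p =>
        (Fintype.card ι = 2 → RealRoots (seqProd a ℓ).val.charpoly) → NoUnitRoot p) Y ∧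
      HasFarSimpleRealSpectrum (seqProd (Y 1 * a) ℓ).val := by
  have hδ3 : 0 < δ / 3 := by positivity
  obtain ⟨T₁, hT₁⟩ := exists_isDeformation_realRoots ι hδ3
  obtain ⟨T₂, hT₂⟩ := exists_nat_ge ((2 * Fintype.card ι + 1) / (δ / 3))
  refine ⟨max 1 (max T₁ T₂), le_max_left _ _, fun ℓ hℓ a ha => ?_⟩
  obtain ⟨hℓ0, hℓ1, hℓ2⟩ : 1 ≤ ℓ ∧ T₁ ≤ ℓ ∧ T₂ ≤ ℓ := by simpa using hℓ
  have hℓδ : 2 * Fintype.card ι + 1 ≤ ℓ * (δ / 3) := by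
    rw [div_le_iff₀ hδ3] at hT₂
    have : (T₂ : ℝ) ≤ ℓ := by exact_mod_cast hℓ2
    nlinarith
  have hmem : ∀ {a : ℕ → GL ι ℝ} {δ : ℝ} {H : ℝ[X] → Prop} {Y : ℝ → ℕ → GL ι ℝ},
      (∀ n, a n ∈ slSubgroup ι) → IsDeformation (slSubgroup ι) δ ℓ a H Y →
      ∀ n, (Y 1 * a) n ∈ slSubgroup ι := fun ha hY n => mul_mem (hY.mem 1 n) (ha n)
  by_cases hell : Fintype.card ι = 2 → RealRoots (seqProd a ℓ).val.charpoly
  · obtain ⟨Y₁, hY₁, -⟩ := exists_isDeformation_hyperbolic_sl hℓ0 hℓδ a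
      (det_seqProd_eq_one ha ℓ) hcard hell
    have h1 := hY₁.prop 1 ⟨one_pos, le_rfl⟩
    obtain ⟨Y₂, hY₂, hreal⟩ := hT₁ ℓ hℓ1 (Y₁ 1 * a)
    obtain ⟨Y₃, hY₃, hfar⟩ := exists_isDeformation_hyperbolic_sl hℓ0 hℓδ (Y₂ 1 * (Y₁ 1 * a))
      (det_seqProd_eq_one (hmem (hmem ha hY₁) hY₂) ℓ) hcard (fun _ => hreal)
    obtain ⟨Z, hZ, hZ1⟩ := hY₁.trans (hY₂.mono le_rfl fun p hp => hp.noUnitRoot h1)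
    rw [← hZ1] at hY₃ hfar hreal
    obtain ⟨W, hW, hW1⟩ := hZ.trans hY₃
    exact ⟨W, hW.mono (by linarith) fun _ h _ => h, by rw [hW1]; exact hfar hreal⟩
  -- In dimension two with nonreal eigenvalues no hyperbolicity is required along the path, so the
  -- initial rescaling is skipped.
  · obtain ⟨Y₂, hY₂, hreal⟩ := hT₁ ℓ hℓ1 a
    obtain ⟨Y₃, hY₃, hfar⟩ := exists_isDeformation_hyperbolic_sl hℓ0 hℓδ (Y₂ 1 * a)
      (det_seqProd_eq_one (hmem ha hY₂) ℓ) hcard (fun _ => hreal)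
    obtain ⟨W, hW, hW1⟩ := (hY₂.mono (H₂ := fun _ => True) le_rfl fun _ _ => trivial).trans
      (hY₃.mono le_rfl fun _ _ => trivial)
    exact ⟨W, hW.mono (by linarith) fun _ _ h => absurd h hell, by rw [hW1]; exact hfar hreal⟩

end SimpleSpectrum

/-! ### Lagrangian stable subspaces of hyperbolic symplectic matrices. -/

section StableSubspace

open Matrix Polynomial

theorem aeval_mul_of_mul_eq {m n : Type*} [Fintype m] [Fintype n] [DecidableEq m] [DecidableEq n]
    {A : Matrix m m ℝ} {B : Matrix n n ℝ} {V : Matrix m n ℝ} (h : A * V = V * B) (p : ℝ[X]) :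
    aeval A p * V = V * aeval B p := by
  have hpow : ∀ k, A ^ k * V = V * B ^ k := by
    intro k
    induction k with
    | zero => simp
    | succ k ih => rw [pow_succ, Matrix.mul_assoc, h, ← Matrix.mul_assoc, ih, Matrix.mul_assoc, pow_succ]
  simp only [aeval_eq_sum_range, Matrix.sum_mul, Matrix.mul_sum, Matrix.smul_mul, Matrix.mul_smul, hpow]

variable {ι : Type*} [Fintype ι] [DecidableEq ι]

theorem transpose_aeval (A : Matrix ι ι ℝ) (p : ℝ[X]) : (aeval A p)ᵀ = aeval Aᵀ p := by
  simp only [aeval_eq_sum_range, transpose_sum, transpose_smul, transpose_pow]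

/-- A root of the characteristic polynomial of `A` is a root of each polynomial killing `A`. -/
theorem aeval_eq_zero_of_charpoly_root {A : Matrix ι ι ℝ} {p : ℝ[X]} (hp : aeval A p = 0) {z : ℂ}
    (hz : aeval z A.charpoly = 0) : aeval z p = 0 := by
  rw [aeval_charpoly_eq_det] at hz
  obtain ⟨v, hv0, hv⟩ := exists_mulVec_eq_zero_iff.2 hz
  rw [sub_mulVec, sub_eq_zero] at hv
  have hAv : (A.map (algebraMap ℝ ℂ)) *ᵥ v = z • v := by
    rw [← hv]; ext i; simp [scalar_apply, mulVec_diagonal]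
  have hpow : ∀ k, (A.map (algebraMap ℝ ℂ)) ^ k *ᵥ v = z ^ k • v := by
    intro k
    induction k with
    | zero => simp
    | succ k ih => rw [pow_succ', ← mulVec_mulVec, ih, mulVec_smul, hAv, smul_smul, pow_succ]
  have h1 : aeval (A.map (algebraMap ℝ ℂ)) p = 0 := by
    have := aeval_algHom_apply (Algebra.ofId ℝ ℂ).mapMatrix A p
    rw [hp, map_zero] at this
    exact this
  have h2 : aeval (A.map (algebraMap ℝ ℂ)) p *ᵥ v = aeval z p • v := by
    simp only [aeval_eq_sum_range, sum_mulVec, smul_mulVec, hpow, Finset.sum_smul, smul_assoc]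
  rw [h1, zero_mulVec] at h2
  exact (smul_eq_zero.1 h2.symm).resolve_right hv0

/-- All roots of an irreducible factor have the same modulus, so each factor falls entirely on one
side of the unit circle. -/
theorem exists_mul_contracting_expanding {p : ℝ[X]} (hp : p ≠ 0) (h : NoUnitRoot p) :
    ∃ f g : ℝ[X], p = f * g ∧ ContractingRoots f ∧ ∀ z : ℂ, aeval z g = 0 → 1 < ‖z‖ := by
  induction p using WfDvdMonoid.induction_on_irreducible with
  | zero => exact absurd rfl hp
  | unit u hu =>
    refine ⟨u, 1, by simp, fun z hz => ?_, fun z hz => by simp at hz⟩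
    exact absurd hz (hu.map (aeval z)).ne_zero
  | mul a i ha hi ih =>
    obtain ⟨f, g, hfg, hf, hg⟩ := ih ha fun z hz => h z (by rw [map_mul, hz, mul_zero])
    obtain ⟨w, hw⟩ := IsAlgClosed.exists_aeval_eq_zero ℂ _ (degree_pos_of_irreducible hi).ne'
    rcases lt_or_gt_of_ne (h w (by rw [map_mul, hw, zero_mul])) with hlt | hgt
    · refine ⟨i * f, g, by rw [hfg, mul_assoc], fun z hz => ?_, hg⟩
      rw [map_mul, mul_eq_zero] at hz
      rcases hz with hz | hz
      · rw [norm_eq_of_irreducible hi hw hz]; exact hlt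
      · exact hf z hz
    · refine ⟨f, i * g, by rw [hfg]; ring, hf, fun z hz => ?_⟩
      rw [map_mul, mul_eq_zero] at hz
      rcases hz with hz | hz
      · rw [norm_eq_of_irreducible hi hw hz]; exact hgt
      · exact hg z hz

/-- If no nonzero root of `p` has a root of `p` as its inverse, then `p(g⁻¹)` maps onto the kernel of
`p(g)`. -/
theorem exists_aeval_inv_mulVec_eq {g : GL ι ℝ} {p : ℝ[X]} (hp0 : p ≠ 0)
    (hp : ∀ z : ℂ, z ≠ 0 → aeval z p = 0 → aeval z⁻¹ p ≠ 0) {u : ι → ℝ}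
    (hu : aeval g.val p *ᵥ u = 0) : ∃ w, u = aeval (g⁻¹).val p *ᵥ w := by
  set n := p.natDegree with hn
  -- The reversed polynomial `X ^ n p(1/X)`. It is coprime to `p` by `hp`; at `0` its value is the
  -- leading coefficient of `p`. A Bézout relation evaluated at `g` then yields `w`.
  set r : ℝ[X] := ∑ i ∈ Finset.range (n + 1), C (p.coeff i) * X ^ (n - i) with hr
  have hrz : ∀ z : ℂ, aeval z r = ∑ i ∈ Finset.range (n + 1), (p.coeff i : ℂ) * z ^ (n - i) := by
    intro z
    simp [hr]
  have hcop : IsCoprime p r := by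
    refine (Polynomial.isCoprime_iff_aeval_ne_zero_of_isAlgClosed (k := ℝ) ℂ p r).2 fun z => ?_
    by_contra! hcon
    rw [hrz] at hcon
    have hz0 : z ≠ 0 := by
      rintro rfl
      have h2 := hcon.2
      rw [Finset.sum_range_succ, Finset.sum_eq_zero (fun i hi => ?_)] at h2
      · simp only [tsub_self, pow_zero, mul_one, zero_add, Complex.ofReal_eq_zero] at h2
        exact hp0 (leadingCoeff_eq_zero.1 h2)
      · have := Finset.mem_range.1 hi
        rw [zero_pow (by omega), mul_zero]
    refine hp z hz0 hcon.1 ?_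
    have h3 : z ^ n * aeval z⁻¹ p = 0 := by
      rw [← hcon.2, aeval_eq_sum_range, Finset.mul_sum]
      refine Finset.sum_congr rfl fun i hi => ?_
      have hi' : i ≤ n := Nat.lt_succ_iff.1 (Finset.mem_range.1 hi)
      rw [pow_sub₀ z hz0 hi', inv_pow, Complex.real_smul]
      ring
    exact (mul_eq_zero.1 h3).resolve_left (pow_ne_zero _ hz0)
  have hrg : aeval g.val r = aeval (g⁻¹).val p * g.val ^ n := by
    rw [aeval_eq_sum_range (p := p), Finset.sum_mul, hr, map_sum]
    refine Finset.sum_congr rfl fun i hi => ?_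
    have hi' : i ≤ n := Nat.lt_succ_iff.1 (Finset.mem_range.1 hi)
    have h4 : g ^ (n - i) = (g⁻¹) ^ i * g ^ n := by
      rw [pow_sub g hi', inv_pow]
      exact ((Commute.refl g).pow_pow n i).inv_right.eq
    have h5 := congrArg Units.val h4
    rw [Units.val_mul, Units.val_pow_eq_pow_val, Units.val_pow_eq_pow_val,
      Units.val_pow_eq_pow_val] at h5
    rw [map_mul, aeval_C, map_pow, aeval_X, h5, smul_mul_assoc, ← Algebra.smul_def]
  obtain ⟨s, t, hst⟩ := hcop
  refine ⟨(g.val ^ n * aeval g.val t) *ᵥ u, ?_⟩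
  have h6 : aeval g.val s * aeval g.val p + aeval g.val r * aeval g.val t = 1 := by
    rw [← map_mul, ← map_mul, mul_comm r, ← map_add, hst, map_one]
  calc u = (1 : Matrix ι ι ℝ) *ᵥ u := (one_mulVec u).symm
    _ = (aeval g.val r * aeval g.val t) *ᵥ u := by
        rw [← h6, add_mulVec, ← mulVec_mulVec u (aeval g.val s), hu, mulVec_zero, zero_add]
    _ = _ := by rw [hrg, mulVec_mulVec, Matrix.mul_assoc]

theorem exists_matrix_of_finrank_eq {W : Submodule ℝ (ι → ℝ)} {k : ℕ}
    (hk : Module.finrank ℝ W = k) : ∃ V : Matrix ι (Fin k) ℝ, Function.Injective V.mulVec ∧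
      (∀ c, V *ᵥ c ∈ W) ∧ ∀ w ∈ W, ∃ c, V *ᵥ c = w := by
  let B := Module.finBasisOfFinrankEq ℝ W hk
  have hV : ∀ c, (of fun i j => (B j : ι → ℝ) i) *ᵥ c = (B.equivFun.symm c : ι → ℝ) := by
    intro c
    ext i
    simp [B.equivFun_symm_apply, mulVec, dotProduct, mul_comm]
  refine ⟨of fun i j => (B j : ι → ℝ) i, fun c c' h => ?_, fun c => ?_, fun w hw => ?_⟩
  · simp only [hV] at h
    exact B.equivFun.symm.injective (Subtype.ext h)
  · rw [hV]; exact Subtype.mem _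
  · refine ⟨B.equivFun ⟨w, hw⟩, ?_⟩
    rw [hV, LinearEquiv.symm_apply_apply]

variable {d : ℕ}

/-- The spectral subspace of a symplectic matrix for a set of eigenvalues containing no pair of
inverses is isotropic. -/
theorem dotProduct_J_eq_zero {g : GL (Fin d ⊕ Fin d) ℝ} (hg : g ∈ spSubgroup d) {p : ℝ[X]}
    (hp0 : p ≠ 0) (hp : ∀ z : ℂ, z ≠ 0 → aeval z p = 0 → aeval z⁻¹ p ≠ 0)
    {u v : Fin d ⊕ Fin d → ℝ} (hu : aeval g.val p *ᵥ u = 0) (hv : aeval g.val p *ᵥ v = 0) :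
    u ⬝ᵥ (J (Fin d) ℝ *ᵥ v) = 0 := by
  -- For the symplectic form the adjoint of `g⁻¹` is `g`, so pairing `p(g⁻¹) w` with `v` is pairing
  -- `w` with `p(g) v = 0`.
  obtain ⟨w, rfl⟩ := exists_aeval_inv_mulVec_eq hp0 hp hu
  have hJ := SymplecticGroup.mem_iff'.1 ((Submonoid.mem_units_iff _ _).1 hg).1
  have h1 : (g⁻¹.val)ᵀ * J (Fin d) ℝ = J (Fin d) ℝ * g.val := by
    calc (g⁻¹.val)ᵀ * J (Fin d) ℝ = (g⁻¹.val)ᵀ * (g.valᵀ * J (Fin d) ℝ * g.val) := by rw [hJ]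
      _ = (g.val * g⁻¹.val)ᵀ * (J (Fin d) ℝ * g.val) := by
        rw [transpose_mul]; simp only [Matrix.mul_assoc]
      _ = _ := by rw [Units.mul_inv, transpose_one, Matrix.one_mul]
  have h2 := aeval_mul_of_mul_eq h1 p
  rw [← transpose_aeval] at h2
  rw [← vecMul_transpose, ← dotProduct_mulVec, mulVec_mulVec, h2, ← mulVec_mulVec, hv, mulVec_zero,
    dotProduct_zero]

theorem transpose_mul_J_mul_eq_zero {m : Type*} [Fintype m] [DecidableEq m]
    {V : Matrix (Fin d ⊕ Fin d) m ℝ}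
    (h : ∀ c c', (V *ᵥ c) ⬝ᵥ (J (Fin d) ℝ *ᵥ (V *ᵥ c')) = 0) : Vᵀ * J (Fin d) ℝ * V = 0 := by
  ext i j
  have := h (Pi.single i 1) (Pi.single j 1)
  rw [← vecMul_transpose, ← dotProduct_mulVec, mulVec_mulVec, mulVec_mulVec] at this
  simpa [Matrix.mul_assoc] using this

theorem rank_eq_of_injective {m : Type*} [Fintype m] {V : Matrix ι m ℝ}
    (hV : Function.Injective V.mulVec) : V.rank = Fintype.card m := by
  rw [Matrix.rank, LinearMap.finrank_range_of_inj hV, Module.finrank_fintype_fun_eq_card]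

/-- The stable subspace of a hyperbolic symplectic matrix is Lagrangian. -/
theorem exists_lagrangian_stable {g : GL (Fin d ⊕ Fin d) ℝ} (hg : g ∈ spSubgroup d)
    (hhyp : NoUnitRoot g.val.charpoly) :
    ∃ (V : Matrix (Fin d ⊕ Fin d) (Fin d) ℝ) (B : GL (Fin d) ℝ), Function.Injective V.mulVec ∧
      Vᵀ * J (Fin d) ℝ * V = 0 ∧ g.val * V = V * B.val ∧ ContractingRoots B.val.charpoly := by
  have hne := (charpoly_monic g.val).ne_zero
  obtain ⟨f, e, hfe, hf, he⟩ := exists_mul_contracting_expanding hne hhyp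
  have hf0 : f ≠ 0 := by rintro rfl; rw [zero_mul] at hfe; exact hne hfe
  have he0 : e ≠ 0 := by rintro rfl; rw [mul_zero] at hfe; exact hne hfe
  have hfinv : ∀ z : ℂ, z ≠ 0 → aeval z f = 0 → aeval z⁻¹ f ≠ 0 := by
    intro z hz h1 h2
    have e1 := hf z h1
    have e2 := hf _ h2
    rw [norm_inv] at e2
    exact absurd e2 (not_lt.2 (one_le_inv_iff₀.2 ⟨norm_pos_iff.2 hz, e1.le⟩))
  have heinv : ∀ z : ℂ, z ≠ 0 → aeval z e = 0 → aeval z⁻¹ e ≠ 0 := by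
    intro z hz h1 h2
    have e1 := he z h1
    have e2 := he _ h2
    rw [norm_inv] at e2
    exact absurd e2 (not_lt.2 (inv_le_one_of_one_le₀ e1.le))
  have hdim : ∀ p : ℝ[X], p ≠ 0 → (∀ z : ℂ, z ≠ 0 → aeval z p = 0 → aeval z⁻¹ p ≠ 0) →
      Module.finrank ℝ (LinearMap.ker (toLin' (aeval g.val p))) ≤ d := by
    intro p hp0 hp
    obtain ⟨V, hV, hVW, -⟩ := exists_matrix_of_finrank_eq
      (W := LinearMap.ker (toLin' (aeval g.val p))) rfl
    have hiso : Vᵀ * J (Fin d) ℝ * V = 0 := transpose_mul_J_mul_eq_zero fun c c' =>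
      dotProduct_J_eq_zero hg hp0 hp (by simpa using hVW c) (by simpa using hVW c')
    have h1 := rank_add_rank_le_card_of_mul_eq_zero hiso
    have h2 : (Vᵀ * J (Fin d) ℝ).rank = Vᵀ.rank :=
      rank_mul_eq_left_of_isUnit_det _ _ (isUnit_det_J _ _)
    rw [h2, rank_transpose, rank_eq_of_injective hV] at h1
    simp at h1
    omega
  have hrank : (aeval g.val f).rank + (aeval g.val e).rank ≤ d + d := by
    have h0 : aeval g.val f * aeval g.val e = 0 := by
      rw [← map_mul, ← hfe, aeval_self_charpoly]
    simpa using rank_add_rank_le_card_of_mul_eq_zero h0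
  have hker : ∀ p : ℝ[X], (aeval g.val p).rank +
      Module.finrank ℝ (LinearMap.ker (toLin' (aeval g.val p))) = d + d := by
    intro p
    have := LinearMap.finrank_range_add_finrank_ker (toLin' (aeval g.val p))
    rw [Module.finrank_fintype_fun_eq_card, Fintype.card_sum, Fintype.card_fin] at this
    exact this
  -- Both kernels are isotropic, hence of dimension at most `d`. By Cayley–Hamilton `f(g) e(g) = 0`,
  -- so their dimensions add up to at least `2d`; both are therefore equal to `d`.
  have hk : Module.finrank ℝ (LinearMap.ker (toLin' (aeval g.val f))) = d := by
    have h1 := hdim f hf0 hfinv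
    have h2 := hdim e he0 heinv
    have h3 := hker f
    have h4 := hker e
    omega
  obtain ⟨V, hV, hVW, hWV⟩ := exists_matrix_of_finrank_eq hk
  have hfV : aeval g.val f * V = 0 := by
    refine ext_of_mulVec_single fun i => ?_
    rw [← mulVec_mulVec, zero_mulVec]
    simpa using hVW (Pi.single i 1)
  have hcol : ∀ j, ∃ c, V *ᵥ c = (g.val * V) *ᵥ Pi.single j 1 := by
    intro j
    refine hWV _ ?_
    have hcomm : aeval g.val f * g.val = g.val * aeval g.val f := aeval_mul_of_mul_eq rfl f
    rw [LinearMap.mem_ker, toLin'_apply, mulVec_mulVec, ← Matrix.mul_assoc, hcomm, Matrix.mul_assoc,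
      hfV, Matrix.mul_zero, zero_mulVec]
  choose c hc using hcol
  have hgV : g.val * V = V * of fun i j => c j i := by
    refine ext_of_mulVec_single fun j => ?_
    rw [← hc, ← mulVec_mulVec]
    congr 1
    ext i
    simp
  set B : Matrix (Fin d) (Fin d) ℝ := of fun i j => c j i with hB
  have hBinj : Function.Injective B.mulVec := by
    intro x y hxy
    have h1 : (g.val * V) *ᵥ x = (g.val * V) *ᵥ y := by
      rw [hgV, ← mulVec_mulVec, ← mulVec_mulVec, hxy]
    rw [← mulVec_mulVec, ← mulVec_mulVec] at h1
    exact hV (mulVec_injective_of_isUnit g.isUnit h1)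
  obtain ⟨B', hB'⟩ := mulVec_injective_iff_isUnit.1 hBinj
  refine ⟨V, B', hV, ?_, by rw [hB']; exact hgV, fun z hz => hf z ?_⟩
  · exact transpose_mul_J_mul_eq_zero fun c c' =>
      dotProduct_J_eq_zero hg hf0 hfinv (by simpa using hVW c) (by simpa using hVW c')
  · refine aeval_eq_zero_of_charpoly_root (A := B) ?_ (by rw [← hB']; exact hz)
    have h1 := aeval_mul_of_mul_eq hgV f
    rw [hfV] at h1
    refine ext_of_mulVec_single fun j => hV ?_
    rw [zero_mulVec, mulVec_zero, mulVec_mulVec, ← h1, zero_mulVec]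

end StableSubspace

/-! ### The symplectic case through the action on the stable subspace. -/

section Symplectic

open Matrix Polynomial

theorem seqProd_mul_of_mul_eq {m n : Type*} [Fintype m] [Fintype n] [DecidableEq m] [DecidableEq n]
    {c : ℕ → GL m ℝ} {γ : ℕ → GL n ℝ} {W : ℕ → Matrix m n ℝ}
    (h : ∀ k, (c k).val * W k = W (k + 1) * (γ k).val) (k : ℕ) :
    (seqProd c k).val * W 0 = W k * (seqProd γ k).val := by
  induction k with
  | zero => simp [seqProd]
  | succ k ih =>
    rw [seqProd, seqProd, Units.val_mul, Units.val_mul, Matrix.mul_assoc, ih, ← Matrix.mul_assoc, h,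
      Matrix.mul_assoc]

theorem seqProd_mem {M : Type*} [Group M] {G : Subgroup M} {a : ℕ → M} (ha : ∀ n, a n ∈ G) (n : ℕ) :
    seqProd a n ∈ G := by
  induction n with
  | zero => exact one_mem G
  | succ n ih => exact mul_mem (ha n) ih

theorem det_scalar_inv_sub_eq_zero {K n : Type*} [Field K] [Fintype n] [DecidableEq n]
    {N N' : Matrix n n K} (h : N' * N = 1) {z : K} (hz0 : z ≠ 0) (hz : (scalar n z - N').det = 0) :
    (scalar n z⁻¹ - N).det = 0 := by
  have h1 : N * (scalar n z - N') = -scalar n z * (scalar n z⁻¹ - N) := by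
    have h2 : N * N' = 1 := mul_eq_one_comm.1 h
    have h3 : scalar n z * scalar n z⁻¹ = 1 := by rw [← map_mul, mul_inv_cancel₀ hz0, map_one]
    rw [mul_sub, mul_sub, h2, neg_mul, neg_mul, h3, (scalar_commute z (Commute.all z) N).eq]
    abel
  have h4 := congrArg det h1
  rw [det_mul, det_mul, hz, mul_zero] at h4
  refine (mul_eq_zero.1 h4.symm).resolve_left ?_
  rw [← map_neg]
  simp [hz0]

variable {d : ℕ}

theorem aeval_inv_charpoly_eq_zero {B B' : Matrix (Fin d) (Fin d) ℝ} (h : B' * B = 1) {z : ℂ}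
    (hz0 : z ≠ 0) (hz : aeval z B'.charpoly = 0) : aeval z⁻¹ B.charpoly = 0 := by
  rw [aeval_charpoly_eq_det] at hz ⊢
  refine det_scalar_inv_sub_eq_zero ?_ hz0 hz
  rw [← Matrix.map_mul, h, Matrix.map_one _ (map_zero _) (map_one _)]

theorem mem_spSubgroup_iff {g : GL (Fin d ⊕ Fin d) ℝ} :
    g ∈ spSubgroup d ↔ g.valᵀ * J (Fin d) ℝ * g.val = J (Fin d) ℝ := by
  refine ⟨fun h => SymplecticGroup.mem_iff'.1 ((Submonoid.mem_units_iff _ _).1 h).1, fun h =>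
    (Submonoid.mem_units_iff _ _).2 ⟨SymplecticGroup.mem_iff'.2 h, SymplecticGroup.mem_iff'.2 ?_⟩⟩
  calc (g⁻¹.val)ᵀ * J (Fin d) ℝ * g⁻¹.val
      = (g⁻¹.val)ᵀ * (g.valᵀ * J (Fin d) ℝ * g.val) * g⁻¹.val := by rw [h]
    _ = (g.val * g⁻¹.val)ᵀ * J (Fin d) ℝ * (g.val * g⁻¹.val) := by
        rw [transpose_mul]; simp only [Matrix.mul_assoc]
    _ = _ := by rw [Units.mul_inv, transpose_one, Matrix.one_mul, Matrix.mul_one]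

/-- The inclusion of the first factor of `ℝ^d × ℝ^d`. -/
def inclFst (d : ℕ) : Matrix (Fin d ⊕ Fin d) (Fin d) ℝ := fromRows 1 0

theorem fromBlocks_mul_inclFst (A B C D : Matrix (Fin d) (Fin d) ℝ) :
    fromBlocks A B C D * inclFst d = fromRows A C := by
  rw [inclFst, fromBlocks_mul_fromRows]
  simp

theorem inclFst_mul (A : Matrix (Fin d) (Fin d) ℝ) : inclFst d * A = fromRows A 0 := by
  rw [inclFst, fromRows_mul, Matrix.one_mul, Matrix.zero_mul]

/-- An orthonormal basis of a Lagrangian subspace extends to an orthonormal symplectic basis. -/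
theorem exists_orthogonal_symplectic {U : Matrix (Fin d ⊕ Fin d) (Fin d) ℝ} (h1 : Uᵀ * U = 1)
    (hJ : Uᵀ * J (Fin d) ℝ * U = 0) : ∃ Q : GL (Fin d ⊕ Fin d) ℝ, Q.valᵀ * Q.val = 1 ∧
      Q ∈ spSubgroup d ∧ Q.val * inclFst d = U := by
  have hJJ : ∀ M : Matrix (Fin d ⊕ Fin d) (Fin d) ℝ, J (Fin d) ℝ * (J (Fin d) ℝ * M) = -M := by
    intro M
    rw [← Matrix.mul_assoc, J_squared, Matrix.neg_mul, Matrix.one_mul]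
  rw [Matrix.mul_assoc] at hJ
  -- The columns of `J U` complete those of `U`: `J` is orthogonal, and `Uᵀ J U = 0` makes the two
  -- families orthogonal.
  have hQ : (fromCols U (J (Fin d) ℝ * U))ᵀ * fromCols U (J (Fin d) ℝ * U) = 1 := by
    rw [transpose_fromCols, fromRows_mul_fromCols, transpose_mul, J_transpose, ← fromBlocks_one]
    simp only [Matrix.mul_assoc, Matrix.neg_mul, Matrix.mul_neg, hJJ, h1, hJ, neg_zero, neg_neg]
  refine ⟨⟨_, _, mul_eq_one_comm.1 hQ, hQ⟩, hQ, mem_spSubgroup_iff.2 ?_, ?_⟩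
  · simp only
    rw [Matrix.mul_assoc, mul_fromCols, transpose_fromCols, fromRows_mul_fromCols, transpose_mul,
      J_transpose]
    simp only [Matrix.mul_assoc, Matrix.neg_mul, Matrix.mul_neg, hJJ, h1, hJ, neg_zero, neg_neg]
    rfl
  · simp only [inclFst]
    rw [fromCols_mul_fromRows, Matrix.mul_one, Matrix.mul_zero, add_zero]

/-- The characteristic polynomial of a symplectic matrix with an invariant Lagrangian subspace. -/
theorem charpoly_eq_of_lagrangian {g : GL (Fin d ⊕ Fin d) ℝ} (hg : g ∈ spSubgroup d)
    {U : Matrix (Fin d ⊕ Fin d) (Fin d) ℝ} (h1 : Uᵀ * U = 1) (hJ : Uᵀ * J (Fin d) ℝ * U = 0)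
    {B : GL (Fin d) ℝ} (hgU : g.val * U = U * B.val) :
    g.val.charpoly = B.val.charpoly * (B⁻¹).val.charpoly := by
  obtain ⟨Q, hQ, hQs, hQU⟩ := exists_orthogonal_symplectic h1 hJ
  have hc : (Q⁻¹ * g * Q).val.charpoly = g.val.charpoly := by
    rw [Units.val_mul, Units.val_mul]
    exact charpoly_mul_mul_of_mul_eq_one (Units.mul_inv Q)
  have hs : Q⁻¹ * g * Q ∈ spSubgroup d := mul_mem (mul_mem (inv_mem hQs) hg) hQs
  have he : (Q⁻¹ * g * Q).val * inclFst d = fromRows B.val 0 := by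
    rw [Units.val_mul, Units.val_mul, Matrix.mul_assoc, hQU, Matrix.mul_assoc, hgU, ← inclFst_mul,
      ← hQU, ← Matrix.mul_assoc, ← Matrix.mul_assoc, Units.inv_mul, Matrix.one_mul]
  rw [← hc]
  generalize Q⁻¹ * g * Q = r at hs he
  have hs' := ((Submonoid.mem_units_iff _ _).1 hs).1
  rw [← fromBlocks_toBlocks r.val, SymplecticGroup.fromBlocks_mem_iff] at hs'
  rw [← fromBlocks_toBlocks r.val, fromBlocks_mul_inclFst] at he
  obtain ⟨h11, h21⟩ := (fromRows_ext_iff _ _ _ _).1 he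
  replace hs' := hs'.2.2
  rw [h11, h21, transpose_zero, Matrix.zero_mul, sub_zero] at hs'
  -- In the adapted basis the matrix is block triangular with first block `B`, and symplecticity
  -- determines the second diagonal block.
  have h22 : r.val.toBlocks₂₂ = (B⁻¹.val)ᵀ := by
    have h3 : (B⁻¹.val)ᵀ * B.valᵀ = 1 := by rw [← transpose_mul, Units.mul_inv, transpose_one]
    calc r.val.toBlocks₂₂ = (B⁻¹.val)ᵀ * (B.valᵀ * r.val.toBlocks₂₂) := by
          rw [← Matrix.mul_assoc, h3, Matrix.one_mul]
      _ = _ := by rw [hs', Matrix.mul_one]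
  rw [← fromBlocks_toBlocks r.val, h11, h21, h22, charpoly_fromBlocks_zero₂₁, charpoly_transpose]

/-- The symplectic matrix `diag (Y, (Y⁻¹)ᵀ)`. -/
def symplecticDouble (Y : GL (Fin d) ℝ) : GL (Fin d ⊕ Fin d) ℝ where
  val := fromBlocks Y.val 0 0 (Y⁻¹.val)ᵀ
  inv := fromBlocks Y⁻¹.val 0 0 Y.valᵀ
  val_inv := by
    rw [fromBlocks_multiply, ← transpose_mul, Units.mul_inv]
    simp
  inv_val := by
    rw [fromBlocks_multiply, ← transpose_mul, Units.inv_mul]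
    simp

theorem symplecticDouble_mem (Y : GL (Fin d) ℝ) : symplecticDouble Y ∈ spSubgroup d := by
  rw [mem_spSubgroup_iff]
  simp only [symplecticDouble, J, fromBlocks_transpose, fromBlocks_multiply, transpose_transpose]
  have h1 : Y⁻¹.val * Y.val = 1 := Y.inv_mul
  have h2 : Y.valᵀ * (Y⁻¹.val)ᵀ = 1 := by rw [← transpose_mul, h1, transpose_one]
  simp [h1, h2, -coe_units_inv]

theorem continuous_symplecticDouble : Continuous (symplecticDouble : GL (Fin d) ℝ → _) := by
  refine Units.continuous_iff.2 ⟨?_, ?_⟩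
  · exact Units.continuous_val.matrix_fromBlocks continuous_const continuous_const
      (Units.continuous_val.comp continuous_inv).matrix_transpose
  · exact (Units.continuous_val.comp continuous_inv).matrix_fromBlocks continuous_const
      continuous_const Units.continuous_val.matrix_transpose

theorem norm_fromBlocks_diagonal_le (A D : Matrix (Fin d) (Fin d) ℝ) :
    ‖fromBlocks A 0 0 D‖ ≤ ‖A‖ + ‖D‖ := by
  have key : ∀ {E : Matrix (Fin d ⊕ Fin d) (Fin d) ℝ}, Eᵀ * E = 1 →
      ∀ M : Matrix (Fin d) (Fin d) ℝ, ‖E * M * Eᵀ‖ ≤ ‖M‖ := by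
    intro E hE M
    have hn := norm_le_one_of_transpose_mul_self hE
    calc ‖E * M * Eᵀ‖ ≤ ‖E * M‖ * ‖Eᵀ‖ := l2_opNorm_mul _ _
      _ ≤ (‖E‖ * ‖M‖) * ‖Eᵀ‖ := by gcongr; exact l2_opNorm_mul _ _
      _ ≤ (1 * ‖M‖) * 1 := by rw [opNorm_transpose]; gcongr
      _ = _ := by ring
  set E : Matrix (Fin d ⊕ Fin d) (Fin d) ℝ := fromRows 1 0 with hE
  set F : Matrix (Fin d ⊕ Fin d) (Fin d) ℝ := fromRows 0 1 with hF
  have h : fromBlocks A 0 0 D = E * A * Eᵀ + F * D * Fᵀ := by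
    rw [hE, hF, fromRows_mul _ _ A, fromRows_mul _ _ D, transpose_fromRows, transpose_fromRows,
      fromRows_mul_fromCols, fromRows_mul_fromCols, fromBlocks_add]
    simp
  rw [h]
  refine (norm_add_le _ _).trans (add_le_add (key ?_ A) (key ?_ D))
  · rw [hE, transpose_fromRows, fromCols_mul_fromRows]; simp
  · rw [hF, transpose_fromRows, fromCols_mul_fromRows]; simp

/-- The norm of a block diagonal matrix is crudely bounded by the sum of the norms of its blocks,
which costs only a factor two in `δ`. -/
theorem nearOne_symplecticDouble {δ : ℝ} {Y : GL (Fin d) ℝ} (hY : NearOne δ Y) :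
    NearOne (2 * δ) (symplecticDouble Y) := by
  have hexp : 2 * (Real.exp δ - 1) ≤ Real.exp (2 * δ) - 1 := by
    rw [two_mul δ, Real.exp_add]
    nlinarith [sq_nonneg (Real.exp δ - 1)]
  have key : ∀ A D : Matrix (Fin d) (Fin d) ℝ, ‖A - 1‖ ≤ Real.exp δ - 1 →
      ‖D - 1‖ ≤ Real.exp δ - 1 → ‖fromBlocks A 0 0 Dᵀ - 1‖ ≤ Real.exp (2 * δ) - 1 := by
    intro A D hA hD
    have h : fromBlocks A 0 0 Dᵀ - 1 = fromBlocks (A - 1) 0 0 (D - 1)ᵀ := by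
      rw [← fromBlocks_one, sub_eq_add_neg, fromBlocks_neg, fromBlocks_add]
      simp [sub_eq_add_neg]
    have h2 := norm_fromBlocks_diagonal_le (A - 1) (D - 1)ᵀ
    rw [opNorm_transpose] at h2
    rw [h]
    linarith
  exact ⟨key _ _ hY.1 hY.2, key _ _ hY.2 hY.1⟩

/-- Moving orthonormal frames of an invariant Lagrangian subspace. -/
theorem exists_lagrangian_frames {a : ℕ → GL (Fin d ⊕ Fin d) ℝ} (ha : ∀ n, a n ∈ spSubgroup d)
    {ℓ : ℕ} (hℓ : 0 < ℓ) {V : Matrix (Fin d ⊕ Fin d) (Fin d) ℝ} {B : GL (Fin d) ℝ}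
    (hV : Function.Injective V.mulVec) (hVJ : Vᵀ * J (Fin d) ℝ * V = 0)
    (hVB : (seqProd a ℓ).val * V = V * B.val) :
    ∃ (U : ℕ → Matrix (Fin d ⊕ Fin d) (Fin d) ℝ) (β : ℕ → GL (Fin d) ℝ),
      (∀ n, (U n)ᵀ * U n = 1) ∧ (∀ n, (U n)ᵀ * J (Fin d) ℝ * U n = 0) ∧ U ℓ = U 0 ∧
      (∀ n, (a n).val * U n = U (n + 1) * (β n).val) ∧
      (seqProd β ℓ).val.charpoly = B.val.charpoly := by
  obtain ⟨K₀, -, hK₀⟩ := exists_blockTriangular_mul_orthonormal hV 0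
  -- At time `ℓ` the orthonormalizing matrix is prescribed as `B⁻¹ * K₀`, since the product maps `V`
  -- to `V B`; the frame then returns to its initial value.
  have h : ∀ n, ∃ K : GL (Fin d) ℝ, ((seqProd a n).val * V * K.val)ᵀ *
      ((seqProd a n).val * V * K.val) = 1 ∧ (n = 0 → K = K₀) ∧ (n = ℓ → K = B⁻¹ * K₀) := by
    intro n
    by_cases hn : n = ℓ
    · subst hn
      refine ⟨B⁻¹ * K₀, ?_, fun h => absurd h hℓ.ne', fun _ => rfl⟩
      rw [hVB, Units.val_mul, Matrix.mul_assoc, ← Matrix.mul_assoc B.val, Units.mul_inv,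
        Matrix.one_mul]
      exact hK₀
    by_cases hn0 : n = 0
    · subst hn0
      exact ⟨K₀, by simpa [seqProd] using hK₀, fun _ => rfl, fun h => absurd h hn⟩
    · obtain ⟨K, -, hK⟩ := exists_blockTriangular_mul_orthonormal
        (V := (seqProd a n).val * V) (fun x y hxy => by
          rw [← mulVec_mulVec, ← mulVec_mulVec] at hxy
          exact hV (mulVec_injective_of_isUnit (seqProd a n).isUnit hxy)) 0
      exact ⟨K, hK, fun h => absurd h hn0, fun h => absurd h hn⟩
  choose K hK h0 h1 using h
  have hK0 : K 0 = K₀ := h0 0 rfl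
  have hKℓ : K ℓ = B⁻¹ * K₀ := h1 ℓ rfl
  refine ⟨fun n => (seqProd a n).val * V * (K n).val, fun n => (K (n + 1))⁻¹ * K n, hK, fun n => ?_,
    ?_, fun n => ?_, ?_⟩
  · have hs := mem_spSubgroup_iff.1 (seqProd_mem ha n)
    calc ((seqProd a n).val * V * (K n).val)ᵀ * J (Fin d) ℝ * ((seqProd a n).val * V * (K n).val)
        = (K n).valᵀ * (Vᵀ * ((seqProd a n).valᵀ * J (Fin d) ℝ * (seqProd a n).val) * V) *
          (K n).val := by
          rw [transpose_mul, transpose_mul]; simp only [Matrix.mul_assoc]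
      _ = 0 := by rw [hs, hVJ, Matrix.mul_zero, Matrix.zero_mul]
  · simp only
    rw [hVB, hKℓ, hK0, Units.val_mul, Matrix.mul_assoc, ← Matrix.mul_assoc B.val, Units.mul_inv,
      Matrix.one_mul]
    simp [seqProd]
  · simp only
    rw [Units.val_mul, Matrix.mul_assoc _ (K (n + 1)).val, ← Matrix.mul_assoc (K (n + 1)).val,
      Units.mul_inv, Matrix.one_mul, seqProd, Units.val_mul]
    simp only [Matrix.mul_assoc]
  · have hβ : ∀ n, seqProd (fun n => (K (n + 1))⁻¹ * K n) n = (K n)⁻¹ * K 0 := by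
      intro n
      induction n with
      | zero => simp [seqProd]
      | succ n ih => rw [seqProd, ih]; group
    have h2 : seqProd (fun n => (K (n + 1))⁻¹ * K n) ℓ = K₀⁻¹ * B * K₀ := by
      rw [hβ, hK0, hKℓ]; group
    rw [h2, Units.val_mul, Units.val_mul]
    exact charpoly_mul_mul_of_mul_eq_one (Units.mul_inv K₀)

theorem aeval_charpoly_eq_zero_of_hasEigenvalue {ι : Type*} [Fintype ι] [DecidableEq ι]
    {M : Matrix ι ι ℝ} {x : ℝ} : Module.End.HasEigenvalue (toLin' M) x ↔
      aeval (x : ℂ) M.charpoly = 0 := by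
  rw [Module.End.hasEigenvalue_iff_isRoot_charpoly, charpoly_toLin', IsRoot.def]
  have : aeval (x : ℂ) M.charpoly = ((M.charpoly.eval x : ℝ) : ℂ) := by
    rw [← Polynomial.coe_aeval_eq_eval]
    exact aeval_algebraMap_apply ℂ x M.charpoly
  rw [this, Complex.ofReal_eq_zero]

theorem noUnitRoot_of_contracting {B : GL (Fin d) ℝ} (hB : ContractingRoots B.val.charpoly) :
    NoUnitRoot (B.val.charpoly * (B⁻¹).val.charpoly) := by
  intro z hz
  rw [map_mul, mul_eq_zero] at hz
  rcases hz with hz | hz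
  · exact (hB z hz).ne
  · intro h
    have hz0 : z ≠ 0 := by rintro rfl; simp at h
    have h1 := hB _ (aeval_inv_charpoly_eq_zero (Units.inv_mul B) hz0 hz)
    rw [norm_inv, h, inv_one] at h1
    exact lt_irrefl _ h1

theorem hasFarSimpleRealSpectrum_of_contracting {g : Matrix (Fin d ⊕ Fin d) (Fin d ⊕ Fin d) ℝ}
    {B : GL (Fin d) ℝ} (hg : g.charpoly = B.val.charpoly * (B⁻¹).val.charpoly)
    (hB : ContractingRoots B.val.charpoly) (hfar : HasFarSimpleRealSpectrum B.val) :
    HasFarSimpleRealSpectrum g := by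
  obtain ⟨v, hv, hvB⟩ := hfar
  have hroot : ∀ j, aeval (v j : ℂ) B.val.charpoly = 0 := fun j =>
    aeval_charpoly_eq_zero_of_hasEigenvalue.1 (hvB j).1
  have hlt : ∀ j, 0 < |v j| ∧ |v j| < 1 / 2 := by
    intro j
    rcases (hvB j).2 with h | h
    · exact h
    · have h1 := hB _ (hroot j)
      rw [Complex.norm_real, Real.norm_eq_abs] at h1
      have h2 : 2 < |v j| := h
      linarith
  have hinv : ∀ j, 2 < |(v j)⁻¹| := by
    intro j
    rw [abs_inv, lt_inv_comm₀ two_pos (hlt j).1]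
    linarith [(hlt j).2]
  have hne : ∀ i j, v i ≠ (v j)⁻¹ := by
    intro i j h
    have h1 := hinv j
    rw [← h] at h1
    linarith [(hlt i).2]
  refine ⟨Sum.elim v fun j => (v j)⁻¹, hv.sumElim (inv_injective.comp hv) hne, ?_⟩
  rintro (j | j)
  · refine ⟨aeval_charpoly_eq_zero_of_hasEigenvalue.2 ?_, Or.inl (hlt j)⟩
    rw [hg, map_mul, Sum.elim_inl, hroot, zero_mul]
  · refine ⟨aeval_charpoly_eq_zero_of_hasEigenvalue.2 ?_, Or.inr (hinv j)⟩
    rw [hg, map_mul, Sum.elim_inr, Complex.ofReal_inv,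
      aeval_inv_charpoly_eq_zero (B' := B.val) (Units.mul_inv B) ?_ (hroot j), mul_zero]
    exact Complex.ofReal_ne_zero.2 (abs_pos.1 (hlt j).1)

/-- The `GL` deformation `Y` of the restriction to the stable subspace, of size `δ / 2`, is extended
by `symplecticDouble` in orthonormal symplectic frames. The frames of the Lagrangian subspace stay
invariant and the restriction stays contracting. The spectrum therefore consists of that of a
contraction and its inverses, which avoids the unit circle. -/
theorem exists_isDeformation_farSimple_sp (d : ℕ) {δ : ℝ} (hδ : 0 < δ) :
    ∃ T : ℕ, 1 ≤ T ∧ ∀ ℓ, T ≤ ℓ → ∀ a : ℕ → GL (Fin d ⊕ Fin d) ℝ, (∀ n, a n ∈ spSubgroup d) →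
      NoUnitRoot (seqProd a ℓ).val.charpoly → ∃ X,
        IsDeformation (spSubgroup d) δ ℓ a NoUnitRoot X ∧
        HasFarSimpleRealSpectrum (seqProd (X 1 * a) ℓ).val := by
  obtain ⟨T, hT1, hT⟩ := exists_isDeformation_farSimple_gl (Fin d) (half_pos hδ)
  refine ⟨T, hT1, fun ℓ hℓ a ha hhyp => ?_⟩
  obtain ⟨V, B, hV, hVJ, hVB, hB⟩ := exists_lagrangian_stable (seqProd_mem ha ℓ) hhyp
  obtain ⟨U, β, hU, hUJ, hUℓ, haU, hβ⟩ := exists_lagrangian_frames ha (hT1.trans hℓ) hV hVJ hVB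
  obtain ⟨Y, hY, hfar⟩ := hT ℓ hℓ β
  choose Q hQ hQs hQU using fun n => exists_orthogonal_symplectic (hU n) (hUJ n)
  rw [← hβ] at hB
  obtain ⟨X, hX⟩ : ∃ X : ℝ → ℕ → GL (Fin d ⊕ Fin d) ℝ, ∀ t n,
      X t n = Q (n + 1) * symplecticDouble (Y t n) * (Q (n + 1))⁻¹ := ⟨_, fun _ _ => rfl⟩
  have hXs : ∀ t n, X t n ∈ spSubgroup d := fun t n => by
    rw [hX]
    exact mul_mem (mul_mem (hQs _) (symplecticDouble_mem _)) (inv_mem (hQs _))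
  have hXU : ∀ t n, ((X t * a) n).val * U n = U (n + 1) * ((Y t * β) n).val := by
    intro t n
    have h1 : (symplecticDouble (Y t n)).val * inclFst d = inclFst d * (Y t n).val := by
      rw [inclFst_mul]; exact fromBlocks_mul_inclFst _ _ _ _
    have h2 : (X t n).val * U (n + 1) = U (n + 1) * (Y t n).val := by
      rw [hX, ← hQU, Units.val_mul, Units.val_mul, Matrix.mul_assoc, ← Matrix.mul_assoc _ _ (inclFst d),
        Units.inv_mul, Matrix.one_mul, Matrix.mul_assoc, h1, ← Matrix.mul_assoc]
    rw [Pi.mul_apply, Pi.mul_apply, Units.val_mul, Units.val_mul, Matrix.mul_assoc, haU,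
      ← Matrix.mul_assoc, h2, Matrix.mul_assoc]
  have hchar : ∀ t, (seqProd (X t * a) ℓ).val.charpoly =
      (seqProd (Y t * β) ℓ).val.charpoly * ((seqProd (Y t * β) ℓ)⁻¹).val.charpoly := by
    intro t
    have hs : seqProd (X t * a) ℓ ∈ spSubgroup d :=
      seqProd_mem (fun n => mul_mem (hXs t n) (ha n)) ℓ
    refine charpoly_eq_of_lagrangian hs (hU 0) (hUJ 0) ?_
    rw [seqProd_mul_of_mul_eq (hXU t), hUℓ]
  refine ⟨X, ⟨fun n => ?_, ?_, hXs, fun t ht n => ?_, fun t ht => ?_⟩, ?_⟩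
  · simp only [hX]
    exact (continuous_const.mul (continuous_symplecticDouble.comp (hY.continuous n))).mul
      continuous_const
  · ext n : 1
    have h1 : symplecticDouble (1 : GL (Fin d) ℝ) = 1 := Units.ext (by simp [symplecticDouble])
    rw [hX, hY.zero, Pi.one_apply, Pi.one_apply, h1]
    group
  · have := (nearOne_symplecticDouble (hY.near t ht n)).conj (hQ (n + 1))
    rwa [← hX, mul_div_cancel₀ _ two_ne_zero] at this
  · rw [hchar]
    exact noUnitRoot_of_contracting ((hY.prop t ht).2 hB)
  · exact hasFarSimpleRealSpectrum_of_contracting (hchar 1)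
      ((hY.prop 1 ⟨one_pos, le_rfl⟩).2 hB) hfar

end Symplectic

/-! ### From deformations over one period to paths of periodic cocycles. -/

section PerturbationPaths

open Matrix Polynomial

variable {ι : Type*} [Fintype ι] [DecidableEq ι]

theorem cocycleProd_eq_seqProd (A : ℤ → GL ι ℝ) (n : ℕ) :
    cocycleProd A n = seqProd (fun k => A ((k : ℤ) + 1)) n := by
  induction n with
  | zero => rfl
  | succ n ih => rw [cocycleProd, seqProd, ih]

theorem mem_complexEigenvalues_iff {M : Matrix ι ι ℝ} {z : ℂ} :
    z ∈ complexEigenvalues M ↔ aeval z M.charpoly = 0 := by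
  change Module.End.HasEigenvalue _ _ ↔ _
  rw [Module.End.hasEigenvalue_iff_isRoot_charpoly, charpoly_toLin', charpoly_map, IsRoot.def, eval_map_algebraMap]

theorem isHyperbolicCocycle_iff {ℓ : ℕ} {A : ℤ → GL ι ℝ} :
    IsHyperbolicCocycle ℓ A ↔ NoUnitRoot (cocycleProd A ℓ).val.charpoly := by
  simp only [IsHyperbolicCocycle, NoUnitRoot, mem_complexEigenvalues_iff]

theorem IsPeriodicCocycle.max_norm_le {G : Subgroup (GL ι ℝ)} {ℓ : ℕ} {A : ℤ → GL ι ℝ}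
    (hA : IsPeriodicCocycle G ℓ A) {C : ℝ} (hC : IsCocycleBoundedBy C ℓ A) (i : ℤ) :
    max ‖(A i).val‖ ‖(A i)⁻¹.val‖ ≤ C := by
  have hℓ : (0 : ℤ) < ℓ := by exact_mod_cast hA.one_le_period
  have hper : Function.Periodic A (ℓ : ℤ) := hA.periodic
  have h1 : A i = A ((i - 1) % ℓ + 1) := by
    rw [← hper.int_mul ((i - 1) / ℓ) ((i - 1) % ℓ + 1)]
    congr 1
    have := Int.emod_add_mul_ediv (i - 1) ℓ
    rw [Int.cast_id, mul_comm]
    linarith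
  rw [h1]
  exact hC _ (by linarith [Int.emod_nonneg (i - 1) hℓ.ne'])
    (by linarith [Int.add_one_le_of_lt (Int.emod_lt_of_pos (i - 1) hℓ)])

/-- A deformation of a periodic cocycle over one period extends to a path of perturbations. -/
theorem exists_isPerturbationPath {G : Subgroup (GL ι ℝ)} {ℓ : ℕ} {A : ℤ → GL ι ℝ}
    (hA : IsPeriodicCocycle G ℓ A) {C : ℝ} (hC : IsCocycleBoundedBy C ℓ A) {δ ε : ℝ}
    (hδ : (Real.exp δ - 1) * C < ε) {H : ℝ[X] → Prop} {X : ℝ → ℕ → GL ι ℝ}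
    (hX : IsDeformation G δ ℓ (fun n : ℕ => A ((n : ℤ) + 1)) H X) :
    ∃ P : unitInterval → ℤ → GL ι ℝ, IsPerturbationPath G ε ℓ A P ∧
      (∀ t : unitInterval, 0 < t → H (cocycleProd (P t) ℓ).val.charpoly) ∧
      cocycleProd (P 1) ℓ = seqProd (X 1 * fun n : ℕ => A ((n : ℤ) + 1)) ℓ := by
  have hprod : ∀ t : ℝ, cocycleProd (fun i => X t ((i - 1) % ℓ).toNat * A i) ℓ =
      seqProd (X t * fun n : ℕ => A ((n : ℤ) + 1)) ℓ := by
    intro t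
    rw [cocycleProd_eq_seqProd]
    refine seqProd_congr fun k hk => ?_
    have h1 : ((k : ℤ) + 1 - 1) % ℓ = k := by
      rw [add_sub_cancel_right]
      exact Int.emod_eq_of_lt (by positivity) (by exact_mod_cast hk)
    rw [h1, Int.toNat_natCast, Pi.mul_apply]
  -- Sequences start at `0` and cocycle products at `A 1`, hence the shift by one; the reduction
  -- modulo `ℓ` makes the perturbation periodic.
  refine ⟨fun t i => X t ((i - 1) % ℓ).toNat * A i, ⟨fun t => ⟨hA.one_le_period,
    fun i => mul_mem (hX.mem _ _) (hA.mem i), fun i => ?_⟩, fun i => ?_, fun i => ?_, fun t i => ?_⟩,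
    fun t ht => ?_, hprod 1⟩
  · rw [hA.periodic, show i + (ℓ : ℤ) - 1 = i - 1 + ℓ by ring, Int.add_emod_right]
  · exact Units.continuous_val.comp
      (((hX.continuous _).comp continuous_subtype_val).mul continuous_const)
  · simp [hX.zero]
  · obtain ⟨h1, h2⟩ := hX.near t t.2 ((i - 1) % ℓ).toNat
    obtain ⟨h3, h4⟩ := max_le_iff.1 (hA.max_norm_le hC i)
    generalize X t ((i - 1) % ℓ).toNat = Y at h1 h2
    refine (max_le ?_ ?_).trans_lt hδ
    · have e : (A i).val - (Y * A i).val = -((Y.val - 1) * (A i).val) := by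
        rw [Units.val_mul]; noncomm_ring
      rw [e, norm_neg]
      refine (norm_mul_le _ _).trans (mul_le_mul h1 h3 (norm_nonneg _) ((norm_nonneg _).trans h1))
    · have e : (A i)⁻¹.val - (Y * A i)⁻¹.val = -((A i)⁻¹.val * (Y⁻¹.val - 1)) := by
        rw [_root_.mul_inv_rev, Units.val_mul]; noncomm_ring
      rw [e, norm_neg, mul_comm (Real.exp δ - 1)]
      refine (norm_mul_le _ _).trans (mul_le_mul h4 h2 (norm_nonneg _) ((norm_nonneg _).trans h4))
  · rw [hprod]
    exact hX.prop t ⟨ht, t.2.2⟩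

theorem exists_exp_sub_one_mul_lt {C ε : ℝ} (hC : 0 < C) (hε : 0 < ε) :
    ∃ δ : ℝ, 0 < δ ∧ (Real.exp δ - 1) * C < ε := by
  refine ⟨Real.log (1 + ε / (2 * C)), Real.log_pos (by linarith [div_pos hε (mul_pos two_pos hC)]), ?_⟩
  rw [Real.exp_log (by positivity)]
  have : (1 + ε / (2 * C) - 1) * C = ε / 2 := by field_simp; ring
  rw [this]
  linarith

end PerturbationPaths
theorem mainTheorem9 (d₀ : ℕ) (hd₀ : 1 ≤ d₀) (C : ℝ) (hC : 1 < C) (ε : ℝ) (hε : 0 < ε) :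
    ∃ T : ℕ, 1 ≤ T ∧
      -- the group `GL(d₀, ℝ)`
      (∀ (ℓ : ℕ) (A : ℤ → GL (Fin d₀) ℝ), T ≤ ℓ → IsPeriodicCocycle ⊤ ℓ A →
        IsCocycleBoundedBy C ℓ A →
        ∃ P : unitInterval → ℤ → GL (Fin d₀) ℝ,
          IsPerturbationPath ⊤ ε ℓ A P ∧
          (∀ t : unitInterval, 0 < t → IsHyperbolicCocycle ℓ (P t)) ∧
          HasFarSimpleRealSpectrum (cocycleProd (P 1) ℓ : Matrix (Fin d₀) (Fin d₀) ℝ)) ∧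
      -- the group `SL(d₀, ℝ)`, with `d₀ ≥ 2`
      (2 ≤ d₀ → ∀ (ℓ : ℕ) (A : ℤ → GL (Fin d₀) ℝ), T ≤ ℓ →
        IsPeriodicCocycle (slSubgroup (Fin d₀)) ℓ A → IsCocycleBoundedBy C ℓ A →
        ∃ P : unitInterval → ℤ → GL (Fin d₀) ℝ,
          IsPerturbationPath (slSubgroup (Fin d₀)) ε ℓ A P ∧
          ((d₀ = 2 → ∀ z ∈ complexEigenvalues
              (cocycleProd A ℓ : Matrix (Fin d₀) (Fin d₀) ℝ), z.im = 0) →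
            ∀ t : unitInterval, 0 < t → IsHyperbolicCocycle ℓ (P t)) ∧
          HasFarSimpleRealSpectrum (cocycleProd (P 1) ℓ : Matrix (Fin d₀) (Fin d₀) ℝ)) ∧
      -- the group `Sp(d₀, ℝ)`, with `d₀ = 2 d`, for hyperbolic cocycles
      (∀ d : ℕ, d₀ = 2 * d → ∀ (ℓ : ℕ) (A : ℤ → GL (Fin d ⊕ Fin d) ℝ), T ≤ ℓ →
        IsPeriodicCocycle (spSubgroup d) ℓ A → IsCocycleBoundedBy C ℓ A →
        IsHyperbolicCocycle ℓ A →
        ∃ P : unitInterval → ℤ → GL (Fin d ⊕ Fin d) ℝ,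
          IsPerturbationPath (spSubgroup d) ε ℓ A P ∧
          (∀ t : unitInterval, 0 < t → IsHyperbolicCocycle ℓ (P t)) ∧
          HasFarSimpleRealSpectrum
            (cocycleProd (P 1) ℓ : Matrix (Fin d ⊕ Fin d) (Fin d ⊕ Fin d) ℝ)) := by
  obtain ⟨δ, hδ, hδε⟩ := exists_exp_sub_one_mul_lt (one_pos.trans hC) hε
  obtain ⟨T₁, hT₁, hgl⟩ := exists_isDeformation_farSimple_gl (Fin d₀) hδ
  obtain ⟨T₂, hsl⟩ : ∃ T₂ : ℕ, 2 ≤ d₀ → ∀ ℓ, T₂ ≤ ℓ → ∀ a : ℕ → GL (Fin d₀) ℝ,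
      (∀ n, a n ∈ slSubgroup (Fin d₀)) → ∃ Y, IsDeformation (slSubgroup (Fin d₀)) δ ℓ a
        (fun p => (d₀ = 2 → RealRoots (seqProd a ℓ).val.charpoly) → NoUnitRoot p) Y ∧
        HasFarSimpleRealSpectrum (seqProd (Y 1 * a) ℓ).val := by
    by_cases h2 : 2 ≤ d₀
    · obtain ⟨T, -, hT⟩ := exists_isDeformation_farSimple_sl (Fin d₀) (by simpa using h2) hδ
      exact ⟨T, fun _ => by simpa only [Fintype.card_fin] using hT⟩
    · exact ⟨0, fun h => absurd h h2⟩
  -- `T` is chosen before `d`, so the half dimension is written `d₀ / 2` and identified with `d`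
  -- afterwards.
  obtain ⟨T₃, -, hsp⟩ := exists_isDeformation_farSimple_sp (d₀ / 2) hδ
  refine ⟨max T₁ (max T₂ T₃), hT₁.trans (le_max_left _ _), fun ℓ A hℓ hA hAC => ?_,
    fun h2 ℓ A hℓ hA hAC => ?_, ?_⟩
  · obtain ⟨X, hX, hfar⟩ := hgl ℓ ((le_max_left _ _).trans hℓ) fun n : ℕ => A ((n : ℤ) + 1)
    obtain ⟨P, hP, hhyp, hP1⟩ := exists_isPerturbationPath hA hAC hδε hX
    exact ⟨P, hP, fun t ht => isHyperbolicCocycle_iff.2 (hhyp t ht).1, by rw [hP1]; exact hfar⟩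
  · obtain ⟨X, hX, hfar⟩ := hsl h2 ℓ (((le_max_left _ _).trans (le_max_right _ _)).trans hℓ)
      (fun n : ℕ => A ((n : ℤ) + 1)) fun n => hA.mem _
    obtain ⟨P, hP, hhyp, hP1⟩ := exists_isPerturbationPath hA hAC hδε hX
    refine ⟨P, hP, fun hreal t ht => isHyperbolicCocycle_iff.2 (hhyp t ht fun h z hz => ?_),
      by rw [hP1]; exact hfar⟩
    rw [← cocycleProd_eq_seqProd] at hz
    exact hreal h z (mem_complexEigenvalues_iff.2 hz)
  · rintro d rfl ℓ A hℓ hA hAC hAh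
    rw [Nat.mul_div_cancel_left d two_pos] at hsp
    rw [isHyperbolicCocycle_iff, cocycleProd_eq_seqProd] at hAh
    obtain ⟨X, hX, hfar⟩ := hsp ℓ (((le_max_right _ _).trans (le_max_right _ _)).trans hℓ)
      (fun n : ℕ => A ((n : ℤ) + 1)) (fun n => hA.mem _) hAh
    obtain ⟨P, hP, hhyp, hP1⟩ := exists_isPerturbationPath hA hAC hδε hX
    exact ⟨P, hP, fun t ht => isHyperbolicCocycle_iff.2 (hhyp t ht), by rw [hP1]; exact hfar⟩
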